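/- Let $\lambda>0$, $\mathbb R_+=(0,\infty)$, $dm_\lambda(x)=x^{2\lambda}\,dx$, $\mu_\lambda=m_\lambda\times m_\lambda$ on $\mathbb R_+\times\mathbb R_+$, and write $\mathbb R_\lambda=(\mathbb R_+\times\mathbb R_+,\mu_\lambda)$. A rectangle is a set $R=I(x_1,t_1)\times I(x_2,t_2)$ with $x_i,t_i>0$ and $I(x,t)=(x-t,x+t)\cap\mathbb R_+$. Functions are complex valued. The space $\mathrm{bmo}(\mathbb R_\lambda)$ consists of the $b\in L^1_{loc}(\mathbb R_\lambda)$ with $$\|b\|_{\mathrm{bmo}}=\sup_R\frac1{\mu_\lambda(R)}\iint_R|b-m_R(b)|\,d\mu_\lambda<\infty,\qquad m_R(b)=\frac1{\mu_\lambda(R)}\iint_R b\,d\mu_\lambda,$$ the supremum being over all rectangles $R$. For $q\in(1,\infty]$, a $q$-atom is a function $a\in L^q(\mathbb R_\lambda)$ vanishing outside a rectangle $R$, with $\|a\|_{L^q}\le\mu_\lambda(R)^{1/q-1}$ and $\int a\,d\mu_\lambda=0$. The little Hardy space $h^{1,q}(\mathbb R_\lambda)$ consists of the functions $f=\sum_i\alpha_ia_i$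 (convergence in $L^1(\mathbb R_\lambda)$) with $q$-atoms $a_i$ and $\alpha_i\in\mathbb C$, $\sum_i|\alpha_i|<\infty$; its norm $\|f\|_{h^{1,q}}$ is the infimum of $\sum_i|\alpha_i|$ over all such representations. Theorem. For every $\lambda>0$ and $q\in(1,\infty]$, the space $h^{1,q}(\mathbb R_\lambda)$ is a Banach space and its dual is $\mathrm{bmo}(\mathbb R_\lambda)$ modulo constants, with equivalent norms. Precisely, there are a linear map $\Phi$ from $\mathrm{bmo}(\mathbb R_\lambda)$ to the dual $(h^{1,q}(\mathbb R_\lambda))^*$ and a constant $C>0$ depending only on $\lambda$ and $q$ such that: (a) for every $b\in\mathrm{bmo}(\mathbb R_\lambda)$ and every finite linear combination $f$ of $q$-atoms, $bf$ is integrable and $\Phi(b)(f)=\int bf\,d\mu_\lambda$; (b) $\Phi$ is surjective; (c) $\Phi(b)=0$ if and only if $b$ is almost everywhere equal to a constant; (d) $C^{-1}\|b\|_{\mathrm{bmo}}\le\|\Phi(b)\|\le C\|b\|_{\mathrm{bmo}}$ for every $b\in\mathrm{bmo}(\mathbb R_\lambda)$. -/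

import Mathlib

open MeasureTheory Set
open scoped ENNReal

noncomputable section

namespace Bessel

/-- The measure `dm_λ(x) = x ^ (2λ) dx` on `ℝ₊ = (0, ∞)`, as a measure on `ℝ` that does not
charge the complement of `(0, ∞)`. -/
def lineMeasure (lam : ℝ) : Measure ℝ :=
  (volume.restrict (Ioi 0)).withDensity fun x => ENNReal.ofReal (x ^ (2 * lam))

/-- The product measure `μ_λ = m_λ × m_λ` on `ℝ₊ × ℝ₊`. -/
def planeMeasure (lam : ℝ) : Measure (ℝ × ℝ) :=
  (lineMeasure lam).prod (lineMeasure lam)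

/-- The open quadrant `ℝ₊ × ℝ₊`. -/
def quadrant : Set (ℝ × ℝ) := Ioi 0 ×ˢ Ioi 0

/-- The interval `I(x, t) = (x - t, x + t) ∩ ℝ₊`. -/
def interval (x t : ℝ) : Set ℝ := Ioo (x - t) (x + t) ∩ Ioi 0

/-- Rectangles `I(x₁, t₁) × I(x₂, t₂)` in `ℝ₊ × ℝ₊`. -/
def IsRectangle (R : Set (ℝ × ℝ)) : Prop :=
  ∃ x₁ t₁ x₂ t₂ : ℝ, 0 < x₁ ∧ 0 < t₁ ∧ 0 < x₂ ∧ 0 < t₂ ∧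
    R = interval x₁ t₁ ×ˢ interval x₂ t₂

theorem IsRectangle.measurableSet {R : Set (ℝ × ℝ)} (hR : IsRectangle R) : MeasurableSet R := by
  obtain ⟨x₁, t₁, x₂, t₂, -, -, -, -, rfl⟩ := hR
  exact (measurableSet_Ioo.inter measurableSet_Ioi).prod
    (measurableSet_Ioo.inter measurableSet_Ioi)

theorem exists_isRectangle : ∃ R, IsRectangle R :=
  ⟨_, 1, 1, 1, 1, one_pos, one_pos, one_pos, one_pos, rfl⟩

/-! ### The little bmo space -/

/-- The mean oscillation `μ_λ(R)⁻¹ ∬_R |b - m_R(b)| dμ_λ`, with values in `[0, ∞]`; here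
`m_R(b)` is the mean value of `b` over `R`. -/
def meanOsc (lam : ℝ) (b : ℝ × ℝ → ℂ) (R : Set (ℝ × ℝ)) : ℝ≥0∞ :=
  (planeMeasure lam R)⁻¹ *
    ∫⁻ x in R, ‖b x - ⨍ y in R, b y ∂(planeMeasure lam)‖ₑ ∂(planeMeasure lam)

/-- The supremum of the mean oscillations of `b` over all rectangles. If `b` is locally
integrable but not integrable over some rectangle touching the axes, this is `∞`. -/
def bmoNorm (lam : ℝ) (b : ℝ × ℝ → ℂ) : ℝ≥0∞ :=
  ⨆ (R : Set (ℝ × ℝ)) (_ : IsRectangle R), meanOsc lam b R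

/-- `b ∈ L¹_loc(ℝ_λ)` with finite bmo norm. -/
def MemBMO (lam : ℝ) (b : ℝ × ℝ → ℂ) : Prop :=
  LocallyIntegrableOn b quadrant (planeMeasure lam) ∧ bmoNorm lam b < ∞

theorem meanOsc_le_bmoNorm (lam : ℝ) (b : ℝ × ℝ → ℂ) {R : Set (ℝ × ℝ)} (hR : IsRectangle R) :
    meanOsc lam b R ≤ bmoNorm lam b :=
  le_iSup₂_of_le R hR le_rfl

theorem meanOsc_congr {lam : ℝ} {b c : ℝ × ℝ → ℂ} (h : b =ᵐ[planeMeasure lam] c)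
    (R : Set (ℝ × ℝ)) : meanOsc lam b R = meanOsc lam c R := by
  have h' := ae_restrict_of_ae (s := R) h
  have hm : ⨍ y in R, b y ∂(planeMeasure lam) = ⨍ y in R, c y ∂(planeMeasure lam) :=
    average_congr h'
  unfold meanOsc
  rw [hm]
  congr 1
  apply lintegral_congr_ae
  filter_upwards [h'] with x hx
  rw [hx]

theorem bmoNorm_congr {lam : ℝ} {b c : ℝ × ℝ → ℂ} (h : b =ᵐ[planeMeasure lam] c) :
    bmoNorm lam b = bmoNorm lam c := by
  unfold bmoNorm
  simp only [meanOsc_congr h]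

theorem locallyIntegrableOn_congr {lam : ℝ} {b c : ℝ × ℝ → ℂ}
    (h : b =ᵐ[planeMeasure lam] c) (hb : LocallyIntegrableOn b quadrant (planeMeasure lam)) :
    LocallyIntegrableOn c quadrant (planeMeasure lam) := fun x hx => by
  obtain ⟨s, hs, hi⟩ := hb x hx
  exact ⟨s, hs, hi.congr (ae_restrict_of_ae h)⟩

theorem memBMO_congr {lam : ℝ} {b c : ℝ × ℝ → ℂ}
    (h : b =ᵐ[planeMeasure lam] c) (hb : MemBMO lam b) : MemBMO lam c :=
  ⟨locallyIntegrableOn_congr h hb.1, bmoNorm_congr h ▸ hb.2⟩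

theorem integrableOn_of_bmoNorm {lam : ℝ} {b : ℝ × ℝ → ℂ}
    (hm : AEStronglyMeasurable b (planeMeasure lam)) (hb : bmoNorm lam b < ∞)
    {R : Set (ℝ × ℝ)} (hR : IsRectangle R) (hfin : planeMeasure lam R ≠ ∞) :
    IntegrableOn b R (planeMeasure lam) := by
  have h1 : meanOsc lam b R < ∞ := (meanOsc_le_bmoNorm lam b hR).trans_lt hb
  unfold meanOsc at h1
  have h2 : ∫⁻ x in R, ‖b x - ⨍ y in R, b y ∂(planeMeasure lam)‖ₑ ∂(planeMeasure lam) < ∞ := by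
    by_contra hcon
    rw [not_lt, top_le_iff] at hcon
    rw [hcon, ENNReal.mul_top (ENNReal.inv_ne_zero.2 hfin)] at h1
    exact lt_irrefl _ h1
  have h3 : IntegrableOn (fun x => b x - ⨍ y in R, b y ∂(planeMeasure lam)) R
      (planeMeasure lam) :=
    ⟨(hm.restrict.sub aestronglyMeasurable_const), h2⟩
  have h4 : IntegrableOn (fun _ => ⨍ y in R, b y ∂(planeMeasure lam)) R (planeMeasure lam) :=
    integrableOn_const hfin
  exact (h3.add h4).congr (Filter.Eventually.of_forall fun x => by simp)

theorem bmoNorm_add_le {lam : ℝ} {b c : ℝ × ℝ → ℂ}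
    (hbm : AEStronglyMeasurable b (planeMeasure lam))
    (hcm : AEStronglyMeasurable c (planeMeasure lam))
    (hb : bmoNorm lam b < ∞) (hc : bmoNorm lam c < ∞) :
    bmoNorm lam (b + c) ≤ bmoNorm lam b + bmoNorm lam c := by
  refine iSup₂_le fun R hR => ?_
  by_cases hfin : planeMeasure lam R = ∞
  · simp [meanOsc, hfin]
  refine le_trans ?_ (add_le_add (meanOsc_le_bmoNorm lam b hR) (meanOsc_le_bmoNorm lam c hR))
  have hbi := integrableOn_of_bmoNorm hbm hb hR hfin
  have hci := integrableOn_of_bmoNorm hcm hc hR hfin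
  have hav : ⨍ y in R, (b + c) y ∂(planeMeasure lam) =
      ⨍ y in R, b y ∂(planeMeasure lam) + ⨍ y in R, c y ∂(planeMeasure lam) := by
    rw [setAverage_eq, setAverage_eq, setAverage_eq, ← smul_add]
    congr 1
    exact integral_add hbi hci
  unfold meanOsc
  rw [hav, ← mul_add, ← lintegral_add_left']
  · gcongr with x
    rw [Pi.add_apply, add_sub_add_comm]
    exact enorm_add_le _ _
  · exact (hbm.restrict.sub aestronglyMeasurable_const).enorm

theorem bmoNorm_smul (lam : ℝ) (z : ℂ) (b : ℝ × ℝ → ℂ) :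
    bmoNorm lam (z • b) = ‖z‖ₑ * bmoNorm lam b := by
  unfold bmoNorm
  rw [ENNReal.mul_iSup]
  congr 1
  ext R
  rw [ENNReal.mul_iSup]
  congr 1
  ext hR
  have hav : ⨍ y in R, (z • b) y ∂(planeMeasure lam) =
      z • ⨍ y in R, b y ∂(planeMeasure lam) := by
    rw [setAverage_eq, setAverage_eq, smul_comm]
    congr 1
    exact integral_smul z b
  unfold meanOsc
  rw [hav, mul_left_comm]
  congr 1
  rw [← lintegral_const_mul' _ _ enorm_ne_top]
  congr 1
  ext x
  rw [Pi.smul_apply, ← smul_sub, enorm_smul]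

/-- The functions (modulo equality almost everywhere) in `bmo(ℝ_λ)`, as a linear subspace. -/
def littleBMOSubmodule (lam : ℝ) : Submodule ℂ ((ℝ × ℝ) →ₘ[planeMeasure lam] ℂ) where
  carrier := {b | MemBMO lam b}
  zero_mem' := by
    refine memBMO_congr (AEEqFun.coeFn_zero (β := ℂ)).symm ⟨?_, ?_⟩
    · intro x _
      exact ⟨univ, Filter.univ_mem, integrableOn_zero⟩
    · simpa using (bmoNorm_smul lam 0 0).trans_lt (by simp)
  add_mem' := by
    intro b c hb hc
    refine memBMO_congr (AEEqFun.coeFn_add b c).symm ⟨hb.1.add hc.1, ?_⟩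
    exact (bmoNorm_add_le b.aestronglyMeasurable c.aestronglyMeasurable hb.2 hc.2).trans_lt
      (ENNReal.add_lt_top.2 ⟨hb.2, hc.2⟩)
  smul_mem' := by
    intro z b hb
    refine memBMO_congr (AEEqFun.coeFn_smul z b).symm ⟨hb.1.smul z, ?_⟩
    rw [bmoNorm_smul]
    exact ENNReal.mul_lt_top enorm_lt_top hb.2

/-- The space `bmo(ℝ_λ)`. Its norm is only a seminorm, since constants have norm `0`. -/
def LittleBMO (lam : ℝ) : Type := ↥(littleBMOSubmodule lam)

namespace LittleBMO

instance (lam : ℝ) : AddCommGroup (LittleBMO lam) :=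
  inferInstanceAs (AddCommGroup ↥(littleBMOSubmodule lam))

instance (lam : ℝ) : Module ℂ (LittleBMO lam) :=
  inferInstanceAs (Module ℂ ↥(littleBMOSubmodule lam))

/-- The almost everywhere class underlying an element of `bmo(ℝ_λ)`. -/
def toAEEqFun {lam : ℝ} (b : LittleBMO lam) : (ℝ × ℝ) →ₘ[planeMeasure lam] ℂ :=
  Subtype.val (p := (· ∈ littleBMOSubmodule lam)) b

instance (lam : ℝ) : CoeFun (LittleBMO lam) fun _ => ℝ × ℝ → ℂ := ⟨fun b => b.toAEEqFun⟩

theorem memBMO {lam : ℝ} (b : LittleBMO lam) : MemBMO lam b :=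
  Subtype.prop (p := (· ∈ littleBMOSubmodule lam)) b

instance (lam : ℝ) : Norm (LittleBMO lam) := ⟨fun b => (bmoNorm lam b).toReal⟩

theorem norm_def {lam : ℝ} (b : LittleBMO lam) : ‖b‖ = (bmoNorm lam b).toReal := rfl

theorem core (lam : ℝ) : SeminormedSpace.Core ℂ (LittleBMO lam) where
  norm_nonneg _ := ENNReal.toReal_nonneg
  norm_smul z b := by
    have h : bmoNorm lam (z • b : LittleBMO lam) = ‖z‖ₑ * bmoNorm lam b :=
      (bmoNorm_congr (AEEqFun.coeFn_smul z b.toAEEqFun)).trans (bmoNorm_smul lam z b)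
    rw [norm_def, norm_def, h, ENNReal.toReal_mul, toReal_enorm]
  norm_triangle b c := by
    have h : bmoNorm lam (b + c : LittleBMO lam) ≤ bmoNorm lam b + bmoNorm lam c :=
      (bmoNorm_congr (AEEqFun.coeFn_add b.toAEEqFun c.toAEEqFun)).trans_le
        (bmoNorm_add_le b.toAEEqFun.aestronglyMeasurable c.toAEEqFun.aestronglyMeasurable
          b.memBMO.2 c.memBMO.2)
    rw [norm_def, norm_def, norm_def, ← ENNReal.toReal_add b.memBMO.2.ne c.memBMO.2.ne]
    exact ENNReal.toReal_mono (ENNReal.add_lt_top.2 ⟨b.memBMO.2, c.memBMO.2⟩).ne h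

instance (lam : ℝ) : SeminormedAddCommGroup (LittleBMO lam) :=
  SeminormedAddCommGroup.ofCore (core lam)

instance (lam : ℝ) : NormedSpace ℂ (LittleBMO lam) where
  norm_smul_le z b := ((core lam).norm_smul z b).le

end LittleBMO

/-! ### The little Hardy space -/

/-- A `q`-atom: a function `a ∈ L^q(ℝ_λ)` vanishing outside a rectangle `R`, with
`‖a‖_q ≤ μ_λ(R) ^ (1/q - 1)` and integral zero. Since such a function is integrable, atoms are
taken as elements of `L¹(ℝ_λ)`. -/
def IsAtom (lam : ℝ) (q : ℝ≥0∞) (a : Lp ℂ 1 (planeMeasure lam)) : Prop :=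
  MemLp a q (planeMeasure lam) ∧
  (∃ R : Set (ℝ × ℝ), IsRectangle R ∧ (∀ᵐ x ∂(planeMeasure lam), x ∉ R → a x = 0) ∧
    eLpNorm a q (planeMeasure lam) ≤ planeMeasure lam R ^ ((q⁻¹).toReal - 1)) ∧
  ∫ x, a x ∂(planeMeasure lam) = 0

theorem isAtom_zero (lam : ℝ) (q : ℝ≥0∞) : IsAtom lam q 0 := by
  have h0 : ((0 : Lp ℂ 1 (planeMeasure lam)) : ℝ × ℝ → ℂ) =ᵐ[planeMeasure lam] 0 :=
    Lp.coeFn_zero ..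
  obtain ⟨R, hR⟩ := exists_isRectangle
  refine ⟨(memLp_congr_ae h0).2 MemLp.zero, ⟨R, hR, ?_, ?_⟩, ?_⟩
  · filter_upwards [h0] with x hx _
    simpa using hx
  · rw [eLpNorm_congr_ae h0]
    simp
  · rw [integral_congr_ae h0]
    simp

theorem IsAtom.norm_le_one {lam : ℝ} {q : ℝ≥0∞} (hq : 1 < q) {a : Lp ℂ 1 (planeMeasure lam)}
    (ha : IsAtom lam q a) : ‖a‖ ≤ 1 := by
  obtain ⟨-, ⟨R, hR, hsupp, hle⟩, -⟩ := ha
  have hind : (a : ℝ × ℝ → ℂ) =ᵐ[planeMeasure lam] R.indicator a := by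
    filter_upwards [hsupp] with x hx
    by_cases hxR : x ∈ R
    · simp [hxR]
    · simp [hxR, hx hxR]
  have hres : eLpNorm a 1 (planeMeasure lam) = eLpNorm a 1 ((planeMeasure lam).restrict R) := by
    rw [eLpNorm_congr_ae hind, eLpNorm_indicator_eq_eLpNorm_restrict hR.measurableSet]
  have h1 : eLpNorm a 1 (planeMeasure lam) ≤ 1 := by
    calc eLpNorm a 1 (planeMeasure lam) = eLpNorm a 1 ((planeMeasure lam).restrict R) := hres
      _ ≤ eLpNorm a q ((planeMeasure lam).restrict R) *
          (planeMeasure lam).restrict R univ ^ (1 / (1 : ℝ≥0∞).toReal - 1 / q.toReal) :=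
        eLpNorm_le_eLpNorm_mul_rpow_measure_univ hq.le (Lp.aestronglyMeasurable a).restrict
      _ ≤ planeMeasure lam R ^ ((q⁻¹).toReal - 1) * planeMeasure lam R ^ (1 - (q⁻¹).toReal) := by
        rw [Measure.restrict_apply_univ, ENNReal.toReal_inv]
        simp only [ENNReal.toReal_one, one_div, inv_one]
        rw [ENNReal.toReal_inv] at hle
        gcongr
        exact (eLpNorm_mono_measure _ Measure.restrict_le_self).trans hle
      _ ≤ 1 := by
        rw [← neg_sub, ENNReal.rpow_neg]
        exact ENNReal.inv_mul_le_one _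
  rw [Lp.norm_def]
  exact ENNReal.toReal_le_of_le_ofReal zero_le_one (by simpa using h1)

/-- `f = ∑ αᵢ aᵢ` in `L¹(ℝ_λ)`, with `q`-atoms `aᵢ` and `∑ |αᵢ| < ∞`. -/
structure IsAtomicDecomposition (lam : ℝ) (q : ℝ≥0∞) (f : Lp ℂ 1 (planeMeasure lam))
    (α : ℕ → ℂ) (a : ℕ → Lp ℂ 1 (planeMeasure lam)) : Prop where
  isAtom : ∀ i, IsAtom lam q (a i)
  summable : Summable fun i => ‖α i‖
  hasSum : HasSum (fun i => α i • a i) f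

theorem IsAtomicDecomposition.zero (lam : ℝ) (q : ℝ≥0∞) :
    IsAtomicDecomposition lam q 0 0 0 where
  isAtom _ := isAtom_zero lam q
  summable := by simp
  hasSum := by simp

theorem IsAtomicDecomposition.smul {lam : ℝ} {q : ℝ≥0∞} {f : Lp ℂ 1 (planeMeasure lam)}
    {α : ℕ → ℂ} {a : ℕ → Lp ℂ 1 (planeMeasure lam)} (h : IsAtomicDecomposition lam q f α a)
    (z : ℂ) : IsAtomicDecomposition lam q (z • f) (fun i => z * α i) a where
  isAtom := h.isAtom
  summable := by simpa only [norm_mul] using h.summable.mul_left ‖z‖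
  hasSum := by simpa only [smul_smul] using h.hasSum.const_smul z

theorem exists_interleave {E : Type*} [NormedAddCommGroup E] [NormedSpace ℂ E] {P : E → Prop}
    {f g : E} {α β : ℕ → ℂ} {a b : ℕ → E} (ha : ∀ i, P (a i)) (hb : ∀ i, P (b i))
    (hα : Summable fun i => ‖α i‖) (hβ : Summable fun i => ‖β i‖)
    (hf : HasSum (fun i => α i • a i) f) (hg : HasSum (fun i => β i • b i) g) :
    ∃ (γ : ℕ → ℂ) (c : ℕ → E), (∀ i, P (c i)) ∧ (Summable fun i => ‖γ i‖) ∧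
      HasSum (fun i => γ i • c i) (f + g) ∧ ∑' i, ‖γ i‖ = ∑' i, ‖α i‖ + ∑' i, ‖β i‖ := by
  obtain ⟨e⟩ : Nonempty (ℕ ≃ ℕ ⊕ ℕ) := ⟨Equiv.natSumNatEquivNat.symm⟩
  have hs : HasSum (fun s : ℕ ⊕ ℕ => ‖Sum.elim α β s‖) (∑' i, ‖α i‖ + ∑' i, ‖β i‖) :=
    HasSum.sum hα.hasSum hβ.hasSum
  have hs' := e.hasSum_iff.2 hs
  have hfg : HasSum (fun s : ℕ ⊕ ℕ => Sum.elim α β s • Sum.elim a b s) (f + g) :=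
    HasSum.sum hf hg
  have hP : ∀ s, P (Sum.elim a b s) := by
    rintro (i | i)
    · exact ha i
    · exact hb i
  exact ⟨Sum.elim α β ∘ e, Sum.elim a b ∘ e, fun i => hP (e i), hs'.summable,
    e.hasSum_iff.2 hfg, hs'.tsum_eq⟩

theorem IsAtomicDecomposition.add {lam : ℝ} {q : ℝ≥0∞} {f g : Lp ℂ 1 (planeMeasure lam)}
    {α β : ℕ → ℂ} {a b : ℕ → Lp ℂ 1 (planeMeasure lam)}
    (h : IsAtomicDecomposition lam q f α a) (k : IsAtomicDecomposition lam q g β b) :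
    ∃ γ c, IsAtomicDecomposition lam q (f + g) γ c ∧
      ∑' i, ‖γ i‖ = ∑' i, ‖α i‖ + ∑' i, ‖β i‖ := by
  obtain ⟨γ, c, h1, h2, h3, h4⟩ := exists_interleave h.isAtom k.isAtom h.summable k.summable
    h.hasSum k.hasSum
  exact ⟨γ, c, ⟨h1, h2, h3⟩, h4⟩

/-- The functions in `h^{1,q}(ℝ_λ)`, as a linear subspace of `L¹(ℝ_λ)`. -/
def littleHardySubmodule (lam : ℝ) (q : ℝ≥0∞) : Submodule ℂ (Lp ℂ 1 (planeMeasure lam)) where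
  carrier := {f | ∃ α a, IsAtomicDecomposition lam q f α a}
  zero_mem' := ⟨_, _, IsAtomicDecomposition.zero lam q⟩
  add_mem' := by
    rintro f g ⟨α, a, h⟩ ⟨β, b, k⟩
    obtain ⟨γ, c, hc, -⟩ := h.add k
    exact ⟨γ, c, hc⟩
  smul_mem' := by
    rintro z f ⟨α, a, h⟩
    exact ⟨_, _, h.smul z⟩

/-- The norm `inf ∑ |αᵢ|` over all atomic decompositions. -/
def atomicNorm (lam : ℝ) (q : ℝ≥0∞) (f : Lp ℂ 1 (planeMeasure lam)) : ℝ :=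
  sInf {r | ∃ α a, IsAtomicDecomposition lam q f α a ∧ r = ∑' i, ‖α i‖}

theorem atomicNorm_nonneg (lam : ℝ) (q : ℝ≥0∞) (f : Lp ℂ 1 (planeMeasure lam)) :
    0 ≤ atomicNorm lam q f := by
  apply Real.sInf_nonneg
  rintro r ⟨α, a, -, rfl⟩
  exact tsum_nonneg fun _ => norm_nonneg _

theorem atomicNorm_le {lam : ℝ} {q : ℝ≥0∞} {f : Lp ℂ 1 (planeMeasure lam)}
    {α : ℕ → ℂ} {a : ℕ → Lp ℂ 1 (planeMeasure lam)} (h : IsAtomicDecomposition lam q f α a) :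
    atomicNorm lam q f ≤ ∑' i, ‖α i‖ := by
  refine csInf_le ⟨0, ?_⟩ ⟨α, a, h, rfl⟩
  rintro r ⟨α, a, -, rfl⟩
  exact tsum_nonneg fun _ => norm_nonneg _

theorem exists_lt_of_atomicNorm_lt {lam : ℝ} {q : ℝ≥0∞} {f : Lp ℂ 1 (planeMeasure lam)}
    (hf : f ∈ littleHardySubmodule lam q) {ε : ℝ} (hε : atomicNorm lam q f < ε) :
    ∃ α a, IsAtomicDecomposition lam q f α a ∧ ∑' i, ‖α i‖ < ε := by
  obtain ⟨α, a, h⟩ := hf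
  have hne : {r | ∃ α a, IsAtomicDecomposition lam q f α a ∧ r = ∑' i, ‖α i‖}.Nonempty :=
    ⟨_, α, a, h, rfl⟩
  obtain ⟨r, ⟨β, b, k, rfl⟩, hlt⟩ := exists_lt_of_csInf_lt hne hε
  exact ⟨β, b, k, hlt⟩

theorem atomicNorm_smul_le {lam : ℝ} {q : ℝ≥0∞} {f : Lp ℂ 1 (planeMeasure lam)}
    (hf : f ∈ littleHardySubmodule lam q) (z : ℂ) :
    atomicNorm lam q (z • f) ≤ ‖z‖ * atomicNorm lam q f := by
  refine le_of_forall_pos_le_add fun ε hε => ?_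
  have hz : 0 < ‖z‖ + 1 := by positivity
  obtain ⟨α, a, h, hlt⟩ := exists_lt_of_atomicNorm_lt hf
    (lt_add_of_pos_right (atomicNorm lam q f) (div_pos hε hz))
  have h1 := atomicNorm_le (h.smul z)
  simp only [norm_mul, tsum_mul_left] at h1
  have h2 : ‖z‖ * (ε / (‖z‖ + 1)) ≤ ε := by
    rw [mul_div_assoc', div_le_iff₀ hz]
    nlinarith
  nlinarith [mul_le_mul_of_nonneg_left hlt.le (norm_nonneg z)]

theorem norm_le_atomicNorm {lam : ℝ} {q : ℝ≥0∞} (hq : 1 < q) {f : Lp ℂ 1 (planeMeasure lam)}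
    (hf : f ∈ littleHardySubmodule lam q) : ‖f‖ ≤ atomicNorm lam q f := by
  refine le_of_forall_pos_le_add fun ε hε => ?_
  obtain ⟨α, a, h, hlt⟩ := exists_lt_of_atomicNorm_lt hf
    (lt_add_of_pos_right (atomicNorm lam q f) hε)
  refine le_trans ?_ hlt.le
  rw [← h.hasSum.tsum_eq]
  refine tsum_of_norm_bounded h.summable.hasSum fun i => ?_
  rw [norm_smul]
  exact mul_le_of_le_one_right (norm_nonneg _) ((h.isAtom i).norm_le_one hq)

/-- The space `h^{1,q}(ℝ_λ)`. -/
def LittleHardy (lam : ℝ) (q : ℝ≥0∞) : Type := ↥(littleHardySubmodule lam q)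

namespace LittleHardy

instance (lam : ℝ) (q : ℝ≥0∞) : AddCommGroup (LittleHardy lam q) :=
  inferInstanceAs (AddCommGroup ↥(littleHardySubmodule lam q))

instance (lam : ℝ) (q : ℝ≥0∞) : Module ℂ (LittleHardy lam q) :=
  inferInstanceAs (Module ℂ ↥(littleHardySubmodule lam q))

/-- The inclusion of `h^{1,q}(ℝ_λ)` into `L¹(ℝ_λ)`. -/
def toLp {lam : ℝ} {q : ℝ≥0∞} (f : LittleHardy lam q) : Lp ℂ 1 (planeMeasure lam) :=
  Subtype.val (p := (· ∈ littleHardySubmodule lam q)) f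

theorem mem {lam : ℝ} {q : ℝ≥0∞} (f : LittleHardy lam q) :
    f.toLp ∈ littleHardySubmodule lam q :=
  Subtype.prop (p := (· ∈ littleHardySubmodule lam q)) f

instance (lam : ℝ) (q : ℝ≥0∞) : Norm (LittleHardy lam q) := ⟨fun f => atomicNorm lam q f.toLp⟩

theorem norm_def {lam : ℝ} {q : ℝ≥0∞} (f : LittleHardy lam q) :
    ‖f‖ = atomicNorm lam q f.toLp := rfl

theorem core (lam : ℝ) (q : ℝ≥0∞) [hq : Fact (1 < q)] :
    NormedSpace.Core ℂ (LittleHardy lam q) where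
  norm_nonneg f := atomicNorm_nonneg lam q f.toLp
  norm_smul z f := by
    refine le_antisymm (atomicNorm_smul_le f.mem z) ?_
    by_cases hz : z = 0
    · rw [hz, norm_zero, zero_mul]
      exact atomicNorm_nonneg lam q _
    have h := atomicNorm_smul_le (littleHardySubmodule lam q |>.smul_mem z f.mem) z⁻¹
    rw [inv_smul_smul₀ hz, norm_inv, ← div_eq_inv_mul, le_div_iff₀ (norm_pos_iff.2 hz),
      mul_comm] at h
    exact h
  norm_triangle f g := by
    refine le_of_forall_pos_le_add fun ε hε => ?_
    obtain ⟨α, a, h, hl⟩ := exists_lt_of_atomicNorm_lt f.mem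
      (lt_add_of_pos_right (atomicNorm lam q f.toLp) (half_pos hε))
    obtain ⟨β, b, k, kl⟩ := exists_lt_of_atomicNorm_lt g.mem
      (lt_add_of_pos_right (atomicNorm lam q g.toLp) (half_pos hε))
    obtain ⟨γ, c, hc, hsum⟩ := h.add k
    have h1 : ‖f + g‖ ≤ ∑' i, ‖γ i‖ := atomicNorm_le hc
    rw [norm_def f, norm_def g]
    linarith
  norm_eq_zero_iff f := by
    constructor
    · intro h
      have h1 := norm_le_atomicNorm hq.out f.mem
      rw [← norm_def, h] at h1
      exact Subtype.ext (norm_le_zero_iff.1 h1)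
    · rintro rfl
      refine le_antisymm ?_ (atomicNorm_nonneg lam q _)
      have h1 := atomicNorm_le (IsAtomicDecomposition.zero lam q)
      rwa [show ∑' i, ‖(0 : ℕ → ℂ) i‖ = 0 by simp] at h1

instance (lam : ℝ) (q : ℝ≥0∞) [Fact (1 < q)] : NormedAddCommGroup (LittleHardy lam q) :=
  NormedAddCommGroup.ofCore (core lam q)

instance (lam : ℝ) (q : ℝ≥0∞) [Fact (1 < q)] : NormedSpace ℂ (LittleHardy lam q) where
  norm_smul_le z f := ((core lam q).norm_smul z f).le

end LittleHardy

end Bessel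

end

/-!
The measure `x ^ (2λ) dx` enters only through its distribution function: in the coordinates
`(μ_λ(0, x), μ_λ(0, y))`, suitably normalised, `μ_λ` on a rectangle `R` is Lebesgue measure on the
unit square, and the dyadic squares correspond to rectangles. Repeated halving thus turns `R` into a
tree of rectangles, all cells of one generation having the same measure.

On this tree a `bmo` function gives a martingale of bounded mean oscillation, and the John–Nirenberg
inequality bounds all its moments. Therefore `∫ b a` is bounded by a multiple of `‖b‖` for every
atom `a`, and the pairing extends to `h^{1,q}` by truncating `b`. Conversely, `‖b‖` is bounded by
`2 ‖Φ(b)‖`: test `b` on a rectangle against the conjugate sign of `b - m_R(b)` minus its mean.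

To represent a functional `ℓ`, let `e_Q = 1_Q μ_λ(R) / μ_λ(Q) - 1_R` for the cells `Q` of the tree
over `R`. The values `ℓ(e_Q)` form a martingale, and its mean oscillation is controlled by the norm
of `ℓ`, because signed averages of the differences `e_{Q'} - e_Q` over the cells `Q' ⊆ Q` of one
generation are multiples of atoms on `Q`. By the John–Nirenberg inequality for this martingale, the
functionals of norm one are bounded in the `L²` norm on bounded functions with integral zero on `R`;
hence so is the atomic norm. On `R` the Riesz representation theorem now gives a function
representing `ℓ`, which is unique up to a constant. The functions for an exhausting sequence of
squares are glued after normalising their means over the first one, and the resulting function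
determines `ℓ` since bounded functions approximate atoms.
-/

noncomputable section

namespace Bessel

/-! ### The John–Nirenberg inequality on trees -/

section Tree

variable {ι κ V W E : Type*} [Fintype κ] [AddCommGroup V] [Module ℝ V] [AddCommGroup W]
  [Module ℝ W] [NormedAddCommGroup E] [NormedSpace ℝ E] (child : ι → κ → ι)

/-- The operator which replaces the value of a function on the nodes of a tree by the average of
its values at the children. The tree is encoded by the function sending `Q : ι` to its
children `child Q k`, `k : κ`. -/
def childAvg : (ι → V) →ₗ[ℝ] (ι → V) where
  toFun c Q := (Fintype.card κ : ℝ)⁻¹ • ∑ k, c (child Q k)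
  map_add' c d := by ext Q; simp [Finset.sum_add_distrib]
  map_smul' r c := by ext Q; simp [← Finset.smul_sum, smul_comm r]

/-- The average of a function on the nodes of a tree over the descendants at depth `m`. -/
def treeAvg (m : ℕ) : (ι → V) →ₗ[ℝ] (ι → V) := childAvg child ^ m

/-- Martingales on a tree: the value at each node is the average over the children. -/
def IsTreeMartingale (β : ι → V) : Prop := childAvg child β = β

/-- The constant in the John–Nirenberg inequality for `n`-th moments on a tree with branching
number `N`. -/
def johnNirenbergConst (N n : ℕ) : ℝ := 4 * n.factorial * (8 * N / Real.log 2) ^ n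

@[simp] theorem treeAvg_zero (c : ι → V) : treeAvg child 0 c = c := rfl

theorem treeAvg_succ (m : ℕ) (c : ι → V) (Q : ι) :
    treeAvg child (m + 1) c Q = (Fintype.card κ : ℝ)⁻¹ • ∑ k, treeAvg child m c (child Q k) := by
  rw [treeAvg, pow_succ']
  rfl

theorem map_treeAvg (L : V →ₗ[ℝ] W) (m : ℕ) (c : ι → V) (Q : ι) :
    L (treeAvg child m c Q) = treeAvg child m (fun Q' => L (c Q')) Q := by
  induction m generalizing Q with
  | zero => rfl
  | succ m ih => simp only [treeAvg_succ, map_smul, map_sum, ih]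

theorem treeAvg_const_mul (a : ℝ) (c : ι → ℝ) (m : ℕ) (Q : ι) :
    treeAvg child m (fun Q' => a * c Q') Q = a * treeAvg child m c Q :=
  (map_treeAvg child (LinearMap.mulLeft ℝ a) m c Q).symm

variable {child} in
theorem IsTreeMartingale.treeAvg_eq {β : ι → V} (hβ : IsTreeMartingale child β) (m : ℕ) :
    treeAvg child m β = β := by
  rw [treeAvg, Module.End.pow_apply]
  exact Function.iterate_fixed hβ m

variable {child} in
theorem IsTreeMartingale.map {β : ι → V} (hβ : IsTreeMartingale child β) (L : V →ₗ[ℝ] W) :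
    IsTreeMartingale child fun Q => L (β Q) := by
  ext Q
  conv_rhs => rw [← hβ]
  exact (map_treeAvg child L 1 β Q).symm

theorem isTreeMartingale_const [Nonempty κ] (v : V) : IsTreeMartingale child fun _ => v := by
  ext Q
  simp [childAvg, ← Nat.cast_smul_eq_nsmul ℝ, smul_smul]

theorem treeAvg_mono {c d : ι → ℝ} (h : c ≤ d) (m : ℕ) : treeAvg child m c ≤ treeAvg child m d := by
  induction m with
  | zero => exact h
  | succ m ih =>
    intro Q
    simp only [treeAvg_succ, smul_eq_mul]
    gcongr with k
    exact ih _

theorem treeAvg_nonneg {c : ι → ℝ} (hc : 0 ≤ c) (m : ℕ) : 0 ≤ treeAvg child m c := by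
  simpa only [map_zero] using treeAvg_mono child hc m

theorem treeAvg_mul_sq_le (c d : ι → ℝ) (m : ℕ) (Q : ι) :
    treeAvg child m (c * d) Q ^ 2 ≤ treeAvg child m (c ^ 2) Q * treeAvg child m (d ^ 2) Q := by
  let B : (ι → ℝ) →ₗ[ℝ] (ι → ℝ) →ₗ[ℝ] ℝ :=
    (LinearMap.mul ℝ (ι → ℝ)).compr₂ (LinearMap.proj Q ∘ₗ treeAvg child m)
  have hB (u : ι → ℝ) : 0 ≤ B u u :=
    treeAvg_nonneg child (fun Q' => mul_self_nonneg (u Q')) m Q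
  have hsymm : B.IsSymm := ⟨fun u v => congrArg (treeAvg child m · Q) (mul_comm u v)⟩
  rw [sq c, sq d]
  exact LinearMap.BilinForm.apply_sq_le_of_symm B hB hsymm c d

theorem norm_treeAvg_le (c : ι → E) (m : ℕ) (Q : ι) :
    ‖treeAvg child m c Q‖ ≤ treeAvg child m (fun Q' => ‖c Q'‖) Q := by
  induction m generalizing Q with
  | zero => exact le_rfl
  | succ m ih =>
    simp only [treeAvg_succ, smul_eq_mul]
    rw [norm_smul, Real.norm_of_nonneg (by positivity)]
    gcongr
    exact (norm_sum_le _ _).trans (Finset.sum_le_sum fun k _ => ih _)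

theorem le_card_mul_treeAvg_one {c : ι → ℝ} (hc : 0 ≤ c) (Q : ι) (k : κ) :
    c (child Q k) ≤ Fintype.card κ * treeAvg child 1 c Q := by
  have hκ : (Fintype.card κ : ℝ) ≠ 0 :=
    have : Nonempty κ := ⟨k⟩
    Nat.cast_ne_zero.2 Fintype.card_ne_zero
  simp only [treeAvg_succ, treeAvg_zero, smul_eq_mul]
  rw [mul_inv_cancel_left₀ hκ]
  exact Finset.single_le_sum (f := fun k => c (child Q k)) (fun k _ => hc _) (Finset.mem_univ k)

theorem treeAvg_succ_le_of_forall_child [Nonempty κ] {c d : ι → ℝ} {a : ℝ} {m : ℕ} {Q : ι}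
    (h : ∀ k, treeAvg child m c (child Q k) ≤ a + treeAvg child m d (child Q k)) :
    treeAvg child (m + 1) c Q ≤ a + treeAvg child (m + 1) d Q := by
  have hconst : (Fintype.card κ : ℝ)⁻¹ * ∑ _k : κ, a = a := by simp
  simp only [treeAvg_succ, smul_eq_mul]
  rw [← hconst, ← mul_add, ← Finset.sum_add_distrib]
  gcongr with k
  exact h k

section Martingale

variable [Nonempty κ] {child} {β : ι → E} {M J θ A : ℝ}

theorem IsTreeMartingale.norm_sub_le_treeAvg (hβ : IsTreeMartingale child β) (z : E) (m : ℕ)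
    (Q : ι) : ‖β Q - z‖ ≤ treeAvg child m (fun Q' => ‖β Q' - z‖) Q := by
  have h := norm_treeAvg_le child (β - fun _ => z) m Q
  rwa [map_sub, hβ.treeAvg_eq, (isTreeMartingale_const child z).treeAvg_eq] at h

theorem IsTreeMartingale.treeAvg_exp_le_of_le_norm_sub (hβ : IsTreeMartingale child β)
    (hθ : 0 ≤ θ) (hJ : 0 < J) {z : E} {r : ℝ} {m : ℕ} {Q : ι} (hJz : J ≤ ‖β Q - z‖)
    (hr : ‖β Q - z‖ ≤ r) (hA : treeAvg child m (fun Q' => Real.exp (θ * ‖β Q' - β Q‖)) Q ≤ A)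
    (hA₀ : 0 ≤ A) :
    treeAvg child m (fun Q' => Real.exp (θ * ‖β Q' - z‖)) Q ≤
      Real.exp (θ * r) * A / J * treeAvg child m (fun Q' => ‖β Q' - z‖) Q := by
  calc treeAvg child m (fun Q' => Real.exp (θ * ‖β Q' - z‖)) Q
      ≤ treeAvg child m (fun Q' => Real.exp (θ * r) * Real.exp (θ * ‖β Q' - β Q‖)) Q := by
        refine treeAvg_mono child (fun Q' => ?_) m Q
        rw [← Real.exp_add, ← mul_add]
        gcongr
        linarith [norm_sub_le_norm_sub_add_norm_sub (β Q') (β Q) z]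
    _ ≤ Real.exp (θ * r) * A := by
        rw [treeAvg_const_mul]
        gcongr
    _ = Real.exp (θ * r) * A / J * J := by field_simp
    _ ≤ Real.exp (θ * r) * A / J * treeAvg child m (fun Q' => ‖β Q' - z‖) Q := by
        gcongr
        exact hJz.trans (hβ.norm_sub_le_treeAvg z m Q)

/-- Stopping time argument: as long as the martingale stays within distance `J` of `z` the
exponential is estimated directly; when it first leaves this ball it is still within `2 * J`
of `z`, and the assumed exponential bound is applied from there on. -/
theorem IsTreeMartingale.treeAvg_exp_le_of_norm_sub_le (hβ : IsTreeMartingale child β)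
    (hθ : 0 ≤ θ) (hJ : 0 < J) (hjump : ∀ Q k, ‖β (child Q k) - β Q‖ ≤ J) (hA : 0 ≤ A) (z : E)
    (m : ℕ) (hexp : ∀ j ≤ m, ∀ Q, treeAvg child j (fun Q' => Real.exp (θ * ‖β Q' - β Q‖)) Q ≤ A)
    (Q : ι) (hQ : ‖β Q - z‖ ≤ 2 * J) :
    treeAvg child m (fun Q' => Real.exp (θ * ‖β Q' - z‖)) Q ≤
      Real.exp (θ * J) +
        Real.exp (θ * (2 * J)) * A / J * treeAvg child m (fun Q' => ‖β Q' - z‖) Q := by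
  rcases le_or_gt J ‖β Q - z‖ with hfar | hnear
  · exact (hβ.treeAvg_exp_le_of_le_norm_sub hθ hJ hfar hQ (hexp m le_rfl Q) hA).trans
      (le_add_of_nonneg_left (Real.exp_pos _).le)
  induction m generalizing Q with
  | zero =>
    simp only [treeAvg_zero]
    refine le_add_of_le_of_nonneg ?_ (by positivity)
    gcongr
  | succ m ih =>
    rw [← treeAvg_const_mul]
    refine treeAvg_succ_le_of_forall_child child fun k => ?_
    have hk : ‖β (child Q k) - z‖ ≤ 2 * J := by
      linarith [norm_sub_le_norm_sub_add_norm_sub (β (child Q k)) (β Q) z, hjump Q k]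
    rw [treeAvg_const_mul]
    rcases le_or_gt J ‖β (child Q k) - z‖ with hfar | hnear'
    · exact (hβ.treeAvg_exp_le_of_le_norm_sub hθ hJ hfar hk (hexp m m.le_succ _) hA).trans
        (le_add_of_nonneg_left (Real.exp_pos _).le)
    · exact ih (fun j hj => hexp j (hj.trans m.le_succ)) _ hk hnear'

theorem IsTreeMartingale.treeAvg_exp_le (hβ : IsTreeMartingale child β) (hM : 0 < M)
    (hosc : ∀ m Q, treeAvg child m (fun Q' => ‖β Q' - β Q‖) Q ≤ M) (m : ℕ) (Q : ι) :
    treeAvg child m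
      (fun Q' => Real.exp (Real.log 2 / (8 * Fintype.card κ * M) * ‖β Q' - β Q‖)) Q ≤ 4 := by
  set J : ℝ := 4 * Fintype.card κ * M with hJdef
  have hN : (1 : ℝ) ≤ Fintype.card κ := Nat.one_le_cast.2 Fintype.card_pos
  have hJ : 0 < J := by positivity
  have hθ : Real.log 2 / (8 * Fintype.card κ * M) * (2 * J) = Real.log 2 := by
    rw [hJdef]; field_simp; norm_num
  set θ := Real.log 2 / (8 * Fintype.card κ * M)
  have hθ₀ : 0 ≤ θ := by have := Real.log_pos one_lt_two; positivity
  have hjump : ∀ Q k, ‖β (child Q k) - β Q‖ ≤ J := fun Q k => by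
    calc ‖β (child Q k) - β Q‖
        ≤ Fintype.card κ * treeAvg child 1 (fun Q' => ‖β Q' - β Q‖) Q :=
          le_card_mul_treeAvg_one child (c := fun Q' => ‖β Q' - β Q‖) (fun _ => norm_nonneg _) Q k
      _ ≤ Fintype.card κ * M := by gcongr; exact hosc 1 Q
      _ ≤ J := by rw [hJdef]; nlinarith
  have hexp₂ : Real.exp (θ * (2 * J)) = 2 := by rw [hθ, Real.exp_log two_pos]
  have hexp₁ : Real.exp (θ * J) ≤ 2 := by
    rw [← hexp₂]
    gcongr
    linarith
  induction m using Nat.strong_induction_on generalizing Q with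
  | _ m ih =>
    rcases m with _ | m
    · simp
    have hchildren : treeAvg child (m + 1) (fun Q' => Real.exp (θ * ‖β Q' - β Q‖)) Q ≤
        Real.exp (θ * J) + treeAvg child (m + 1)
          (fun Q' => Real.exp (θ * (2 * J)) * 4 / J * ‖β Q' - β Q‖) Q := by
      refine treeAvg_succ_le_of_forall_child child fun k => ?_
      rw [treeAvg_const_mul]
      exact hβ.treeAvg_exp_le_of_norm_sub_le hθ₀ hJ hjump (by norm_num) (β Q) m
        (fun j hj => ih j (Nat.lt_succ_of_le hj)) _ ((hjump Q k).trans (by linarith))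
    rw [treeAvg_const_mul, hexp₂] at hchildren
    have hsmall : 2 * 4 / J * treeAvg child (m + 1) (fun Q' => ‖β Q' - β Q‖) Q ≤ 2 := by
      calc _ ≤ 2 * 4 / J * M := by gcongr; exact hosc (m + 1) Q
        _ ≤ 2 := by rw [div_mul_eq_mul_div, div_le_iff₀ hJ, hJdef]; nlinarith
    linarith

theorem IsTreeMartingale.treeAvg_pow_le (hβ : IsTreeMartingale child β) (hM : 0 < M)
    (hosc : ∀ m Q, treeAvg child m (fun Q' => ‖β Q' - β Q‖) Q ≤ M) (n m : ℕ) (Q : ι) :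
    treeAvg child m (fun Q' => ‖β Q' - β Q‖ ^ n) Q ≤
      johnNirenbergConst (Fintype.card κ) n * M ^ n := by
  set θ := Real.log 2 / (8 * Fintype.card κ * M) with hθdef
  have hθ : 0 < θ := by have := Real.log_pos one_lt_two; positivity
  calc treeAvg child m (fun Q' => ‖β Q' - β Q‖ ^ n) Q
      ≤ treeAvg child m (fun Q' => n.factorial / θ ^ n * Real.exp (θ * ‖β Q' - β Q‖)) Q := by
        refine treeAvg_mono child (fun Q' => ?_) m Q
        have h := Real.pow_div_factorial_le_exp (x := θ * ‖β Q' - β Q‖) (by positivity) n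
        have hpow : ‖β Q' - β Q‖ ^ n =
            n.factorial / θ ^ n * ((θ * ‖β Q' - β Q‖) ^ n / n.factorial) := by
          rw [mul_pow]
          field_simp
        rw [hpow]
        gcongr
    _ ≤ n.factorial / θ ^ n * 4 := by
        rw [treeAvg_const_mul]
        gcongr
        exact hβ.treeAvg_exp_le hM hosc m Q
    _ = johnNirenbergConst (Fintype.card κ) n * M ^ n := by
        have hlog : Real.log 2 ≠ 0 := (Real.log_pos one_lt_two).ne'
        have hN : (Fintype.card κ : ℝ) ≠ 0 := Nat.cast_ne_zero.2 Fintype.card_ne_zero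
        rw [johnNirenbergConst, hθdef, mul_assoc _ (_ ^ n) (_ ^ n), ← mul_pow, div_eq_mul_inv,
          ← inv_pow, mul_right_comm, mul_comm _ (4 : ℝ)]
        congr 2
        field_simp

end Martingale

end Tree

/-! ### Partition trees -/

/-- A tree of measurable sets of finite positive measure in which every cell `cell Q` is the
disjoint union of the cells of its children `child Q k`, `k : κ`, all of the same measure. The
label of the child of `Q` containing a point `x` of `cell Q` is `index Q x`; it is a junk value for
points outside `cell Q`. -/
structure PartitionTree {X : Type*} [MeasurableSpace X] (μ : Measure X) (ι κ : Type*)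
    [Fintype κ] where
  root : ι
  child : ι → κ → ι
  cell : ι → Set X
  index : ι → X → κ
  measurableSet_cell : ∀ Q, MeasurableSet (cell Q)
  measurableSet_index : ∀ Q k, MeasurableSet {x | index Q x = k}
  cell_subset_root : ∀ Q, cell Q ⊆ cell root
  mem_cell_child : ∀ {Q k x}, x ∈ cell (child Q k) ↔ x ∈ cell Q ∧ index Q x = k
  measure_cell_ne_zero : ∀ Q, μ (cell Q) ≠ 0
  measure_root_ne_top : μ (cell root) ≠ ∞
  measureReal_cell_child : ∀ Q k,
    μ.real (cell (child Q k)) = (Fintype.card κ : ℝ)⁻¹ * μ.real (cell Q)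

namespace PartitionTree

variable {X ι κ E : Type*} [MeasurableSpace X] {μ : Measure X} [Fintype κ] [NormedAddCommGroup E]
  [NormedSpace ℝ E] (T : PartitionTree μ ι κ)

/-- The descendant of the node `Q` at depth `m` whose cell contains the point `x` of the cell
of `Q`. -/
def leaf : ℕ → ι → X → ι
  | 0, Q, _ => Q
  | m + 1, Q, x => leaf m (T.child Q (T.index Q x)) x

/-- The mean value of a function over a cell. -/
def average (F : X → E) (Q : ι) : E := ⨍ x in T.cell Q, F x ∂μ

/-- **Lebesgue differentiation** holds along the cells of the tree. -/
def Differentiates : Prop :=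
  ∀ F : X → ℂ, Measurable F → IntegrableOn F (T.cell T.root) μ →
    ∀ᵐ x ∂μ.restrict (T.cell T.root),
      Filter.Tendsto (fun m => T.average F (T.leaf m T.root x)) Filter.atTop (nhds (F x))

theorem measure_cell_ne_top (Q : ι) : μ (T.cell Q) ≠ ∞ :=
  measure_ne_top_of_subset (T.cell_subset_root Q) T.measure_root_ne_top

theorem measureReal_cell_pos (Q : ι) : 0 < μ.real (T.cell Q) :=
  ENNReal.toReal_pos (T.measure_cell_ne_zero Q) (T.measure_cell_ne_top Q)

theorem nonempty_index (T : PartitionTree μ ι κ) : Nonempty κ :=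
  (nonempty_of_measure_ne_zero (T.measure_cell_ne_zero T.root)).to_type.map
    fun x => T.index T.root x

theorem iUnion_cell_child (Q : ι) : ⋃ k, T.cell (T.child Q k) = T.cell Q := by
  ext x
  simp [T.mem_cell_child]

theorem pairwise_disjoint_cell_child (Q : ι) :
    Pairwise (Function.onFun Disjoint fun k => T.cell (T.child Q k)) := by
  intro k l hkl
  refine Set.disjoint_left.2 fun x hk hl => hkl ?_
  rw [← (T.mem_cell_child.1 hk).2, (T.mem_cell_child.1 hl).2]

theorem mem_cell_leaf (m : ℕ) {Q : ι} {x : X} (hx : x ∈ T.cell Q) : x ∈ T.cell (T.leaf m Q x) := by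
  induction m generalizing Q with
  | zero => exact hx
  | succ _ ih => exact ih (T.mem_cell_child.2 ⟨hx, rfl⟩)

theorem measurable_comp_leaf {Y : Type*} [MeasurableSpace Y] (G : ι → Y) (m : ℕ) (Q : ι) :
    Measurable fun x => G (T.leaf m Q x) := by
  induction m generalizing Q with
  | zero => exact (measurable_const : Measurable fun _ : X => G Q)
  | succ m ih =>
    intro A hA
    have hsplit : (fun x => G (T.leaf (m + 1) Q x)) ⁻¹' A =
        ⋃ k, {x | T.index Q x = k} ∩ (fun x => G (T.leaf m (T.child Q k) x)) ⁻¹' A := by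
      ext x
      simp [leaf]
    rw [hsplit]
    exact .iUnion fun k => (T.measurableSet_index Q k).inter (ih (T.child Q k) hA)

theorem setLIntegral_leaf {G : ι → ℝ} (hG : 0 ≤ G) (m : ℕ) (Q : ι) :
    ∫⁻ x in T.cell Q, ENNReal.ofReal (G (T.leaf m Q x)) ∂μ =
      ENNReal.ofReal (treeAvg T.child m G Q) * μ (T.cell Q) := by
  induction m generalizing Q with
  | zero => simp [leaf]
  | succ m ih =>
    have hchild (k : κ) : ∫⁻ x in T.cell (T.child Q k), ENNReal.ofReal (G (T.leaf (m + 1) Q x)) ∂μ =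
        ENNReal.ofReal (treeAvg T.child m G (T.child Q k)) * μ (T.cell (T.child Q k)) := by
      rw [← ih]
      refine setLIntegral_congr_fun (T.measurableSet_cell _) fun x hx => ?_
      rw [leaf, (T.mem_cell_child.1 hx).2]
    have hnonneg (k : κ) : 0 ≤ treeAvg T.child m G (T.child Q k) :=
      treeAvg_nonneg T.child hG m (T.child Q k)
    rw [← iUnion_cell_child, lintegral_iUnion (fun k => T.measurableSet_cell _)
      (T.pairwise_disjoint_cell_child Q), tsum_fintype, iUnion_cell_child]
    simp only [hchild, ← ofReal_measureReal (T.measure_cell_ne_top _), T.measureReal_cell_child,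
      ← ENNReal.ofReal_mul (hnonneg _)]
    rw [← ENNReal.ofReal_sum_of_nonneg fun k _ => mul_nonneg (hnonneg k) (by positivity),
      ← ENNReal.ofReal_mul' measureReal_nonneg, ← Finset.sum_mul, treeAvg_succ, smul_eq_mul]
    ring_nf

theorem isTreeMartingale_average {F : X → E} (hF : IntegrableOn F (T.cell T.root) μ) :
    IsTreeMartingale T.child (T.average F) := by
  ext Q
  have hsum : ∫ x in T.cell Q, F x ∂μ = ∑ k, ∫ x in T.cell (T.child Q k), F x ∂μ := by
    rw [← iUnion_cell_child, integral_iUnion (fun k => T.measurableSet_cell _)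
      (T.pairwise_disjoint_cell_child Q), tsum_fintype]
    rw [iUnion_cell_child]
    exact hF.mono_set (T.cell_subset_root Q)
  have hcard : (Fintype.card κ : ℝ) ≠ 0 :=
    have := T.nonempty_index
    Nat.cast_ne_zero.2 Fintype.card_ne_zero
  simp only [childAvg, LinearMap.coe_mk, AddHom.coe_mk, average, setAverage_eq,
    T.measureReal_cell_child, ← Finset.smul_sum, smul_smul, hsum]
  congr 1
  field_simp

theorem norm_average_le (F : X → E) (Q : ι) : ‖T.average F Q‖ ≤ T.average (fun x => ‖F x‖) Q := by
  rw [average, average, setAverage_eq, setAverage_eq, norm_smul,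
    Real.norm_of_nonneg (by positivity), smul_eq_mul]
  gcongr
  exact norm_integral_le_integral_norm _

theorem average_sub_const [CompleteSpace E] {F : X → E} (hF : IntegrableOn F (T.cell T.root) μ)
    (z : E) (Q : ι) : T.average (fun x => F x - z) Q = T.average F Q - z := by
  have hsub := T.cell_subset_root Q
  rw [average, average, setAverage_eq, setAverage_eq, integral_sub (hF.mono_set hsub)
    (integrableOn_const (T.measure_cell_ne_top Q)), setIntegral_const, smul_sub, smul_smul,
    inv_mul_cancel₀ (T.measureReal_cell_pos Q).ne', one_smul]

theorem treeAvg_norm_average_sub_le [CompleteSpace E] {F : X → E}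
    (hF : IntegrableOn F (T.cell T.root) μ) (z : E) (m : ℕ) (Q : ι) :
    treeAvg T.child m (fun Q' => ‖T.average F Q' - z‖) Q ≤ T.average (fun x => ‖F x - z‖) Q := by
  have hint : IntegrableOn (fun x => ‖F x - z‖) (T.cell T.root) μ :=
    (hF.sub (integrableOn_const T.measure_root_ne_top)).norm
  calc treeAvg T.child m (fun Q' => ‖T.average F Q' - z‖) Q
      ≤ treeAvg T.child m (T.average fun x => ‖F x - z‖) Q := by
        refine treeAvg_mono T.child (fun Q' => ?_) m Q
        rw [← T.average_sub_const hF]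
        exact T.norm_average_le _ Q'
    _ = T.average (fun x => ‖F x - z‖) Q := by
        rw [(T.isTreeMartingale_average hint).treeAvg_eq]

theorem lintegral_enorm_sub_average_pow_le (hT : T.Differentiates) {F : X → ℂ} (hF : Measurable F)
    (hint : IntegrableOn F (T.cell T.root) μ) {M : ℝ} (hM : 0 < M)
    (hosc : ∀ Q, T.average (fun x => ‖F x - T.average F Q‖) Q ≤ M) (n : ℕ) :
    ∫⁻ x in T.cell T.root, ‖F x - T.average F T.root‖ₑ ^ n ∂μ ≤
      ENNReal.ofReal (johnNirenbergConst (Fintype.card κ) n * M ^ n) * μ (T.cell T.root) := by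
  have := T.nonempty_index
  let G (Q : ι) : ℝ := ‖T.average F Q - T.average F T.root‖ ^ n
  have hdepth (m : ℕ) : ∫⁻ x in T.cell T.root, ENNReal.ofReal (G (T.leaf m T.root x)) ∂μ ≤
      ENNReal.ofReal (johnNirenbergConst (Fintype.card κ) n * M ^ n) * μ (T.cell T.root) := by
    rw [T.setLIntegral_leaf fun Q => by positivity]
    gcongr
    exact (T.isTreeMartingale_average hint).treeAvg_pow_le hM
      (fun m Q => (T.treeAvg_norm_average_sub_le hint _ m Q).trans (hosc Q)) n m T.root
  calc ∫⁻ x in T.cell T.root, ‖F x - T.average F T.root‖ₑ ^ n ∂μ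
      = ∫⁻ x in T.cell T.root, Filter.liminf
          (fun m => ENNReal.ofReal (G (T.leaf m T.root x))) Filter.atTop ∂μ := by
        refine lintegral_congr_ae ?_
        filter_upwards [hT F hF hint] with x hx
        rw [← ofReal_norm, ← ENNReal.ofReal_pow (norm_nonneg _)]
        exact (ENNReal.tendsto_ofReal ((hx.sub_const _).norm.pow n)).liminf_eq.symm
    _ ≤ Filter.liminf (fun m => ∫⁻ x in T.cell T.root,
          ENNReal.ofReal (G (T.leaf m T.root x)) ∂μ) Filter.atTop :=
        lintegral_liminf_le fun m => T.measurable_comp_leaf (fun Q => ENNReal.ofReal (G Q)) m T.root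
    _ ≤ _ := Filter.liminf_le_of_frequently_le' (Filter.Frequently.of_forall hdepth)

section Comap

variable {Y : Type*} [MeasurableSpace Y] {ν : Measure Y} {T : PartitionTree ν ι κ} {φ : X → Y}
  {R : Set X} {c : ℝ≥0∞}

theorem measure_inter_preimage_cell (hφ : Measurable φ)
    (hmap : (μ.restrict R).map φ = c • ν.restrict (T.cell T.root)) (Q : ι) :
    μ (R ∩ φ ⁻¹' T.cell Q) = c * ν (T.cell Q) := by
  rw [inter_comm, ← Measure.restrict_apply (hφ (T.measurableSet_cell Q)),
    ← Measure.map_apply hφ (T.measurableSet_cell Q), hmap, Measure.smul_apply,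
    Measure.restrict_apply (T.measurableSet_cell Q), inter_eq_left.2 (T.cell_subset_root Q),
    smul_eq_mul]

/-- The partition of a set `R` into the preimages of the cells of a tree under a map of `R` to the
root cell which preserves the measure up to a factor. -/
def comap (T : PartitionTree ν ι κ) (hR : MeasurableSet R) (hφ : Measurable φ)
    (hmap : (μ.restrict R).map φ = c • ν.restrict (T.cell T.root)) (hc₀ : c ≠ 0) (hc : c ≠ ∞) :
    PartitionTree μ ι κ where
  root := T.root
  child := T.child
  cell Q := R ∩ φ ⁻¹' T.cell Q
  index Q x := T.index Q (φ x)
  measurableSet_cell Q := hR.inter (hφ (T.measurableSet_cell Q))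
  measurableSet_index Q k := hφ (T.measurableSet_index Q k)
  cell_subset_root Q := inter_subset_inter_right R (preimage_mono (T.cell_subset_root Q))
  mem_cell_child := by simp [T.mem_cell_child, and_assoc]
  measure_cell_ne_zero Q := by
    rw [measure_inter_preimage_cell hφ hmap]
    exact mul_ne_zero hc₀ (T.measure_cell_ne_zero Q)
  measure_root_ne_top := by
    rw [measure_inter_preimage_cell hφ hmap]
    exact ENNReal.mul_ne_top hc T.measure_root_ne_top
  measureReal_cell_child Q k := by
    simp only [measureReal_def, measure_inter_preimage_cell hφ hmap, ENNReal.toReal_mul]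
    rw [← measureReal_def, T.measureReal_cell_child, measureReal_def, mul_left_comm]

variable (hR : MeasurableSet R) (hφ : Measurable φ)
  (hmap : (μ.restrict R).map φ = c • ν.restrict (T.cell T.root)) (hc₀ : c ≠ 0) (hc : c ≠ ∞)

theorem cell_root_comap (hmaps : MapsTo φ R (T.cell T.root)) :
    (T.comap hR hφ hmap hc₀ hc).cell (T.comap hR hφ hmap hc₀ hc).root = R :=
  inter_eq_left.2 hmaps

theorem leaf_comap (m : ℕ) (Q : ι) (x : X) :
    (T.comap hR hφ hmap hc₀ hc).leaf m Q x = T.leaf m Q (φ x) := by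
  induction m generalizing Q with
  | zero => rfl
  | succ _ ih => exact ih _

variable {ψ : Y → X} (hψ : LeftInvOn ψ φ R)

include hψ in
theorem average_comap {F : X → E} (hF : AEStronglyMeasurable (F ∘ ψ) ν) (Q : ι) :
    (T.comap hR hφ hmap hc₀ hc).average F Q = T.average (F ∘ ψ) Q := by
  have hpre := hφ (T.measurableSet_cell Q)
  have hint : ∫ x in R ∩ φ ⁻¹' T.cell Q, F x ∂μ = c.toReal • ∫ y in T.cell Q, (F ∘ ψ) y ∂ν := by
    calc ∫ x in R ∩ φ ⁻¹' T.cell Q, F x ∂μ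
        = ∫ x in φ ⁻¹' T.cell Q, (F ∘ ψ) (φ x) ∂(μ.restrict R) := by
          rw [Measure.restrict_restrict hpre, inter_comm]
          refine setIntegral_congr_fun (hpre.inter hR) fun x hx => ?_
          rw [Function.comp_apply, hψ hx.2]
      _ = ∫ y in T.cell Q, (F ∘ ψ) y ∂((μ.restrict R).map φ) := by
          refine (setIntegral_map (T.measurableSet_cell Q) ?_ hφ.aemeasurable).symm
          rw [hmap]
          exact hF.restrict.smul_measure c
      _ = c.toReal • ∫ y in T.cell Q, (F ∘ ψ) y ∂ν := by
          rw [hmap, Measure.restrict_smul, Measure.restrict_restrict (T.measurableSet_cell Q),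
            inter_eq_left.2 (T.cell_subset_root Q), integral_smul_measure]
  have hc' : c.toReal ≠ 0 := ENNReal.toReal_ne_zero.2 ⟨hc₀, hc⟩
  change ⨍ x in R ∩ φ ⁻¹' T.cell Q, F x ∂μ = ⨍ y in T.cell Q, (F ∘ ψ) y ∂ν
  rw [setAverage_eq, setAverage_eq, hint, smul_smul, measureReal_def,
    measure_inter_preimage_cell hφ hmap, ENNReal.toReal_mul, mul_inv, mul_right_comm,
    inv_mul_cancel₀ hc', one_mul, ← measureReal_def]

include hψ in
theorem Differentiates.comap (hT : T.Differentiates) (hmaps : MapsTo φ R (T.cell T.root))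
    (hψm : Measurable ψ) :
    (T.comap hR hφ hmap hc₀ hc).Differentiates := by
  intro F hF hint
  rw [cell_root_comap hR hφ hmap hc₀ hc hmaps] at hint ⊢
  have hFψ : Measurable (F ∘ ψ) := hF.comp hψm
  have hcomp : ∀ x ∈ R, (F ∘ ψ) (φ x) = F x := fun x hx => congrArg F (hψ hx)
  have hintψ : IntegrableOn (F ∘ ψ) (T.cell T.root) ν := by
    rw [IntegrableOn, ← integrable_smul_measure hc₀ hc, ← hmap,
      integrable_map_measure hFψ.aestronglyMeasurable hφ.aemeasurable]
    exact IntegrableOn.congr_fun hint (fun x hx => (hcomp x hx).symm) hR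
  have hae := (Measure.ae_smul_measure (hT (F ∘ ψ) hFψ hintψ) c)
  rw [← hmap] at hae
  filter_upwards [ae_of_ae_map hφ.aemeasurable hae, ae_restrict_mem hR] with x hx hxR
  rw [hcomp x hxR] at hx
  simp only [average_comap hR hφ hmap hc₀ hc hψ hFψ.aestronglyMeasurable, leaf_comap]
  exact hx

end Comap

end PartitionTree

/-! ### Dyadic subdivision of the unit square -/

/-- A half-open square `[s, s + r) × [t, t + r)` contained in the unit square `[0, 1) × [0, 1)`. -/
structure UnitSubsquare where
  s : ℝ
  t : ℝ
  r : ℝ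
  r_pos : 0 < r
  s_nonneg : 0 ≤ s
  t_nonneg : 0 ≤ t
  s_add_r_le : s + r ≤ 1
  t_add_r_le : t + r ≤ 1

namespace UnitSubsquare

/-- The set of points of a square. -/
def toSet (Q : UnitSubsquare) : Set (ℝ × ℝ) := Ico Q.s (Q.s + Q.r) ×ˢ Ico Q.t (Q.t + Q.r)

/-- The quarters of a square; `k.1` selects the right half and `k.2` the upper half. -/
def quarter (Q : UnitSubsquare) (k : Bool × Bool) : UnitSubsquare where
  s := if k.1 then Q.s + Q.r / 2 else Q.s
  t := if k.2 then Q.t + Q.r / 2 else Q.t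
  r := Q.r / 2
  r_pos := half_pos Q.r_pos
  s_nonneg := by have := Q.r_pos; have := Q.s_nonneg; split_ifs <;> linarith
  t_nonneg := by have := Q.r_pos; have := Q.t_nonneg; split_ifs <;> linarith
  s_add_r_le := by have := Q.r_pos; have := Q.s_add_r_le; split_ifs <;> linarith
  t_add_r_le := by have := Q.r_pos; have := Q.t_add_r_le; split_ifs <;> linarith

/-- The label of the quarter of `Q` which contains the point `y` of `Q`. -/
def quarterIndex (Q : UnitSubsquare) (y : ℝ × ℝ) : Bool × Bool :=
  (decide (Q.s + Q.r / 2 ≤ y.1), decide (Q.t + Q.r / 2 ≤ y.2))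

theorem measurable_quarterIndex (Q : UnitSubsquare) : Measurable Q.quarterIndex := by
  have hdecide (a : ℝ) : Measurable fun x : ℝ => decide (a ≤ x) := by
    refine measurable_to_bool ?_
    simpa [preimage, ← Ici_def] using measurableSet_Ici
  exact ((hdecide _).comp measurable_fst).prodMk ((hdecide _).comp measurable_snd)

theorem volume_toSet (Q : UnitSubsquare) : volume Q.toSet = ENNReal.ofReal (Q.r ^ 2) := by
  rw [toSet, Measure.volume_eq_prod, Measure.prod_prod, Real.volume_Ico, Real.volume_Ico,
    add_sub_cancel_left, add_sub_cancel_left, ← ENNReal.ofReal_mul Q.r_pos.le, sq]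

theorem mem_Ico_add_half_iff {s r x : ℝ} (hr : 0 < r) (b : Bool) :
    x ∈ Ico (if b then s + r / 2 else s) ((if b then s + r / 2 else s) + r / 2) ↔
      x ∈ Ico s (s + r) ∧ decide (s + r / 2 ≤ x) = b := by
  cases b <;> simp only [mem_Ico, Bool.false_eq_true, if_true, if_false, decide_eq_true_eq,
    decide_eq_false_iff_not, not_le]
  · exact ⟨fun h => ⟨⟨h.1, by linarith⟩, h.2⟩, fun h => ⟨h.1.1, h.2⟩⟩
  · exact ⟨fun h => ⟨⟨by linarith, by linarith⟩, h.1⟩, fun h => ⟨h.2, by linarith⟩⟩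

theorem mem_quarter_iff {Q : UnitSubsquare} {k : Bool × Bool} {y : ℝ × ℝ} :
    y ∈ (Q.quarter k).toSet ↔ y ∈ Q.toSet ∧ Q.quarterIndex y = k := by
  simp only [toSet, quarter, quarterIndex, mem_prod, mem_Ico_add_half_iff Q.r_pos, Prod.ext_iff]
  tauto

/-- The tree of the dyadic subsquares of the unit square. -/
def tree : PartitionTree (volume : Measure (ℝ × ℝ)) UnitSubsquare (Bool × Bool) where
  root := ⟨0, 0, 1, one_pos, le_rfl, le_rfl, by simp, by simp⟩
  child := quarter
  cell := toSet
  index := quarterIndex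
  measurableSet_cell _ := measurableSet_Ico.prod measurableSet_Ico
  measurableSet_index Q k := Q.measurable_quarterIndex (measurableSet_singleton k)
  cell_subset_root Q := by
    refine prod_mono (Ico_subset_Ico Q.s_nonneg ?_) (Ico_subset_Ico Q.t_nonneg ?_)
    · simpa using Q.s_add_r_le
    · simpa using Q.t_add_r_le
  mem_cell_child := mem_quarter_iff
  measure_cell_ne_zero Q := by simpa [volume_toSet] using Q.r_pos.ne'
  measure_root_ne_top := by simp [volume_toSet]
  measureReal_cell_child Q k := by
    simp only [measureReal_def, volume_toSet, ENNReal.toReal_ofReal (sq_nonneg _), quarter,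
      Fintype.card_prod, Fintype.card_bool]
    ring

theorem r_leaf (m : ℕ) (Q : UnitSubsquare) (y : ℝ × ℝ) :
    (tree.leaf m Q y).r = Q.r * (1 / 2) ^ m := by
  induction m generalizing Q with
  | zero => simp [PartitionTree.leaf]
  | succ m ih =>
    rw [PartitionTree.leaf, ih, pow_succ']
    change Q.r / 2 * _ = _
    ring

/-- The centre of a square. -/
def centre (Q : UnitSubsquare) : ℝ × ℝ := (Q.s + Q.r / 2, Q.t + Q.r / 2)

theorem closedBall_centre (Q : UnitSubsquare) : Metric.closedBall Q.centre (Q.r / 2) =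
    Icc Q.s (Q.s + Q.r) ×ˢ Icc Q.t (Q.t + Q.r) := by
  rw [centre, ← closedBall_prod_same, Real.closedBall_eq_Icc, Real.closedBall_eq_Icc]
  ring_nf

theorem toSet_ae_eq_closedBall (Q : UnitSubsquare) :
    Q.toSet =ᵐ[volume] Metric.closedBall Q.centre (Q.r / 2) := by
  rw [closedBall_centre]
  exact Measure.set_prod_ae_eq Ico_ae_eq_Icc Ico_ae_eq_Icc

theorem toSet_subset_closedBall (Q : UnitSubsquare) :
    Q.toSet ⊆ Metric.closedBall Q.centre (Q.r / 2) := by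
  rw [closedBall_centre]
  exact prod_mono Ico_subset_Icc_self Ico_subset_Icc_self

theorem differentiates_tree : tree.Differentiates := by
  intro F _ hint
  let S : Set (ℝ × ℝ) := tree.cell tree.root
  have hS : MeasurableSet S := tree.measurableSet_cell _
  have hindicator : LocallyIntegrable (S.indicator F) :=
    ((integrable_indicator_iff hS).2 hint).locallyIntegrable
  rw [ae_restrict_iff' hS]
  filter_upwards [IsUnifLocDoublingMeasure.ae_tendsto_average volume hindicator 1] with y hy hyS
  have hradius : Filter.Tendsto (fun m => (tree.leaf m tree.root y).r / 2) Filter.atTop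
      (nhdsWithin 0 (Ioi 0)) := by
    refine tendsto_nhdsWithin_iff.2 ⟨?_, .of_forall fun m => half_pos (UnitSubsquare.r_pos _)⟩
    simp only [r_leaf]
    simpa using ((tendsto_pow_atTop_nhds_zero_of_lt_one (by norm_num : (0 : ℝ) ≤ 1 / 2)
      (by norm_num)).const_mul tree.root.r).div_const 2
  have hlim := hy (fun m => (tree.leaf m tree.root y).centre) _ hradius <| .of_forall fun m => by
    rw [one_mul]
    exact toSet_subset_closedBall _ (tree.mem_cell_leaf m hyS)
  rw [indicator_of_mem hyS] at hlim
  refine hlim.congr fun m => ?_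
  rw [PartitionTree.average, ← setAverage_congr (toSet_ae_eq_closedBall _), setAverage_eq,
    setAverage_eq]
  congr 1
  exact setIntegral_congr_fun (tree.measurableSet_cell _) fun x hx =>
    indicator_of_mem (tree.cell_subset_root _ hx) F

end UnitSubsquare

/-! ### Coordinates on intervals and rectangles -/

/-- The increasing map of `(a, b)` onto `(0, 1)` which transports the normalized measure
`x ^ (2λ) dx` to Lebesgue measure. -/
def flatten (lam a b x : ℝ) : ℝ :=
  (x ^ (2 * lam + 1) - a ^ (2 * lam + 1)) / (b ^ (2 * lam + 1) - a ^ (2 * lam + 1))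

/-- The inverse of `flatten`. -/
def unflatten (lam a b s : ℝ) : ℝ :=
  (a ^ (2 * lam + 1) + s * (b ^ (2 * lam + 1) - a ^ (2 * lam + 1))) ^ (2 * lam + 1)⁻¹

section Line

variable {lam a b : ℝ}

@[fun_prop] theorem measurable_flatten : Measurable (flatten lam a b) :=
  ((measurable_id.pow_const _).sub_const _).div_const _

@[fun_prop] theorem measurable_unflatten : Measurable (unflatten lam a b) :=
  ((measurable_id.mul_const _).const_add _).pow_const _

theorem interval_eq_Ioo (x t : ℝ) : interval x t = Ioo (max (x - t) 0) (x + t) := by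
  ext
  simp only [interval, mem_inter_iff, mem_Ioi, mem_Ioo, max_lt_iff]
  tauto

theorem lineMeasure_apply {s : Set ℝ} (hs : MeasurableSet s) (hpos : s ⊆ Ioi 0) :
    lineMeasure lam s = ∫⁻ x in s, ENNReal.ofReal (x ^ (2 * lam)) := by
  rw [lineMeasure, withDensity_apply _ hs, Measure.restrict_restrict hs, inter_eq_left.2 hpos]

instance : SFinite (lineMeasure lam) := by
  unfold lineMeasure
  infer_instance

instance : NullSingletonClass (lineMeasure lam) := by
  unfold lineMeasure
  infer_instance

theorem hasDerivAt_flatten {x : ℝ} (hx : 0 < x) : HasDerivAt (flatten lam a b)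
    ((2 * lam + 1) / (b ^ (2 * lam + 1) - a ^ (2 * lam + 1)) * x ^ (2 * lam)) x := by
  refine (((Real.hasDerivAt_rpow_const (p := 2 * lam + 1) (Or.inl hx.ne')).sub_const
    (a ^ (2 * lam + 1))).div_const (b ^ (2 * lam + 1) - a ^ (2 * lam + 1))).congr_deriv ?_
  rw [add_sub_cancel_right]
  ring

variable (hlam : -1 / 2 < lam) (ha : 0 ≤ a) (hab : a < b)

include hlam ha hab

theorem rpow_sub_rpow_pos : 0 < b ^ (2 * lam + 1) - a ^ (2 * lam + 1) :=
  sub_pos.2 (Real.rpow_lt_rpow ha hab (by linarith))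

theorem strictMonoOn_flatten : StrictMonoOn (flatten lam a b) (Ici 0) := fun x hx y _ hxy =>
  div_lt_div_of_pos_right (sub_lt_sub_right (Real.rpow_lt_rpow hx hxy (by linarith)) _)
    (rpow_sub_rpow_pos hlam ha hab)

theorem strictMonoOn_unflatten : StrictMonoOn (unflatten lam a b) (Ici 0) := by
  intro s (hs : 0 ≤ s) t _ hst
  have hD := rpow_sub_rpow_pos hlam ha hab
  refine Real.rpow_lt_rpow (by positivity) ?_ (inv_pos.2 (by linarith))
  gcongr

theorem unflatten_nonneg {s : ℝ} (hs : 0 ≤ s) : 0 ≤ unflatten lam a b s := by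
  have hD := rpow_sub_rpow_pos hlam ha hab
  unfold unflatten
  positivity

theorem flatten_unflatten {s : ℝ} (hs : 0 ≤ s) : flatten lam a b (unflatten lam a b s) = s := by
  have hD := rpow_sub_rpow_pos hlam ha hab
  rw [flatten, unflatten, Real.rpow_inv_rpow (by positivity) (by linarith), add_sub_cancel_left,
    mul_div_cancel_right₀ _ hD.ne']

theorem unflatten_flatten {x : ℝ} (hx : 0 ≤ x) : unflatten lam a b (flatten lam a b x) = x := by
  rw [unflatten, flatten, div_mul_cancel₀ _ (rpow_sub_rpow_pos hlam ha hab).ne', add_sub_cancel,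
    Real.rpow_rpow_inv hx (by linarith)]

omit hab in
theorem unflatten_zero : unflatten lam a b 0 = a := by
  rw [unflatten, zero_mul, add_zero, Real.rpow_rpow_inv ha (by linarith)]

theorem unflatten_one : unflatten lam a b 1 = b := by
  rw [unflatten, one_mul, add_sub_cancel, Real.rpow_rpow_inv (ha.trans hab.le) (by linarith)]

theorem bijOn_flatten : BijOn (flatten lam a b) (Ioo a b) (Ioo 0 1) := by
  have hzero : flatten lam a b a = 0 := by simp [flatten]
  have hone : flatten lam a b b = 1 := div_self (rpow_sub_rpow_pos hlam ha hab).ne'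
  have hflatten := ((strictMonoOn_flatten hlam ha hab).mono
    fun x (hx : x ∈ Icc a b) => ha.trans hx.1).mapsTo_Ioo
  have hunflatten := ((strictMonoOn_unflatten hlam ha hab).mono
    fun s (hs : s ∈ Icc 0 1) => hs.1).mapsTo_Ioo
  rw [hzero, hone] at hflatten
  rw [unflatten_zero hlam ha, unflatten_one hlam ha hab] at hunflatten
  exact InvOn.bijOn ⟨fun x hx => unflatten_flatten hlam ha hab (ha.trans hx.1.le),
    fun s hs => flatten_unflatten hlam ha hab hs.1.le⟩ hflatten hunflatten

theorem lineMeasure_preimage_flatten_inter {A : Set ℝ} (hA : MeasurableSet A) :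
    lineMeasure lam (flatten lam a b ⁻¹' A ∩ Ioo a b) =
      ENNReal.ofReal ((b ^ (2 * lam + 1) - a ^ (2 * lam + 1)) / (2 * lam + 1)) *
        volume (A ∩ Ioo 0 1) := by
  have hk : 0 < 2 * lam + 1 := by linarith
  have hD := rpow_sub_rpow_pos hlam ha hab
  have hs : MeasurableSet (flatten lam a b ⁻¹' A ∩ Ioo a b) :=
    (measurable_flatten hA).inter measurableSet_Ioo
  have hmono : MonotoneOn (flatten lam a b) (flatten lam a b ⁻¹' A ∩ Ioo a b) :=
    (strictMonoOn_flatten hlam ha hab).monotoneOn.mono fun x hx => ha.trans hx.2.1.le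
  rw [lineMeasure_apply hs fun x hx => ha.trans_lt hx.2.1,
    ← (bijOn_flatten hlam ha hab).image_eq, inter_comm A, ← image_inter_preimage,
    inter_comm (Ioo a b), ← lintegral_deriv_eq_volume_image_of_monotoneOn hs
      (fun x hx => (hasDerivAt_flatten (ha.trans_lt hx.2.1)).hasDerivWithinAt) hmono,
    ← lintegral_const_mul' _ _ ENNReal.ofReal_ne_top]
  refine setLIntegral_congr_fun hs fun x _ => ?_
  rw [← ENNReal.ofReal_mul (by positivity)]
  congr 1
  field_simp

theorem lineMeasure_Ioo : lineMeasure lam (Ioo a b) =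
    ENNReal.ofReal ((b ^ (2 * lam + 1) - a ^ (2 * lam + 1)) / (2 * lam + 1)) := by
  simpa using lineMeasure_preimage_flatten_inter hlam ha hab MeasurableSet.univ

theorem map_flatten : ((lineMeasure lam).restrict (Ioo a b)).map (flatten lam a b) =
    lineMeasure lam (Ioo a b) • volume.restrict (Ico 0 1) := by
  ext A hA
  rw [Measure.map_apply measurable_flatten hA, Measure.restrict_apply (measurable_flatten hA),
    lineMeasure_preimage_flatten_inter hlam ha hab hA, lineMeasure_Ioo hlam ha hab,
    ← Measure.restrict_congr_set Ioo_ae_eq_Ico, Measure.smul_apply, smul_eq_mul,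
    Measure.restrict_apply hA]

theorem Ioo_unflatten_ae_eq {s t : ℝ} (hs : 0 ≤ s) (hst : s < t) (ht : t ≤ 1) :
    Ioo (unflatten lam a b s) (unflatten lam a b t) =ᵐ[lineMeasure lam]
      (Ioo a b ∩ flatten lam a b ⁻¹' Ico s t : Set ℝ) := by
  have hmono := strictMonoOn_flatten hlam ha hab
  have hmono' := (strictMonoOn_unflatten hlam ha hab).monotoneOn
  have ht₀ : 0 ≤ t := hs.trans hst.le
  have hs' := unflatten_nonneg hlam ha hab hs
  have ht' := unflatten_nonneg hlam ha hab ht₀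
  have hmem {x : ℝ} (hx : 0 ≤ x) : flatten lam a b x ∈ Ico s t ↔
      x ∈ Ico (unflatten lam a b s) (unflatten lam a b t) := by
    rw [mem_Ico, mem_Ico, ← hmono.le_iff_le hs' hx, ← hmono.lt_iff_lt hx ht',
      flatten_unflatten hlam ha hab hs, flatten_unflatten hlam ha hab ht₀]
  have hleft : a ≤ unflatten lam a b s :=
    (unflatten_zero hlam ha).ge.trans (hmono' self_mem_Ici hs hs)
  have hright : unflatten lam a b t ≤ b :=
    (hmono' ht₀ (mem_Ici.2 zero_le_one) ht).trans (unflatten_one hlam ha hab).le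
  refine Filter.EventuallyLE.antisymm (Filter.Eventually.of_forall ?_)
    (Filter.EventuallyLE.trans_eq (Filter.Eventually.of_forall ?_) Ioo_ae_eq_Ico.symm)
  · exact fun x hx => ⟨Ioo_subset_Ioo hleft hright hx,
      (hmem (hs'.trans hx.1.le)).2 (Ioo_subset_Ico_self hx)⟩
  · exact fun x hx => (hmem (ha.trans hx.1.1.le)).1 hx.2

end Line

theorem isRectangle_iff {R : Set (ℝ × ℝ)} : IsRectangle R ↔ ∃ a b c d : ℝ, 0 ≤ a ∧ a < b ∧ 0 ≤ c ∧
    c < d ∧ R = Ioo a b ×ˢ Ioo c d := by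
  constructor
  · rintro ⟨x, t, y, u, hx, ht, hy, hu, rfl⟩
    exact ⟨max (x - t) 0, x + t, max (y - u) 0, y + u, le_max_right _ _,
      max_lt (by linarith) (by linarith), le_max_right _ _, max_lt (by linarith) (by linarith),
      by rw [interval_eq_Ioo, interval_eq_Ioo]⟩
  · rintro ⟨a, b, c, d, ha, hab, hc, hcd, rfl⟩
    have hinterval {a b : ℝ} (ha : 0 ≤ a) : Ioo a b = interval ((a + b) / 2) ((b - a) / 2) := by
      rw [interval_eq_Ioo, show (a + b) / 2 - (b - a) / 2 = a by ring,
        show (a + b) / 2 + (b - a) / 2 = b by ring, max_eq_left ha]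
    exact ⟨(a + b) / 2, (b - a) / 2, (c + d) / 2, (d - c) / 2, by linarith, by linarith,
      by linarith, by linarith, by rw [hinterval ha, hinterval hc]⟩

theorem UnitSubsquare.cell_root_tree : tree.cell tree.root = Ico (0 : ℝ) 1 ×ˢ Ico (0 : ℝ) 1 := by
  simp [tree, toSet]

section Rectangle

variable {lam : ℝ} (hlam : -1 / 2 < lam) {R : Set (ℝ × ℝ)} (hR : IsRectangle R)

include hlam hR

theorem IsRectangle.measure_ne_zero : planeMeasure lam R ≠ 0 := by
  obtain ⟨a, b, c, d, ha, hab, hc, hcd, rfl⟩ := isRectangle_iff.1 hR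
  have hk : 0 < 2 * lam + 1 := by linarith
  rw [planeMeasure, Measure.prod_prod, lineMeasure_Ioo hlam ha hab, lineMeasure_Ioo hlam hc hcd]
  have h₁ := rpow_sub_rpow_pos hlam ha hab
  have h₂ := rpow_sub_rpow_pos hlam hc hcd
  exact mul_ne_zero (ENNReal.ofReal_pos.2 (by positivity)).ne'
    (ENNReal.ofReal_pos.2 (by positivity)).ne'

theorem IsRectangle.measure_ne_top : planeMeasure lam R ≠ ∞ := by
  obtain ⟨a, b, c, d, ha, hab, hc, hcd, rfl⟩ := isRectangle_iff.1 hR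
  rw [planeMeasure, Measure.prod_prod, lineMeasure_Ioo hlam ha hab, lineMeasure_Ioo hlam hc hcd]
  exact ENNReal.mul_ne_top ENNReal.ofReal_ne_top ENNReal.ofReal_ne_top

omit hR in
theorem map_prodMap_flatten {a b c d : ℝ} (ha : 0 ≤ a) (hab : a < b) (hc : 0 ≤ c) (hcd : c < d) :
    ((planeMeasure lam).restrict (Ioo a b ×ˢ Ioo c d)).map
        (Prod.map (flatten lam a b) (flatten lam c d)) =
      planeMeasure lam (Ioo a b ×ˢ Ioo c d) •
        volume.restrict (UnitSubsquare.tree.cell UnitSubsquare.tree.root) := by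
  rw [UnitSubsquare.cell_root_tree, planeMeasure, ← Measure.prod_restrict,
    ← Measure.map_prod_map _ _ measurable_flatten measurable_flatten, map_flatten hlam ha hab,
    map_flatten hlam hc hcd, Measure.prod_smul_left, Measure.prod_smul_right, Measure.prod_prod,
    Measure.prod_restrict, ← Measure.volume_eq_prod, smul_smul]

omit hR in
theorem exists_isRectangle_ae_eq_preimage_flatten {a b c d : ℝ} (ha : 0 ≤ a) (hab : a < b)
    (hc : 0 ≤ c) (hcd : c < d) (Q : UnitSubsquare) :
    ∃ R, IsRectangle R ∧ R =ᵐ[planeMeasure lam] (Ioo a b ×ˢ Ioo c d ∩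
      Prod.map (flatten lam a b) (flatten lam c d) ⁻¹' Q.toSet : Set (ℝ × ℝ)) := by
  have hs := lt_add_of_pos_right Q.s Q.r_pos
  have ht := lt_add_of_pos_right Q.t Q.r_pos
  refine ⟨Ioo (unflatten lam a b Q.s) (unflatten lam a b (Q.s + Q.r)) ×ˢ
    Ioo (unflatten lam c d Q.t) (unflatten lam c d (Q.t + Q.r)), isRectangle_iff.2 ⟨_, _, _, _,
      unflatten_nonneg hlam ha hab Q.s_nonneg,
      strictMonoOn_unflatten hlam ha hab Q.s_nonneg (Q.s_nonneg.trans hs.le) hs,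
      unflatten_nonneg hlam hc hcd Q.t_nonneg,
      strictMonoOn_unflatten hlam hc hcd Q.t_nonneg (Q.t_nonneg.trans ht.le) ht, rfl⟩, ?_⟩
  rw [UnitSubsquare.toSet, preimage_prod_map_prod, prod_inter_prod]
  exact Measure.set_prod_ae_eq
    (Ioo_unflatten_ae_eq hlam ha hab Q.s_nonneg hs Q.s_add_r_le)
    (Ioo_unflatten_ae_eq hlam hc hcd Q.t_nonneg ht Q.t_add_r_le)

theorem IsRectangle.exists_partitionTree :
    ∃ T : PartitionTree (planeMeasure lam) UnitSubsquare (Bool × Bool),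
      T.cell T.root = R ∧ T.Differentiates ∧
        ∀ Q, ∃ R', IsRectangle R' ∧ R' =ᵐ[planeMeasure lam] T.cell Q := by
  have hR₀ := hR.measure_ne_zero hlam
  have hR_top := hR.measure_ne_top hlam
  have hRm := hR.measurableSet
  obtain ⟨a, b, c, d, ha, hab, hc, hcd, rfl⟩ := isRectangle_iff.1 hR
  have hφ : Measurable (Prod.map (flatten lam a b) (flatten lam c d)) := by fun_prop
  have hmaps : MapsTo (Prod.map (flatten lam a b) (flatten lam c d)) (Ioo a b ×ˢ Ioo c d)
      (UnitSubsquare.tree.cell UnitSubsquare.tree.root) := by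
    rw [UnitSubsquare.cell_root_tree]
    exact fun x hx => ⟨Ioo_subset_Ico_self ((bijOn_flatten hlam ha hab).mapsTo hx.1),
      Ioo_subset_Ico_self ((bijOn_flatten hlam hc hcd).mapsTo hx.2)⟩
  have hinv : LeftInvOn (Prod.map (unflatten lam a b) (unflatten lam c d))
      (Prod.map (flatten lam a b) (flatten lam c d)) (Ioo a b ×ˢ Ioo c d) := fun x hx =>
    Prod.ext (unflatten_flatten hlam ha hab (ha.trans hx.1.1.le))
      (unflatten_flatten hlam hc hcd (hc.trans hx.2.1.le))
  have hmap := map_prodMap_flatten hlam ha hab hc hcd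
  exact ⟨UnitSubsquare.tree.comap hRm hφ hmap hR₀ hR_top,
    PartitionTree.cell_root_comap hRm hφ hmap hR₀ hR_top hmaps,
    UnitSubsquare.differentiates_tree.comap hRm hφ hmap hR₀ hR_top hinv hmaps
      (by fun_prop),
    exists_isRectangle_ae_eq_preimage_flatten hlam ha hab hc hcd⟩

end Rectangle

/-! ### Higher integrability of functions of bounded mean oscillation -/

theorem setAverage_norm_sub_eq_toReal_meanOsc {lam : ℝ} {R : Set (ℝ × ℝ)} {f : ℝ × ℝ → ℂ}
    (hf : AEStronglyMeasurable f (planeMeasure lam)) :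
    ⨍ x in R, ‖f x - ⨍ y in R, f y ∂(planeMeasure lam)‖ ∂(planeMeasure lam) =
      (meanOsc lam f R).toReal := by
  rw [setAverage_eq, meanOsc, ENNReal.toReal_mul, ENNReal.toReal_inv, smul_eq_mul, Measure.real]
  congr 1
  exact integral_norm_eq_lintegral_enorm (hf.restrict.sub aestronglyMeasurable_const)

section JohnNirenberg

variable {lam : ℝ} (hlam : -1 / 2 < lam) {R : Set (ℝ × ℝ)} (hR : IsRectangle R) {f : ℝ × ℝ → ℂ}
  (hf : Measurable f) {M : ℝ} (hM : 0 < M) (hosc : bmoNorm lam f ≤ ENNReal.ofReal M)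

include hlam hR hf hM hosc

theorem setLIntegral_enorm_sub_average_pow_le (n : ℕ) :
    ∫⁻ x in R, ‖f x - ⨍ y in R, f y ∂(planeMeasure lam)‖ₑ ^ n ∂(planeMeasure lam) ≤
      ENNReal.ofReal (johnNirenbergConst 4 n * M ^ n) * planeMeasure lam R := by
  have hint : IntegrableOn f R (planeMeasure lam) := integrableOn_of_bmoNorm
    hf.aestronglyMeasurable (hosc.trans_lt ENNReal.ofReal_lt_top) hR (hR.measure_ne_top hlam)
  obtain ⟨T, rfl, hT, hcell⟩ := hR.exists_partitionTree hlam
  have hosc_cell (Q : UnitSubsquare) : T.average (fun x => ‖f x - T.average f Q‖) Q ≤ M := by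
    obtain ⟨R', hR', hae⟩ := hcell Q
    rw [PartitionTree.average, PartitionTree.average, ← setAverage_congr hae,
      ← setAverage_congr hae, setAverage_norm_sub_eq_toReal_meanOsc hf.aestronglyMeasurable]
    exact ENNReal.toReal_le_of_le_ofReal hM.le ((meanOsc_le_bmoNorm lam f hR').trans hosc)
  exact T.lintegral_enorm_sub_average_pow_le hT hf hint hM hosc_cell n

theorem eLpNorm_sub_average_natCast_le {n : ℕ} (hn : n ≠ 0) :
    eLpNorm (fun x => f x - ⨍ y in R, f y ∂(planeMeasure lam)) n ((planeMeasure lam).restrict R) ≤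
      ENNReal.ofReal (johnNirenbergConst 4 n ^ (n : ℝ)⁻¹ * M) * planeMeasure lam R ^ (n : ℝ)⁻¹ := by
  have hC : 0 ≤ johnNirenbergConst 4 n := by
    unfold johnNirenbergConst
    positivity
  rw [eLpNorm_eq_lintegral_rpow_enorm_toReal (by exact_mod_cast hn) (by simp)]
  simp only [ENNReal.toReal_natCast, ENNReal.rpow_natCast, one_div]
  refine (ENNReal.rpow_le_rpow (setLIntegral_enorm_sub_average_pow_le hlam hR hf hM hosc n)
    (by positivity)).trans_eq ?_
  rw [ENNReal.mul_rpow_of_nonneg _ _ (by positivity),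
    ENNReal.ofReal_rpow_of_nonneg (by positivity) (by positivity),
    Real.mul_rpow hC (by positivity), Real.pow_rpow_inv_natCast hM.le hn]

omit hR hf hM hosc in
theorem exists_eLpNorm_sub_average_le {p : ℝ≥0∞} (hp : p ≠ ∞) :
    ∃ K : ℝ, 0 < K ∧ ∀ R, IsRectangle R → ∀ f : ℝ × ℝ → ℂ, Measurable f → ∀ M : ℝ, 0 < M →
      bmoNorm lam f ≤ ENNReal.ofReal M →
        eLpNorm (fun x => f x - ⨍ y in R, f y ∂(planeMeasure lam)) p
          ((planeMeasure lam).restrict R) ≤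
            ENNReal.ofReal (K * M) * planeMeasure lam R ^ p.toReal⁻¹ := by
  obtain ⟨n, hn⟩ := ENNReal.exists_nat_gt hp
  have hn₀ : n ≠ 0 := by
    rintro rfl
    simp at hn
  refine ⟨johnNirenbergConst 4 n ^ (n : ℝ)⁻¹, ?_, fun R hR f hf M hM hosc => ?_⟩
  · have := Real.log_pos one_lt_two
    unfold johnNirenbergConst
    positivity
  calc _ ≤ eLpNorm (fun x => f x - ⨍ y in R, f y ∂(planeMeasure lam)) n
          ((planeMeasure lam).restrict R) *
            planeMeasure lam R ^ (1 / p.toReal - 1 / (n : ℝ)) := by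
        simpa using eLpNorm_le_eLpNorm_mul_rpow_measure_univ (μ := (planeMeasure lam).restrict R)
          hn.le (hf.sub_const _).aestronglyMeasurable
    _ ≤ ENNReal.ofReal (johnNirenbergConst 4 n ^ (n : ℝ)⁻¹ * M) *
          planeMeasure lam R ^ (n : ℝ)⁻¹ * planeMeasure lam R ^ (1 / p.toReal - 1 / (n : ℝ)) := by
        gcongr
        exact eLpNorm_sub_average_natCast_le hlam hR hf hM hosc hn₀
    _ = _ := by
        rw [mul_assoc, ← ENNReal.rpow_add _ _ (hR.measure_ne_zero hlam) (hR.measure_ne_top hlam)]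
        congr 2
        ring

end JohnNirenberg

/-! ### Completeness of the little Hardy space -/

namespace LittleHardy

variable {lam : ℝ} {q : ℝ≥0∞}

theorem toLp_injective : Function.Injective (toLp : LittleHardy lam q → _) :=
  Subtype.val_injective

theorem norm_le_tsum {f : LittleHardy lam q} {α : ℕ → ℂ} {a : ℕ → Lp ℂ 1 (planeMeasure lam)}
    (h : IsAtomicDecomposition lam q f.toLp α a) : ‖f‖ ≤ ∑' i, ‖α i‖ :=
  atomicNorm_le h

variable [hq : Fact (1 < q)]

/-- The inclusion of `h^{1,q}(ℝ_λ)` into `L¹(ℝ_λ)`, as a continuous linear map. -/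
def toLpCLM (lam : ℝ) (q : ℝ≥0∞) [hq : Fact (1 < q)] :
    LittleHardy lam q →L[ℂ] Lp ℂ 1 (planeMeasure lam) :=
  LinearMap.mkContinuous
    { toFun := toLp
      map_add' := fun _ _ => rfl
      map_smul' := fun _ _ => rfl } 1 fun f => by
    rw [one_mul]
    exact norm_le_atomicNorm hq.out f.mem

@[simp] theorem toLpCLM_apply (f : LittleHardy lam q) : toLpCLM lam q f = f.toLp := rfl

theorem exists_hasSum_toLp {u : ℕ → LittleHardy lam q} {v : ℕ → ℝ} (hv : Summable v)
    (huv : ∀ k, ‖u k‖ < v k) :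
    ∃ g : LittleHardy lam q, HasSum (fun k => (u k).toLp) g.toLp ∧ ‖g‖ ≤ ∑' k, v k := by
  choose α a hdec hlt using fun k => exists_lt_of_atomicNorm_lt (u k).mem (huv k)
  have hα : Summable fun x : ℕ × ℕ => ‖α x.1 x.2‖ := by
    rw [summable_prod_of_nonneg fun _ => norm_nonneg _]
    exact ⟨fun k => (hdec k).summable, hv.of_nonneg_of_le
      (fun k => tsum_nonneg fun _ => norm_nonneg _) fun k => (hlt k).le⟩
  have hαa : Summable fun x : ℕ × ℕ => α x.1 x.2 • a x.1 x.2 := by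
    refine Summable.of_norm_bounded hα fun x => ?_
    rw [norm_smul]
    exact mul_le_of_le_one_right (norm_nonneg _) (((hdec x.1).isAtom x.2).norm_le_one hq.out)
  obtain ⟨e⟩ : Nonempty (ℕ ≃ ℕ × ℕ) := ⟨Nat.pairEquiv.symm⟩
  have hdec_all : IsAtomicDecomposition lam q (∑' x : ℕ × ℕ, α x.1 x.2 • a x.1 x.2)
      (fun i => α (e i).1 (e i).2) (fun i => a (e i).1 (e i).2) :=
    ⟨fun i => (hdec _).isAtom _, e.summable_iff.2 hα, e.hasSum_iff.2 hαa.hasSum⟩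
  let g : LittleHardy lam q := ⟨_, _, _, hdec_all⟩
  refine ⟨g, HasSum.prod_fiberwise hαa.hasSum fun k => (hdec k).hasSum,
    (norm_le_tsum (f := g) hdec_all).trans ?_⟩
  rw [e.tsum_eq (fun x : ℕ × ℕ => ‖α x.1 x.2‖), hα.tsum_prod]
  exact hα.prod.tsum_le_tsum (fun k => (hlt k).le) hv

instance : CompleteSpace (LittleHardy lam q) := by
  refine NormedAddCommGroup.completeSpace_of_summable_imp_tendsto fun u hu => ?_
  let v (k : ℕ) : ℝ := ‖u k‖ + (1 / 2) ^ k
  have hv : Summable v := hu.add summable_geometric_two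
  have huv (k : ℕ) : ‖u k‖ < v k := lt_add_of_pos_right _ (by positivity)
  obtain ⟨g, hg, -⟩ := exists_hasSum_toLp hv huv
  refine ⟨g, tendsto_iff_norm_sub_tendsto_zero.2 <|
    squeeze_zero (fun _ => norm_nonneg _) (fun n => ?_) (tendsto_sum_nat_add v)⟩
  obtain ⟨r, hr, hrn⟩ := exists_hasSum_toLp ((summable_nat_add_iff n).2 hv) fun k => huv (k + n)
  have hsum : g = r + ∑ i ∈ Finset.range n, u i := toLp_injective <| by
    rw [hg.unique ((hasSum_nat_add_iff (f := fun k => (u k).toLp) n).1 hr),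
      ← toLpCLM_apply (r + _), map_add, map_sum]
    simp only [toLpCLM_apply]
  rwa [norm_sub_rev, hsum, add_sub_cancel_right]

end LittleHardy

/-! ### Bounded functions as elements of the little Hardy space -/

theorem indicator_ae_eq_self {X E : Type*} [MeasurableSpace X] [Zero E] {μ : Measure X} {R : Set X}
    {f : X → E} (hf : ∀ᵐ x ∂μ, x ∉ R → f x = 0) : R.indicator f =ᵐ[μ] f := by
  filter_upwards [hf] with x hx
  exact indicator_apply_eq_self.2 hx

theorem IsAtom.isAtomicDecomposition_smul {lam : ℝ} {q : ℝ≥0∞} {a : Lp ℂ 1 (planeMeasure lam)}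
    (ha : IsAtom lam q a) (z : ℂ) :
    IsAtomicDecomposition lam q (z • a) (Pi.single 0 z) fun _ => a where
  isAtom _ := ha
  summable := (hasSum_single 0 fun i hi => by simp [hi]).summable
  hasSum := by
    simpa using hasSum_single (f := fun i : ℕ => (Pi.single 0 z : ℕ → ℂ) i • a) 0
      fun i hi => by simp [hi]

theorem isAtom_inv_smul {lam : ℝ} {q : ℝ≥0∞} {f : Lp ℂ 1 (planeMeasure lam)}
    (hf : MemLp f q (planeMeasure lam)) {R : Set (ℝ × ℝ)} (hR : IsRectangle R)
    (hsupp : ∀ᵐ x ∂(planeMeasure lam), x ∉ R → f x = 0) (hint : ∫ x, f x ∂(planeMeasure lam) = 0)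
    {A : ℝ} (hA : 0 < A) (hle : eLpNorm f q (planeMeasure lam) ≤
      ENNReal.ofReal A * planeMeasure lam R ^ ((q⁻¹).toReal - 1)) :
    IsAtom lam q ((A : ℂ)⁻¹ • f) := by
  have hcoe : ((A : ℂ)⁻¹ • f : Lp ℂ 1 (planeMeasure lam)) =ᵐ[planeMeasure lam]
    (A : ℂ)⁻¹ • (f : ℝ × ℝ → ℂ) := Lp.coeFn_smul _ _
  refine ⟨(memLp_congr_ae hcoe).2 (hf.const_smul _), ⟨R, hR, ?_, ?_⟩, ?_⟩
  · filter_upwards [hcoe, hsupp] with x hx hx₀ hxR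
    rw [hx, Pi.smul_apply, hx₀ hxR, smul_zero]
  · have hnorm : ‖(A : ℂ)⁻¹‖ₑ = (ENNReal.ofReal A)⁻¹ := by
      rw [← ofReal_norm, norm_inv, Complex.norm_real, Real.norm_of_nonneg hA.le,
        ENNReal.ofReal_inv_of_pos hA]
    rw [eLpNorm_congr_ae hcoe, eLpNorm_const_smul, hnorm, mul_comm, ← div_eq_mul_inv]
    exact ENNReal.div_le_of_le_mul' hle
  · rw [integral_congr_ae hcoe]
    simp only [Pi.smul_apply]
    rw [integral_smul, hint, smul_zero]

theorem exists_toLp_eq_of_eLpNorm_le {lam : ℝ} {q : ℝ≥0∞} {f : Lp ℂ 1 (planeMeasure lam)}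
    (hf : MemLp f q (planeMeasure lam)) {R : Set (ℝ × ℝ)} (hR : IsRectangle R)
    (hsupp : ∀ᵐ x ∂(planeMeasure lam), x ∉ R → f x = 0) (hint : ∫ x, f x ∂(planeMeasure lam) = 0)
    {A : ℝ} (hA : 0 ≤ A) (hle : eLpNorm f q (planeMeasure lam) ≤
      ENNReal.ofReal A * planeMeasure lam R ^ ((q⁻¹).toReal - 1)) :
    ∃ u : LittleHardy lam q, u.toLp = f ∧ ‖u‖ ≤ A := by
  have hdec (B : ℝ) (hB : A < B) :
      IsAtomicDecomposition lam q f (Pi.single 0 (B : ℂ)) fun _ => (B : ℂ)⁻¹ • f := by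
    have hB₀ : (B : ℂ) ≠ 0 := by exact_mod_cast (hA.trans_lt hB).ne'
    simpa only [smul_inv_smul₀ hB₀] using (isAtom_inv_smul hf hR hsupp hint (hA.trans_lt hB)
      (hle.trans (by gcongr))).isAtomicDecomposition_smul B
  refine ⟨⟨f, _, _, hdec (A + 1) (lt_add_one A)⟩, rfl,
    le_of_forall_gt_imp_ge_of_dense fun B hB => ?_⟩
  refine (LittleHardy.norm_le_tsum (hdec B hB)).trans_eq ?_
  rw [tsum_eq_single 0 fun i hi => by simp [hi]]
  simp [(hA.trans_lt hB).le]

/-- The bounded measurable functions with integral zero which vanish outside `R`. -/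
def bddMeanZero (lam : ℝ) (R : Set (ℝ × ℝ)) : Submodule ℂ (ℝ × ℝ → ℂ) where
  carrier := {f | Measurable f ∧ Integrable f (planeMeasure lam) ∧ (∀ x ∉ R, f x = 0) ∧
    (∃ K : ℝ, ∀ x, ‖f x‖ ≤ K) ∧ ∫ x, f x ∂(planeMeasure lam) = 0}
  zero_mem' := ⟨measurable_zero, integrable_zero _ _ _, fun _ _ => rfl, ⟨0, fun _ => by simp⟩,
    by simp⟩
  add_mem' := by
    rintro f g ⟨hf, hf', hfR, ⟨K, hK⟩, hf₀⟩ ⟨hg, hg', hgR, ⟨L, hL⟩, hg₀⟩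
    refine ⟨hf.add hg, hf'.add hg', fun x hx => ?_,
      ⟨K + L, fun x => norm_add_le_of_le (hK x) (hL x)⟩, ?_⟩
    · rw [Pi.add_apply, hfR x hx, hgR x hx, add_zero]
    · rw [integral_add' hf' hg', hf₀, hg₀, add_zero]
  smul_mem' := by
    rintro z f ⟨hf, hf', hfR, ⟨K, hK⟩, hf₀⟩
    refine ⟨hf.const_smul z, hf'.smul z, fun x hx => ?_, ⟨‖z‖ * K, fun x => ?_⟩, ?_⟩
    · rw [Pi.smul_apply, hfR x hx, smul_zero]
    · rw [Pi.smul_apply, norm_smul]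
      gcongr
      exact hK x
    · simp only [Pi.smul_apply]
      rw [integral_smul, hf₀, smul_zero]

theorem mem_bddMeanZero_of_bound {lam : ℝ} {R : Set (ℝ × ℝ)} (hfin : planeMeasure lam R ≠ ∞)
    {f : ℝ × ℝ → ℂ} (hf : Measurable f) (hsupp : ∀ x ∉ R, f x = 0) {K : ℝ}
    (hK : ∀ x, ‖f x‖ ≤ K) (hint : ∫ x, f x ∂(planeMeasure lam) = 0) : f ∈ bddMeanZero lam R := by
  have hfR : IntegrableOn f R (planeMeasure lam) :=
    Measure.integrableOn_of_bounded hfin hf.aestronglyMeasurable (Filter.Eventually.of_forall hK)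
  exact ⟨hf, (integrableOn_iff_integrable_of_support_subset fun x hx => by
    by_contra h
    exact hx (hsupp x h)).1 hfR, hsupp, ⟨K, hK⟩, hint⟩

theorem bddMeanZero_mono {lam : ℝ} {R R' : Set (ℝ × ℝ)} (h : R ⊆ R') :
    bddMeanZero lam R ≤ bddMeanZero lam R' := fun _ hf =>
  ⟨hf.1, hf.2.1, fun x hx => hf.2.2.1 x fun hxR => hx (h hxR), hf.2.2.2⟩

section Embedding

variable {lam : ℝ} (q : ℝ≥0∞) (hlam : -1 / 2 < lam) {R : Set (ℝ × ℝ)}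

include hlam in
theorem exists_toLp_eq_toL1_of_bound {f : ℝ × ℝ → ℂ} (hf : Integrable f (planeMeasure lam))
    (hint : ∫ x, f x ∂(planeMeasure lam) = 0) (hR : IsRectangle R)
    (hsupp : ∀ᵐ x ∂(planeMeasure lam), x ∉ R → f x = 0) {K : ℝ} (hK₀ : 0 ≤ K)
    (hK : ∀ᵐ x ∂(planeMeasure lam), ‖f x‖ ≤ K) :
    ∃ u : LittleHardy lam q, u.toLp = hf.toL1 ∧ ‖u‖ ≤ K * (planeMeasure lam).real R := by
  have hR₀ := hR.measure_ne_zero hlam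
  have hR_top := hR.measure_ne_top hlam
  have hcoe : (hf.toL1 : ℝ × ℝ → ℂ) =ᵐ[planeMeasure lam] f := hf.coeFn_toL1
  have hle : eLpNorm f q (planeMeasure lam) ≤
      ENNReal.ofReal (K * (planeMeasure lam).real R) *
        planeMeasure lam R ^ ((q⁻¹).toReal - 1) := by
    rw [← eLpNorm_congr_ae (indicator_ae_eq_self hsupp),
      eLpNorm_indicator_eq_eLpNorm_restrict hR.measurableSet]
    refine (eLpNorm_le_of_ae_bound (ae_restrict_of_ae hK)).trans_eq ?_
    rw [Measure.restrict_apply_univ, ENNReal.ofReal_mul hK₀, ofReal_measureReal hR_top, mul_comm,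
      mul_assoc, ENNReal.rpow_sub _ _ hR₀ hR_top, ENNReal.rpow_one,
      ENNReal.mul_div_cancel hR₀ hR_top, ENNReal.toReal_inv]
  refine exists_toLp_eq_of_eLpNorm_le ((memLp_congr_ae hcoe).2 ⟨hf.1, hle.trans_lt ?_⟩) hR ?_ ?_
    (by positivity) ((eLpNorm_congr_ae hcoe).trans_le hle)
  · exact ENNReal.mul_lt_top ENNReal.ofReal_lt_top
      (ENNReal.rpow_ne_top_of_ne_zero hR₀ hR_top).lt_top
  · filter_upwards [hcoe, hsupp] with x hx hx₀ hxR
    rw [hx, hx₀ hxR]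
  · rw [integral_congr_ae hcoe, hint]

/-- The embedding of the bounded functions with integral zero on a rectangle into
`h^{1,q}(ℝ_λ)`. -/
def bddToHardy (hR : IsRectangle R) : bddMeanZero lam R →ₗ[ℂ] LittleHardy lam q where
  toFun f := ⟨f.2.2.1.toL1, by
    obtain ⟨-, hint, hsupp, ⟨K, hK⟩, hzero⟩ := f.2
    obtain ⟨u, hu, -⟩ := exists_toLp_eq_toL1_of_bound q hlam hint hzero hR
      (Filter.Eventually.of_forall hsupp) ((norm_nonneg _).trans (hK 0))
      (Filter.Eventually.of_forall hK)
    rw [← hu]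
    exact u.mem⟩
  map_add' f g := Subtype.ext (Integrable.toL1_add _ _ f.2.2.1 g.2.2.1)
  map_smul' z f := Subtype.ext (Integrable.toL1_smul _ f.2.2.1 z)

theorem coeFn_bddToHardy (hR : IsRectangle R) (f : bddMeanZero lam R) :
    ((bddToHardy q hlam hR f).toLp : ℝ × ℝ → ℂ) =ᵐ[planeMeasure lam] f :=
  f.2.2.1.coeFn_toL1

theorem norm_bddToHardy_le (hR : IsRectangle R) (f : bddMeanZero lam R) {R' : Set (ℝ × ℝ)}
    (hR' : IsRectangle R') (hsupp : ∀ᵐ x ∂(planeMeasure lam), x ∉ R' → (f : ℝ × ℝ → ℂ) x = 0)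
    {K : ℝ} (hK : ∀ x, ‖(f : ℝ × ℝ → ℂ) x‖ ≤ K) :
    ‖bddToHardy q hlam hR f‖ ≤ K * (planeMeasure lam).real R' := by
  obtain ⟨u, hu, hnorm⟩ := exists_toLp_eq_toL1_of_bound q hlam f.2.2.1 f.2.2.2.2.2 hR' hsupp
    ((norm_nonneg _).trans (hK 0)) (Filter.Eventually.of_forall hK)
  rwa [LittleHardy.toLp_injective (a₁ := bddToHardy q hlam hR f) hu.symm]

end Embedding

/-! ### Truncation and mean oscillation -/

/-- Truncation of the real and imaginary parts at height `N`, by which integrals against unbounded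
`bmo` functions are reduced to integrals against bounded ones. -/
def trunc (N : ℕ) (z : ℂ) : ℂ := ⟨max (-N) (min N z.re), max (-N) (min N z.im)⟩

theorem lipschitzWith_trunc (N : ℕ) : LipschitzWith 2 (trunc N) := by
  have hclamp : LipschitzWith 1 fun x : ℝ => max (-(N : ℝ)) (min (N : ℝ) x) :=
    (LipschitzWith.id.const_min _).const_max _
  refine LipschitzWith.of_dist_le_mul fun z w => ?_
  have hre := hclamp.dist_le_mul z.re w.re
  have him := hclamp.dist_le_mul z.im w.im
  have hre' := Complex.abs_re_le_norm (z - w)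
  have him' := Complex.abs_im_le_norm (z - w)
  simp only [Real.dist_eq, NNReal.coe_one, one_mul] at hre him
  simp only [dist_eq_norm, NNReal.coe_ofNat]
  refine (Complex.norm_le_abs_re_add_abs_im _).trans ?_
  simp only [Complex.sub_re, Complex.sub_im, trunc] at hre' him' ⊢
  linarith

theorem measurable_trunc (N : ℕ) : Measurable (trunc N) :=
  (lipschitzWith_trunc N).continuous.measurable

theorem trunc_eq_self {N : ℕ} {z : ℂ} (h : ‖z‖ ≤ N) : trunc N z = z := by
  have hre := abs_le.1 ((Complex.abs_re_le_norm z).trans h)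
  have him := abs_le.1 ((Complex.abs_im_le_norm z).trans h)
  refine Complex.ext ?_ ?_
  · simp only [trunc, min_eq_right hre.2, max_eq_right hre.1]
  · simp only [trunc, min_eq_right him.2, max_eq_right him.1]

theorem norm_trunc_le (N : ℕ) (z : ℂ) : ‖trunc N z‖ ≤ 2 * ‖z‖ := by
  simpa [trunc_eq_self (N := N) (z := 0), dist_zero_right] using
    (lipschitzWith_trunc N).dist_le_mul z 0

theorem norm_trunc_le_natCast (N : ℕ) (z : ℂ) : ‖trunc N z‖ ≤ 2 * N := by
  have hclamp (x : ℝ) : |max (-(N : ℝ)) (min (N : ℝ) x)| ≤ N :=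
    abs_le.2 ⟨le_max_left _ _, max_le (by linarith [N.cast_nonneg (α := ℝ)]) (min_le_left _ _)⟩
  refine (Complex.norm_le_abs_re_add_abs_im _).trans ?_
  simp only [trunc]
  linarith [hclamp z.re, hclamp z.im]

theorem tendsto_trunc (z : ℂ) : Filter.Tendsto (trunc · z) Filter.atTop (nhds z) := by
  obtain ⟨n, hn⟩ := exists_nat_ge ‖z‖
  refine tendsto_const_nhds.congr' ?_
  filter_upwards [Filter.eventually_ge_atTop n] with N hN
  exact (trunc_eq_self (hn.trans (by exact_mod_cast hN))).symm

theorem lintegral_enorm_sub_average_le {X E : Type*} [MeasurableSpace X] [NormedAddCommGroup E]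
    [NormedSpace ℝ E] [CompleteSpace E] {μ : Measure X} [IsFiniteMeasure μ] {g : X → E}
    (hg : Integrable g μ) (z : E) :
    ∫⁻ x, ‖g x - ⨍ y, g y ∂μ‖ₑ ∂μ ≤ 2 * ∫⁻ x, ‖g x - z‖ₑ ∂μ := by
  have haverage : ∫⁻ _, ‖⨍ y, g y ∂μ - z‖ₑ ∂μ ≤ ∫⁻ x, ‖g x - z‖ₑ ∂μ := by
    have hsmul : ∫ x, (g x - z) ∂μ = μ.real univ • (⨍ y, g y ∂μ - z) := by
      rw [smul_sub, measure_smul_average, integral_sub hg (integrable_const z), integral_const]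
    rw [lintegral_const, ← ofReal_measureReal, mul_comm, ← Real.enorm_of_nonneg measureReal_nonneg,
      ← enorm_smul, ← hsmul]
    exact enorm_integral_le_lintegral_enorm _
  calc _ ≤ ∫⁻ x, (‖g x - z‖ₑ + ‖⨍ y, g y ∂μ - z‖ₑ) ∂μ := by
        gcongr with x
        rw [← sub_sub_sub_cancel_right _ _ z]
        exact enorm_sub_le
    _ = ∫⁻ x, ‖g x - z‖ₑ ∂μ + ∫⁻ _, ‖⨍ y, g y ∂μ - z‖ₑ ∂μ :=
        lintegral_add_right _ measurable_const
    _ ≤ _ := (add_le_add_right haverage _).trans_eq (two_mul _).symm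

theorem meanOsc_comp_le {lam : ℝ} {R : Set (ℝ × ℝ)} (hR : planeMeasure lam R ≠ ∞) {T : ℂ → ℂ}
    {L : NNReal} (hT : LipschitzWith L T) {b : ℝ × ℝ → ℂ}
    (hTb : IntegrableOn (fun x => T (b x)) R (planeMeasure lam)) :
    meanOsc lam (fun x => T (b x)) R ≤ 2 * L * meanOsc lam b R := by
  have : IsFiniteMeasure ((planeMeasure lam).restrict R) := isFiniteMeasure_restrict.2 hR
  unfold meanOsc
  rw [mul_left_comm]
  gcongr
  refine (lintegral_enorm_sub_average_le hTb (T (⨍ y in R, b y ∂(planeMeasure lam)))).trans ?_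
  rw [mul_assoc, ← lintegral_const_mul' _ _ ENNReal.coe_ne_top]
  gcongr with x
  simpa only [edist_eq_enorm_sub] using hT (b x) (⨍ y in R, b y ∂(planeMeasure lam))

theorem bmoNorm_trunc_le {lam : ℝ} (hlam : -1 / 2 < lam) {b : ℝ × ℝ → ℂ} (hb : Measurable b)
    (N : ℕ) : bmoNorm lam (fun x => trunc N (b x)) ≤ 4 * bmoNorm lam b := by
  refine iSup₂_le fun R hR => ?_
  have hint : IntegrableOn (fun x => trunc N (b x)) R (planeMeasure lam) :=
    Measure.integrableOn_of_bounded (hR.measure_ne_top hlam)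
      ((measurable_trunc N).comp hb).aestronglyMeasurable
      (Filter.Eventually.of_forall fun x => norm_trunc_le_natCast N _)
  refine (meanOsc_comp_le (hR.measure_ne_top hlam) (lipschitzWith_trunc N) hint).trans ?_
  rw [ENNReal.coe_ofNat, show (2 * 2 : ℝ≥0∞) = 4 by norm_num]
  gcongr
  exact meanOsc_le_bmoNorm lam b hR

/-! ### Pairing of `bmo` functions with atoms -/

theorem integrable_mul_and_enorm_integral_mul_le {X : Type*} [MeasurableSpace X] {μ : Measure X}
    {p q : ℝ≥0∞} [ENNReal.HolderConjugate p q] {R : Set X} (hR : MeasurableSet R) {b a : X → ℂ}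
    {z : ℂ} (hb : MemLp (fun x => b x - z) p (μ.restrict R)) (ha : Integrable a μ)
    (haq : MemLp a q μ) (hsupp : ∀ᵐ x ∂μ, x ∉ R → a x = 0) (hint : ∫ x, a x ∂μ = 0) :
    Integrable (fun x => b x * a x) μ ∧ ‖∫ x, b x * a x ∂μ‖ₑ ≤
      eLpNorm (fun x => b x - z) p (μ.restrict R) * eLpNorm a q μ := by
  have hind : (R.indicator fun x => (b x - z) * a x) =ᵐ[μ] fun x => (b x - z) * a x :=
    indicator_ae_eq_self <| by
      filter_upwards [hsupp] with x hx hxR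
      rw [hx hxR, mul_zero]
  have hmul : MemLp (fun x => (b x - z) * a x) 1 (μ.restrict R) := (haq.restrict R).mul' hb
  have hcentred : Integrable (fun x => (b x - z) * a x) μ :=
    ((integrable_indicator_iff hR).2 (memLp_one_iff_integrable.1 hmul)).congr hind
  have hsplit : (fun x => b x * a x) = fun x => (b x - z) * a x + z * a x := by
    ext x
    ring
  refine ⟨hsplit ▸ hcentred.add (ha.const_mul z), ?_⟩
  calc ‖∫ x, b x * a x ∂μ‖ₑ = ‖∫ x, (b x - z) * a x ∂μ‖ₑ := by
        rw [hsplit, integral_add hcentred (ha.const_mul z), integral_const_mul, hint, mul_zero,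
          add_zero]
    _ ≤ eLpNorm (fun x => (b x - z) * a x) 1 (μ.restrict R) := by
        rw [← eLpNorm_indicator_eq_eLpNorm_restrict hR, eLpNorm_congr_ae hind,
          eLpNorm_one_eq_lintegral_enorm]
        exact enorm_integral_le_lintegral_enorm _
    _ ≤ eLpNorm (fun x => b x - z) p (μ.restrict R) * eLpNorm a q (μ.restrict R) :=
        eLpNorm_smul_le_mul_eLpNorm (φ := fun x => b x - z) haq.1.restrict hb.1
    _ ≤ eLpNorm (fun x => b x - z) p (μ.restrict R) * eLpNorm a q μ := by
        gcongr
        exact Measure.restrict_le_self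

theorem exists_norm_integral_mul_le {lam : ℝ} (hlam : -1 / 2 < lam) {q : ℝ≥0∞} (hq : 1 < q) :
    ∃ K : ℝ, 0 < K ∧ ∀ a, IsAtom lam q a → ∀ b : ℝ × ℝ → ℂ, Measurable b → bmoNorm lam b ≠ ∞ →
      Integrable (fun x => b x * a x) (planeMeasure lam) ∧
        ‖∫ x, b x * a x ∂(planeMeasure lam)‖ ≤ K * (bmoNorm lam b).toReal := by
  have hpq : ENNReal.HolderConjugate q.conjExponent q :=
    (ENNReal.HolderConjugate.conjExponent hq.le).symm
  have hp : q.conjExponent ≠ ∞ := by simp [ENNReal.conjExponent, tsub_eq_zero_iff_le, hq]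
  obtain ⟨K, hK, hJN⟩ := exists_eLpNorm_sub_average_le hlam hp
  refine ⟨K, hK, fun a ⟨haq, ⟨R, hR, hsupp, hle⟩, hint⟩ b hb hbmo => ?_⟩
  have hR₀ := hR.measure_ne_zero hlam
  have hR_top := hR.measure_ne_top hlam
  have hM₀ {M : ℝ} (hM : (bmoNorm lam b).toReal < M) : 0 < M := ENNReal.toReal_nonneg.trans_lt hM
  have hosc {M : ℝ} (hM : (bmoNorm lam b).toReal < M) :=
    hJN R hR b hb M (hM₀ hM) ((ENNReal.le_ofReal_iff_toReal_le hbmo (hM₀ hM).le).2 hM.le)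
  have hmem : MemLp (fun x => b x - ⨍ y in R, b y ∂(planeMeasure lam)) q.conjExponent
      ((planeMeasure lam).restrict R) :=
    ⟨(hb.sub_const _).aestronglyMeasurable, (hosc (lt_add_one _)).trans_lt <|
      ENNReal.mul_lt_top ENNReal.ofReal_lt_top (ENNReal.rpow_ne_top_of_ne_zero hR₀ hR_top).lt_top⟩
  obtain ⟨hba, hbound⟩ := integrable_mul_and_enorm_integral_mul_le hR.measurableSet hmem
    (L1.integrable_coeFn a) haq hsupp hint
  refine ⟨hba, le_mul_of_forall_lt₀ fun K' hK' M hM => ?_⟩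
  have hexp : q.conjExponent.toReal⁻¹ + ((q⁻¹).toReal - 1) = 0 := by
    have := congrArg ENNReal.toReal (ENNReal.HolderConjugate.inv_add_inv_eq_one q.conjExponent q)
    rw [ENNReal.toReal_add (ENNReal.inv_ne_top.2 hpq.ne_zero)
      (ENNReal.inv_ne_top.2 (zero_lt_one.trans hq).ne'), ENNReal.toReal_inv,
      ENNReal.toReal_one] at this
    linarith
  have hKM : ‖∫ x, b x * a x ∂(planeMeasure lam)‖ₑ ≤ ENNReal.ofReal (K * M) := by
    calc _ ≤ ENNReal.ofReal (K * M) * planeMeasure lam R ^ q.conjExponent.toReal⁻¹ *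
          planeMeasure lam R ^ ((q⁻¹).toReal - 1) := hbound.trans (by gcongr; exact hosc hM)
      _ = _ := by
        rw [mul_assoc, ← ENNReal.rpow_add _ _ hR₀ hR_top, hexp, ENNReal.rpow_zero, mul_one]
  rw [← ofReal_norm, ENNReal.ofReal_le_ofReal_iff (mul_pos hK (hM₀ hM)).le] at hKM
  exact hKM.trans (mul_le_mul_of_nonneg_right hK'.le (hM₀ hM).le)

/-- Integration against a bounded measurable function, as a continuous linear functional on
`L¹(ℝ_λ)`. -/
def boundedPairing (lam : ℝ) {g : ℝ × ℝ → ℂ} (hg : Measurable g) {K : ℝ} (hK : ∀ x, ‖g x‖ ≤ K) :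
    Lp ℂ 1 (planeMeasure lam) →L[ℂ] ℂ :=
  have hint (f : Lp ℂ 1 (planeMeasure lam)) : Integrable (fun x => g x * f x) (planeMeasure lam) :=
    (L1.integrable_coeFn f).bdd_mul hg.aestronglyMeasurable (Filter.Eventually.of_forall hK)
  LinearMap.mkContinuous
    { toFun f := ∫ x, g x * f x ∂(planeMeasure lam)
      map_add' f h := by
        rw [← integral_add (hint f) (hint h)]
        refine integral_congr_ae ?_
        filter_upwards [Lp.coeFn_add f h] with x hx
        rw [hx, Pi.add_apply, mul_add]
      map_smul' z f := by
        rw [RingHom.id_apply, ← integral_smul]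
        refine integral_congr_ae ?_
        filter_upwards [Lp.coeFn_smul z f] with x hx
        rw [hx, Pi.smul_apply, smul_eq_mul, smul_eq_mul, mul_left_comm] } K fun f => by
    refine (norm_integral_le_integral_norm _).trans ?_
    rw [L1.norm_eq_integral_norm, ← integral_const_mul]
    refine integral_mono (hint f).norm ((L1.integrable_coeFn f).norm.const_mul K) fun x => ?_
    simp only [norm_mul]
    gcongr
    exact hK x

theorem boundedPairing_apply (lam : ℝ) {g : ℝ × ℝ → ℂ} (hg : Measurable g) {K : ℝ}
    (hK : ∀ x, ‖g x‖ ≤ K) (f : Lp ℂ 1 (planeMeasure lam)) :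
    boundedPairing lam hg hK f = ∫ x, g x * f x ∂(planeMeasure lam) := rfl

theorem tendsto_integral_trunc_mul {X : Type*} [MeasurableSpace X] {μ : Measure X} {b f : X → ℂ}
    (hb : Measurable b) (hf : AEStronglyMeasurable f μ) (hbf : Integrable (fun x => b x * f x) μ) :
    Filter.Tendsto (fun N => ∫ x, trunc N (b x) * f x ∂μ) Filter.atTop
      (nhds (∫ x, b x * f x ∂μ)) := by
  refine tendsto_integral_of_dominated_convergence (fun x => 2 * ‖b x * f x‖)
    (fun N => ((measurable_trunc N).comp hb).aestronglyMeasurable.mul hf)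
    (hbf.norm.const_mul 2) (fun N => Filter.Eventually.of_forall fun x => ?_)
    (Filter.Eventually.of_forall fun x => (tendsto_trunc (b x)).mul_const _)
  rw [norm_mul, norm_mul, ← mul_assoc]
  gcongr
  exact norm_trunc_le N _

theorem IsAtomicDecomposition.tendsto_integral_trunc_mul {lam : ℝ} (hlam : -1 / 2 < lam)
    {q : ℝ≥0∞} (hq : 1 < q) {b : ℝ × ℝ → ℂ} (hb : Measurable b) (hbmo : bmoNorm lam b ≠ ∞)
    {f : Lp ℂ 1 (planeMeasure lam)} {α : ℕ → ℂ} {a : ℕ → Lp ℂ 1 (planeMeasure lam)}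
    (h : IsAtomicDecomposition lam q f α a) :
    Filter.Tendsto (fun N => ∫ x, trunc N (b x) * f x ∂(planeMeasure lam)) Filter.atTop
      (nhds (∑' i, α i * ∫ x, b x * a i x ∂(planeMeasure lam))) := by
  obtain ⟨K, hK, hbound⟩ := exists_norm_integral_mul_le hlam hq
  have htrunc (N : ℕ) : Measurable fun x => trunc N (b x) := (measurable_trunc N).comp hb
  have hbmo4 : 4 * bmoNorm lam b ≠ ∞ := ENNReal.mul_ne_top (by simp) hbmo
  have hseries (N : ℕ) : ∫ x, trunc N (b x) * f x ∂(planeMeasure lam) =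
      ∑' i, α i * ∫ x, trunc N (b x) * a i x ∂(planeMeasure lam) := by
    have := (boundedPairing lam (htrunc N) fun x => norm_trunc_le_natCast N (b x)).hasSum h.hasSum
    simp only [map_smul, boundedPairing_apply, smul_eq_mul] at this
    exact this.tsum_eq.symm
  simp only [hseries]
  refine tendsto_tsum_of_dominated_convergence
    (bound := fun i => ‖α i‖ * (K * (4 * bmoNorm lam b).toReal))
    (h.summable.mul_right _) (fun i => ?_) (Filter.Eventually.of_forall fun N i => ?_)
  · exact (Bessel.tendsto_integral_trunc_mul hb (Lp.aestronglyMeasurable _)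
      (hbound (a i) (h.isAtom i) b hb hbmo).1).const_mul _
  · have hle := bmoNorm_trunc_le hlam hb N
    rw [norm_mul]
    gcongr
    refine (hbound (a i) (h.isAtom i) _ (htrunc N) (ne_top_of_le_ne_top hbmo4 hle)).2.trans ?_
    gcongr

/-! ### The duality map -/

theorem LittleBMO.measurable {lam : ℝ} (b : LittleBMO lam) : Measurable b :=
  b.toAEEqFun.stronglyMeasurable.measurable

theorem LittleBMO.bmoNorm_ne_top {lam : ℝ} (b : LittleBMO lam) : bmoNorm lam b ≠ ∞ :=
  b.memBMO.2.ne

/-- The pairing of `b ∈ bmo` with `f ∈ h^{1,q}`. As `b f` need not be integrable, it is the limit of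
the integrals of `f` against the truncations of `b`. -/
def pairing {lam : ℝ} {q : ℝ≥0∞} (b : LittleBMO lam) (f : LittleHardy lam q) : ℂ :=
  Filter.atTop.limUnder fun N : ℕ => ∫ x, trunc N (b x) * f.toLp x ∂(planeMeasure lam)

section Pairing

variable {lam : ℝ} (hlam : -1 / 2 < lam) {q : ℝ≥0∞} [hq : Fact (1 < q)] (b c : LittleBMO lam)
  (f g : LittleHardy lam q)

include hlam

theorem integrable_mul_of_mem_span {f : Lp ℂ 1 (planeMeasure lam)}
    (hf : f ∈ Submodule.span ℂ {a | IsAtom lam q a}) :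
    Integrable (fun x => b x * f x) (planeMeasure lam) := by
  obtain ⟨K, -, hK⟩ := exists_norm_integral_mul_le hlam hq.out
  induction hf using Submodule.span_induction with
  | mem a ha => exact (hK a ha b b.measurable b.bmoNorm_ne_top).1
  | zero =>
    refine (integrable_zero _ _ _).congr ?_
    filter_upwards [Lp.coeFn_zero ℂ 1 (planeMeasure lam)] with x hx
    rw [hx, Pi.zero_apply, mul_zero]
  | add f g _ _ hf hg =>
    refine (hf.add hg).congr ?_
    filter_upwards [Lp.coeFn_add f g] with x hx
    rw [hx, Pi.add_apply, Pi.add_apply, mul_add]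
  | smul z f _ hf =>
    refine (hf.smul z).congr ?_
    filter_upwards [Lp.coeFn_smul z f] with x hx
    rw [hx, Pi.smul_apply, Pi.smul_apply, smul_eq_mul, smul_eq_mul, mul_left_comm]

theorem pairing_eq_tsum {f : LittleHardy lam q} {α : ℕ → ℂ} {a : ℕ → Lp ℂ 1 (planeMeasure lam)}
    (h : IsAtomicDecomposition lam q f.toLp α a) :
    pairing b f = ∑' i, α i * ∫ x, b x * a i x ∂(planeMeasure lam) :=
  (h.tendsto_integral_trunc_mul hlam hq.out b.measurable b.bmoNorm_ne_top).limUnder_eq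

theorem tendsto_pairing :
    Filter.Tendsto (fun N => ∫ x, trunc N (b x) * f.toLp x ∂(planeMeasure lam)) Filter.atTop
      (nhds (pairing b f)) := by
  obtain ⟨α, a, h⟩ := f.mem
  rw [pairing_eq_tsum hlam b h]
  exact h.tendsto_integral_trunc_mul hlam hq.out b.measurable b.bmoNorm_ne_top

theorem pairing_eq_integral {f : LittleHardy lam q}
    (h : Integrable (fun x => b x * f.toLp x) (planeMeasure lam)) :
    pairing b f = ∫ x, b x * f.toLp x ∂(planeMeasure lam) :=
  tendsto_nhds_unique (tendsto_pairing hlam b f)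
    (tendsto_integral_trunc_mul b.measurable (Lp.aestronglyMeasurable _) h)

theorem pairing_add_right : pairing b (f + g) = pairing b f + pairing b g :=
  tendsto_nhds_unique (tendsto_pairing hlam b (f + g)) <|
    ((tendsto_pairing hlam b f).add (tendsto_pairing hlam b g)).congr fun N =>
      ((boundedPairing lam ((measurable_trunc N).comp b.measurable)
        fun x => norm_trunc_le_natCast N (b x)).map_add f.toLp g.toLp).symm

theorem pairing_smul_right (z : ℂ) : pairing b (z • f) = z • pairing b f :=
  tendsto_nhds_unique (tendsto_pairing hlam b (z • f)) <|
    ((tendsto_pairing hlam b f).const_smul z).congr fun N =>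
      ((boundedPairing lam ((measurable_trunc N).comp b.measurable)
        fun x => norm_trunc_le_natCast N (b x)).map_smul z f.toLp).symm

theorem summable_mul_integral_mul {α : ℕ → ℂ} {a : ℕ → Lp ℂ 1 (planeMeasure lam)}
    (hα : Summable fun i => ‖α i‖) (ha : ∀ i, IsAtom lam q (a i)) :
    Summable fun i => α i * ∫ x, b x * a i x ∂(planeMeasure lam) := by
  obtain ⟨K, -, hK⟩ := exists_norm_integral_mul_le hlam hq.out
  refine Summable.of_norm_bounded (hα.mul_right (K * ‖b‖)) fun i => ?_
  rw [norm_mul]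
  gcongr
  exact (hK (a i) (ha i) b b.measurable b.bmoNorm_ne_top).2

theorem pairing_add_left : pairing (b + c) f = pairing b f + pairing c f := by
  obtain ⟨K, -, hK⟩ := exists_norm_integral_mul_le hlam hq.out
  obtain ⟨α, a, h⟩ := f.mem
  have hint (b : LittleBMO lam) (i : ℕ) : Integrable (fun x => b x * a i x) (planeMeasure lam) :=
    (hK (a i) (h.isAtom i) b b.measurable b.bmoNorm_ne_top).1
  rw [pairing_eq_tsum hlam _ h, pairing_eq_tsum hlam _ h, pairing_eq_tsum hlam _ h,
    ← (summable_mul_integral_mul hlam b h.summable h.isAtom).tsum_add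
      (summable_mul_integral_mul hlam c h.summable h.isAtom)]
  refine tsum_congr fun i => ?_
  rw [← mul_add, ← integral_add (hint b i) (hint c i)]
  congr 1
  refine integral_congr_ae ?_
  filter_upwards [AEEqFun.coeFn_add b.toAEEqFun c.toAEEqFun] with x hx
  rw [← add_mul]
  exact congrArg (· * _) hx

theorem pairing_smul_left (z : ℂ) : pairing (z • b) f = z • pairing b f := by
  obtain ⟨α, a, h⟩ := f.mem
  rw [pairing_eq_tsum hlam _ h, pairing_eq_tsum hlam _ h, smul_eq_mul, ← tsum_mul_left]
  refine tsum_congr fun i => ?_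
  rw [mul_left_comm, ← integral_const_mul z]
  congr 1
  refine integral_congr_ae ?_
  filter_upwards [AEEqFun.coeFn_smul z b.toAEEqFun] with x hx
  rw [← mul_assoc]
  exact congrArg (· * _) hx

omit b c f g in
theorem exists_norm_pairing_le (q : ℝ≥0∞) [hq : Fact (1 < q)] : ∃ K : ℝ, 0 < K ∧
    ∀ (b : LittleBMO lam) (f : LittleHardy lam q), ‖pairing b f‖ ≤ K * ‖b‖ * ‖f‖ := by
  obtain ⟨K, hK, hbound⟩ := exists_norm_integral_mul_le hlam hq.out
  refine ⟨K, hK, fun b f => le_mul_of_forall_lt₀ fun K' hK' r hr => ?_⟩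
  obtain ⟨α, a, h, hlt⟩ := exists_lt_of_atomicNorm_lt f.mem hr
  have hterm (i : ℕ) : ‖α i * ∫ x, b x * a i x ∂(planeMeasure lam)‖ ≤ K * ‖b‖ * ‖α i‖ := by
    rw [norm_mul, mul_comm]
    gcongr
    exact (hbound (a i) (h.isAtom i) b b.measurable b.bmoNorm_ne_top).2
  have hKb : 0 ≤ K * ‖b‖ := mul_nonneg hK.le (norm_nonneg b)
  calc ‖pairing b f‖ ≤ ∑' i, K * ‖b‖ * ‖α i‖ := by
        rw [pairing_eq_tsum hlam b h]
        exact tsum_of_norm_bounded (h.summable.mul_left _).hasSum hterm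
    _ = K * ‖b‖ * ∑' i, ‖α i‖ := tsum_mul_left
    _ ≤ K' * r := mul_le_mul hK'.le hlt.le (tsum_nonneg fun _ => norm_nonneg _)
        (hKb.trans hK'.le)

end Pairing

section DualityMap

variable {lam : ℝ} (hlam : -1 / 2 < lam) (q : ℝ≥0∞) [hq : Fact (1 < q)]

/-- The map from `bmo(ℝ_λ)` to the dual of `h^{1,q}(ℝ_λ)`. -/
def dualityMap : LittleBMO lam →ₗ[ℂ] (LittleHardy lam q →L[ℂ] ℂ) where
  toFun b := LinearMap.mkContinuousOfExistsBound
    { toFun := pairing b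
      map_add' := pairing_add_right hlam b
      map_smul' := fun z f => pairing_smul_right hlam b f z }
    (let ⟨K, _, h⟩ := exists_norm_pairing_le hlam q; ⟨K * ‖b‖, h b⟩)
  map_add' b c := ContinuousLinearMap.ext (pairing_add_left hlam b c)
  map_smul' z b := ContinuousLinearMap.ext fun f => pairing_smul_left hlam b f z

theorem dualityMap_apply (b : LittleBMO lam) (f : LittleHardy lam q) :
    dualityMap hlam q b f = pairing b f := rfl

theorem exists_norm_dualityMap_le :
    ∃ K : ℝ, 0 < K ∧ ∀ b : LittleBMO lam, ‖dualityMap hlam q b‖ ≤ K * ‖b‖ := by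
  obtain ⟨K, hK, h⟩ := exists_norm_pairing_le hlam q
  exact ⟨K, hK, fun b => ContinuousLinearMap.opNorm_le_bound _ (mul_nonneg hK.le (norm_nonneg b))
    (h b)⟩

end DualityMap

/-! ### Bounds for the mean oscillation by duality -/

/-- The complex sign of the conjugate: the unimodular factor (or `0`) which turns `z` into
its norm. -/
def conjSign (z : ℂ) : ℂ := (starRingEnd ℂ) z / ‖z‖

theorem measurable_conjSign : Measurable conjSign :=
  Complex.continuous_conj.measurable.div (Complex.measurable_ofReal.comp measurable_norm)

theorem norm_conjSign_le_one (z : ℂ) : ‖conjSign z‖ ≤ 1 := by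
  rw [conjSign, norm_div, RCLike.norm_conj, Complex.norm_real, norm_norm]
  exact div_self_le_one _

theorem mul_conjSign (z : ℂ) : z * conjSign z = ‖z‖ := by
  rw [conjSign, ← mul_div_assoc, Complex.mul_conj, Complex.normSq_eq_norm_sq, Complex.ofReal_pow,
    sq, mul_self_div_self]

theorem norm_average_le_of_norm_le {X E : Type*} [MeasurableSpace X] [NormedAddCommGroup E]
    [NormedSpace ℝ E] {μ : Measure X} [IsFiniteMeasure μ] {g : X → E} {K : ℝ} (hK₀ : 0 ≤ K)
    (hK : ∀ x, ‖g x‖ ≤ K) : ‖⨍ x, g x ∂μ‖ ≤ K := by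
  rw [average_eq, norm_smul, norm_inv, Real.norm_of_nonneg measureReal_nonneg]
  refine inv_mul_le_of_le_mul₀ measureReal_nonneg hK₀ ?_
  rw [mul_comm]
  exact norm_integral_le_of_norm_le_const (Filter.Eventually.of_forall hK)

section MeanZero

variable {lam : ℝ} {R : Set (ℝ × ℝ)} {b g : ℝ × ℝ → ℂ} {K : ℝ}

theorem norm_indicator_sub_average_le (hfin : planeMeasure lam R ≠ ∞) (hK : ∀ x, ‖g x‖ ≤ K)
    (x : ℝ × ℝ) :
    ‖R.indicator (fun x => g x - ⨍ y in R, g y ∂(planeMeasure lam)) x‖ ≤ 2 * K := by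
  have : IsFiniteMeasure ((planeMeasure lam).restrict R) := isFiniteMeasure_restrict.2 hfin
  refine (norm_indicator_le_norm_self _ _).trans ((norm_sub_le _ _).trans ?_)
  rw [two_mul]
  exact add_le_add (hK x) (norm_average_le_of_norm_le ((norm_nonneg _).trans (hK x)) hK)

theorem indicator_sub_average_mem (hR : MeasurableSet R) (hfin : planeMeasure lam R ≠ ∞)
    (hg : Measurable g) (hK : ∀ x, ‖g x‖ ≤ K) :
    (R.indicator fun x => g x - ⨍ y in R, g y ∂(planeMeasure lam)) ∈ bddMeanZero lam R := by
  refine mem_bddMeanZero_of_bound hfin ((hg.sub_const _).indicator hR)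
    (fun x hx => indicator_of_notMem hx _) (norm_indicator_sub_average_le hfin hK) ?_
  rw [integral_indicator hR, setAverage_sub_setAverage hfin]

theorem integral_mul_indicator_sub_average (hR : MeasurableSet R) (hfin : planeMeasure lam R ≠ ∞)
    (hb : IntegrableOn b R (planeMeasure lam)) (hg : Measurable g) (hK : ∀ x, ‖g x‖ ≤ K) :
    ∫ x, b x * R.indicator (fun x => g x - ⨍ y in R, g y ∂(planeMeasure lam)) x
      ∂(planeMeasure lam) =
    ∫ x in R, (b x - ⨍ y in R, b y ∂(planeMeasure lam)) * g x ∂(planeMeasure lam) := by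
  have hgR : IntegrableOn g R (planeMeasure lam) :=
    Measure.integrableOn_of_bounded hfin hg.aestronglyMeasurable (Filter.Eventually.of_forall hK)
  have hbg : IntegrableOn (fun x => b x * g x) R (planeMeasure lam) :=
    Integrable.mul_bdd (c := K) hb hg.aestronglyMeasurable (Filter.Eventually.of_forall hK)
  have hind (x : ℝ × ℝ) :
      b x * R.indicator (fun x => g x - ⨍ y in R, g y ∂(planeMeasure lam)) x =
        R.indicator (fun x => b x * g x - b x * ⨍ y in R, g y ∂(planeMeasure lam)) x := by
    rw [← indicator_mul_right, funext fun x => mul_sub (b x) (g x) _]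
  simp only [hind, sub_mul]
  rw [integral_indicator hR, integral_sub hbg (hb.mul_const _),
    integral_sub hbg (hgR.const_mul _), integral_mul_const, integral_const_mul, setAverage_eq,
    setAverage_eq]
  simp only [Complex.real_smul]
  ring

theorem integrable_mul_of_mem_bddMeanZero {f : ℝ × ℝ → ℂ}
    (hb : IntegrableOn b R (planeMeasure lam)) (hf : f ∈ bddMeanZero lam R) :
    Integrable (fun x => b x * f x) (planeMeasure lam) := by
  obtain ⟨hfm, -, hsupp, ⟨K, hK⟩, -⟩ := hf
  have hbf : IntegrableOn (fun x => b x * f x) R (planeMeasure lam) :=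
    Integrable.mul_bdd (c := K) hb hfm.aestronglyMeasurable (Filter.Eventually.of_forall hK)
  refine (integrableOn_iff_integrable_of_support_subset fun x hx => ?_).1 hbf
  by_contra hxR
  exact hx (mul_eq_zero_of_right _ (hsupp x hxR))

theorem meanOsc_le_of_forall_bddMeanZero (hR : MeasurableSet R) (h₀ : planeMeasure lam R ≠ 0)
    (hfin : planeMeasure lam R ≠ ∞) (hbm : Measurable b)
    (hb : IntegrableOn b R (planeMeasure lam)) {A : ℝ}
    (hA : ∀ f ∈ bddMeanZero lam R, (∀ x, ‖f x‖ ≤ 2) →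
      ‖∫ x, b x * f x ∂(planeMeasure lam)‖ ≤ A * (planeMeasure lam).real R) :
    meanOsc lam b R ≤ ENNReal.ofReal A := by
  set z := ⨍ y in R, b y ∂(planeMeasure lam) with hz
  have hsign : Measurable fun x => conjSign (b x - z) :=
    measurable_conjSign.comp (hbm.sub_const z)
  have hsign_le (x : ℝ × ℝ) : ‖conjSign (b x - z)‖ ≤ 1 := norm_conjSign_le_one _
  have hdual := hA _ (indicator_sub_average_mem hR hfin hsign hsign_le) fun x =>
    (norm_indicator_sub_average_le hfin hsign_le x).trans_eq (mul_one 2)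
  rw [integral_mul_indicator_sub_average hR hfin hb hsign hsign_le, ← hz] at hdual
  simp only [mul_conjSign] at hdual
  rw [integral_complex_ofReal, Complex.norm_real,
    Real.norm_of_nonneg (integral_nonneg fun _ => norm_nonneg _)] at hdual
  have hint : Integrable (fun x => b x - z) ((planeMeasure lam).restrict R) :=
    Integrable.sub hb (integrableOn_const hfin)
  rw [meanOsc, ← ofReal_integral_norm_eq_lintegral_enorm hint, ENNReal.inv_mul_le_iff h₀ hfin,
    ← ofReal_measureReal hfin, ← ENNReal.ofReal_mul measureReal_nonneg, mul_comm]
  exact ENNReal.ofReal_le_ofReal hdual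

end MeanZero

section LowerBound

variable {lam : ℝ} (hlam : -1 / 2 < lam) (q : ℝ≥0∞) [hq : Fact (1 < q)]

variable {q} in
theorem bmoNorm_le_of_forall_bddMeanZero {b : ℝ × ℝ → ℂ} (hbm : Measurable b)
    (hb : ∀ R, IsRectangle R → IntegrableOn b R (planeMeasure lam))
    (ℓ : LittleHardy lam q →L[ℂ] ℂ)
    (hℓ : ∀ R (hR : IsRectangle R) (f : bddMeanZero lam R),
      ℓ (bddToHardy q hlam hR f) = ∫ x, b x * (f : ℝ × ℝ → ℂ) x ∂(planeMeasure lam)) :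
    bmoNorm lam b ≤ ENNReal.ofReal (2 * ‖ℓ‖) := by
  refine iSup₂_le fun R hR => meanOsc_le_of_forall_bddMeanZero hR.measurableSet
    (hR.measure_ne_zero hlam) (hR.measure_ne_top hlam) hbm (hb R hR) fun f hf hf₂ => ?_
  rw [← hℓ R hR ⟨f, hf⟩, mul_comm 2, mul_assoc]
  exact ℓ.le_opNorm_of_le
    (norm_bddToHardy_le q hlam hR ⟨f, hf⟩ hR (Filter.Eventually.of_forall hf.2.2.1) hf₂)

include hlam in
theorem LittleBMO.integrableOn (b : LittleBMO lam) {R : Set (ℝ × ℝ)} (hR : IsRectangle R) :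
    IntegrableOn b R (planeMeasure lam) :=
  integrableOn_of_bmoNorm b.measurable.aestronglyMeasurable b.memBMO.2 hR
    (hR.measure_ne_top hlam)

theorem dualityMap_bddToHardy (b : LittleBMO lam) {R : Set (ℝ × ℝ)} (hR : IsRectangle R)
    (f : bddMeanZero lam R) :
    dualityMap hlam q b (bddToHardy q hlam hR f) =
      ∫ x, b x * (f : ℝ × ℝ → ℂ) x ∂(planeMeasure lam) := by
  have hcongr : (fun x => b x * (bddToHardy q hlam hR f).toLp x) =ᵐ[planeMeasure lam]
      fun x => b x * (f : ℝ × ℝ → ℂ) x := by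
    filter_upwards [coeFn_bddToHardy q hlam hR f] with x hx
    rw [hx]
  rw [dualityMap_apply, pairing_eq_integral hlam, integral_congr_ae hcongr]
  exact (integrable_mul_of_mem_bddMeanZero (b.integrableOn hlam hR) f.2).congr hcongr.symm

theorem norm_le_two_mul_norm_dualityMap (b : LittleBMO lam) : ‖b‖ ≤ 2 * ‖dualityMap hlam q b‖ :=
  ENNReal.toReal_le_of_le_ofReal (by positivity)
    (bmoNorm_le_of_forall_bddMeanZero hlam b.measurable (fun _ hR => b.integrableOn hlam hR)
      (dualityMap hlam q b) fun _ hR f => dualityMap_bddToHardy hlam q b hR f)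

end LowerBound

/-! ### Densities of cells -/

namespace PartitionTree

variable {X ι κ : Type*} [MeasurableSpace X] {μ : Measure X} [Fintype κ] (T : PartitionTree μ ι κ)

/-- The density of the uniform probability measure on a cell with respect to the uniform
probability measure on the root cell. -/
def density (Q : ι) : X → ℝ :=
  (T.cell Q).indicator fun _ => μ.real (T.cell T.root) / μ.real (T.cell Q)

theorem density_of_mem {Q : ι} {x : X} (hx : x ∈ T.cell Q) :
    T.density Q x = μ.real (T.cell T.root) / μ.real (T.cell Q) :=
  indicator_of_mem hx _

theorem density_of_notMem {Q : ι} {x : X} (hx : x ∉ T.cell Q) : T.density Q x = 0 :=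
  indicator_of_notMem hx _

theorem density_nonneg (Q : ι) (x : X) : 0 ≤ T.density Q x :=
  indicator_nonneg (fun _ _ => by positivity) x

theorem density_le (Q : ι) (x : X) :
    T.density Q x ≤ μ.real (T.cell T.root) / μ.real (T.cell Q) :=
  indicator_le_self' (fun _ _ => by positivity) x

theorem measurable_density (Q : ι) : Measurable (T.density Q) :=
  measurable_const.indicator (T.measurableSet_cell Q)

theorem integrable_density (Q : ι) : Integrable (T.density Q) μ :=
  (integrable_indicator_iff (T.measurableSet_cell Q)).2
    (integrableOn_const (T.measure_cell_ne_top Q))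

theorem integral_density (Q : ι) : ∫ x, T.density Q x ∂μ = μ.real (T.cell T.root) := by
  have := (T.measureReal_cell_pos Q).ne'
  rw [density, integral_indicator (T.measurableSet_cell Q), setIntegral_const, smul_eq_mul]
  field_simp

theorem density_child [DecidableEq κ] (Q : ι) (k : κ) (x : X) :
    T.density (T.child Q k) x =
      if T.index Q x = k then Fintype.card κ * T.density Q x else 0 := by
  by_cases hx : x ∈ T.cell (T.child Q k)
  · obtain ⟨hxQ, hk⟩ := T.mem_cell_child.1 hx
    rw [if_pos hk, T.density_of_mem hx, T.density_of_mem hxQ, T.measureReal_cell_child,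
      div_mul_eq_div_div_swap, div_inv_eq_mul, mul_comm]
  · rw [T.density_of_notMem hx]
    split_ifs with hk
    · rw [T.density_of_notMem fun hxQ => hx (T.mem_cell_child.2 ⟨hxQ, hk⟩), mul_zero]
    · rfl

theorem treeAvg_mul_density (G : ι → ℂ) (m : ℕ) (Q : ι) (x : X) :
    treeAvg T.child m (fun Q' => G Q' * T.density Q' x) Q =
      G (T.leaf m Q x) * T.density Q x := by
  classical
  have hcard : (Fintype.card κ : ℂ) ≠ 0 :=
    have := T.nonempty_index
    Nat.cast_ne_zero.2 Fintype.card_ne_zero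
  induction m generalizing Q with
  | zero => rfl
  | succ m ih =>
    simp only [treeAvg_succ, ih, density_child, apply_ite Complex.ofReal, Complex.ofReal_zero,
      mul_ite, mul_zero, Finset.sum_ite_eq, Finset.mem_univ, if_true, leaf, Complex.real_smul,
      Complex.ofReal_mul, Complex.ofReal_inv, Complex.ofReal_natCast]
    field_simp

theorem isTreeMartingale_density (x : X) : IsTreeMartingale T.child fun Q => T.density Q x := by
  ext Q
  have h := T.treeAvg_mul_density (fun _ => 1) 1 Q x
  simp only [one_mul] at h
  exact Complex.ofReal_injective ((map_treeAvg T.child Complex.ofRealLI.toLinearMap 1 _ Q).trans h)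

theorem treeAvg_sq_norm_average_le {F : X → ℂ} (hF : IntegrableOn F (T.cell T.root) μ)
    (hF₂ : IntegrableOn (fun x => ‖F x‖ ^ 2) (T.cell T.root) μ) (m : ℕ) (Q : ι) :
    treeAvg T.child m (fun Q' => ‖T.average F Q'‖ ^ 2) Q ≤ T.average (fun x => ‖F x‖ ^ 2) Q := by
  have hconv : ConvexOn ℝ univ fun z : ℂ => ‖z‖ ^ 2 :=
    convexOn_univ_norm.pow (fun _ _ => norm_nonneg _) 2
  have hjensen (Q' : ι) : ‖T.average F Q'‖ ^ 2 ≤ T.average (fun x => ‖F x‖ ^ 2) Q' :=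
    hconv.map_set_average_le (by fun_prop) isClosed_univ (T.measure_cell_ne_zero Q')
      (T.measure_cell_ne_top Q') (by simp) (hF.mono_set (T.cell_subset_root Q'))
      (hF₂.mono_set (T.cell_subset_root Q'))
  exact (treeAvg_mono T.child hjensen m Q).trans_eq
    (congrFun ((T.isTreeMartingale_average hF₂).treeAvg_eq m) Q)

end PartitionTree

/-! ### The `L²` bound for the atomic norm -/

/-- Iterating the approximation on the remainder `v - w` expands `J v` in a geometrically convergent
series. -/
theorem norm_le_two_mul_of_forall_approx {V E F H : Type*} [AddCommGroup V] [Module ℂ V]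
    [NormedAddCommGroup E] [NormedSpace ℂ E] [CompleteSpace E] [NormedAddCommGroup F]
    [NormedSpace ℂ F] [SeminormedAddCommGroup H] [NormedSpace ℂ H] {J : V →ₗ[ℂ] E}
    {L : V →ₗ[ℂ] H} {i : E →L[ℂ] F} (hi : Function.Injective i) {C D : ℝ}
    (hC : ∀ v, ‖i (J v)‖ ≤ C * ‖L v‖)
    (happrox : ∀ v, ∀ ε > 0, ∃ w, ‖J w‖ ≤ D * ‖L v‖ ∧ ‖L (v - w)‖ ≤ ε) (v : V) :
    ‖J v‖ ≤ 2 * D * ‖L v‖ := by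
  obtain hρ | hρ := (norm_nonneg (L v)).eq_or_lt
  · have hzero : i (J v) = 0 := by simpa [← hρ] using hC v
    simp [(map_eq_zero_iff i hi).1 hzero, ← hρ]
  have hC₀ : 0 ≤ C := nonneg_of_mul_nonneg_left ((norm_nonneg _).trans (hC v)) hρ
  have hD₀ : 0 ≤ D := by
    obtain ⟨w, hw, -⟩ := happrox v 1 one_pos
    exact nonneg_of_mul_nonneg_left ((norm_nonneg _).trans hw) hρ
  choose w hwJ hwL using fun (k : ℕ) u => happrox u (‖L v‖ / 2 ^ (k + 1)) (by positivity)
  let r (n : ℕ) : V := n.rec v fun k u => u - w k u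
  have hrL (n : ℕ) : ‖L (r n)‖ ≤ ‖L v‖ / 2 ^ n := by
    cases n with
    | zero => simp [r]
    | succ k => exact hwL k (r k)
  have hterm (n : ℕ) : ‖J (r n) - J (r (n + 1))‖ ≤ D * ‖L v‖ * (1 / 2) ^ n := by
    have hw : J (r n) - J (r (n + 1)) = J (w n (r n)) := by
      rw [← map_sub]
      exact congrArg J (sub_sub_cancel _ _)
    rw [hw, mul_assoc, one_div_pow, mul_one_div]
    exact (hwJ n (r n)).trans (by gcongr; exact hrL n)
  have hgeom : HasSum (fun n : ℕ => D * ‖L v‖ * (1 / 2 : ℝ) ^ n) (2 * D * ‖L v‖) := by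
    have h := hasSum_geometric_two.mul_left (D * ‖L v‖)
    rwa [mul_comm _ (2 : ℝ), ← mul_assoc] at h
  have hsum := (Summable.of_norm_bounded hgeom.summable hterm).hasSum
  have hrem : Filter.Tendsto (fun n => i (J (r n))) Filter.atTop (nhds 0) := by
    refine squeeze_zero_norm (fun n => (hC (r n)).trans
      (mul_le_mul_of_nonneg_left (hrL n) hC₀)) ?_
    simpa only [div_eq_mul_inv, mul_zero, inv_pow] using ((tendsto_pow_atTop_nhds_zero_of_lt_one
      (r := (2 : ℝ)⁻¹) (by norm_num) (by norm_num)).const_mul ‖L v‖).const_mul C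
  have hpartial : Filter.Tendsto (fun n => i (J v) - i (J (r n))) Filter.atTop
      (nhds (i (∑' n, (J (r n) - J (r (n + 1)))))) := by
    refine ((i.continuous.tendsto _).comp hsum.tendsto_sum_nat).congr fun n => ?_
    rw [Function.comp_apply, Finset.sum_range_sub', map_sub]
    rfl
  have hlim : i (J v) = i (∑' n, (J (r n) - J (r (n + 1)))) := by
    simpa using tendsto_nhds_unique (hrem.const_sub (i (J v))) hpartial
  rw [hi hlim]
  exact tsum_of_norm_bounded hgeom hterm

theorem norm_toLp_two_sq {X : Type*} [MeasurableSpace X] {μ : Measure X} {f : X → ℂ}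
    (hf : MemLp f 2 μ) : ‖hf.toLp f‖ ^ 2 = ∫ x, ‖f x‖ ^ 2 ∂μ := by
  have hinner : inner ℂ (hf.toLp f) (hf.toLp f) = ((∫ x, ‖f x‖ ^ 2 ∂μ : ℝ) : ℂ) := by
    rw [L2.inner_def, ← integral_complex_ofReal]
    refine integral_congr_ae ?_
    filter_upwards [hf.coeFn_toLp] with x hx
    rw [hx, inner_self_eq_norm_sq_to_K, Complex.ofReal_pow]
    rfl
  rw [@norm_sq_eq_re_inner ℂ, hinner]
  exact Complex.ofReal_re _

section BddToL2

variable {lam : ℝ} {R : Set (ℝ × ℝ)}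

theorem memLp_two_of_mem_bddMeanZero {f : ℝ × ℝ → ℂ} (hf : f ∈ bddMeanZero lam R) :
    MemLp f 2 (planeMeasure lam) := by
  obtain ⟨hfm, hint, -, ⟨K, hK⟩, -⟩ := hf
  refine (memLp_two_iff_integrable_sq_norm hfm.aestronglyMeasurable).2 ?_
  simp only [sq]
  exact hint.norm.bdd_mul (c := K) hfm.norm.aestronglyMeasurable
    (Filter.Eventually.of_forall fun x => (norm_norm (f x)).trans_le (hK x))

variable (lam R) in
/-- The embedding of the bounded functions with integral zero on a set into `L²` of the set. -/
def bddToL2 : bddMeanZero lam R →ₗ[ℂ] Lp ℂ 2 ((planeMeasure lam).restrict R) where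
  toFun f := ((memLp_two_of_mem_bddMeanZero f.2).restrict R).toLp f
  map_add' _ _ := MemLp.toLp_add _ _
  map_smul' z _ := MemLp.toLp_const_smul z _

theorem coeFn_bddToL2 (f : bddMeanZero lam R) :
    bddToL2 lam R f =ᵐ[(planeMeasure lam).restrict R] (f : ℝ × ℝ → ℂ) :=
  MemLp.coeFn_toLp ((memLp_two_of_mem_bddMeanZero f.2).restrict R)

theorem norm_bddToL2_sq (f : bddMeanZero lam R) :
    ‖bddToL2 lam R f‖ ^ 2 = ∫ x in R, ‖(f : ℝ × ℝ → ℂ) x‖ ^ 2 ∂(planeMeasure lam) :=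
  norm_toLp_two_sq ((memLp_two_of_mem_bddMeanZero f.2).restrict R)

theorem exists_norm_toLp_bddToHardy_le (hlam : -1 / 2 < lam) (q : ℝ≥0∞) (hR : IsRectangle R) :
    ∃ C : ℝ, ∀ f : bddMeanZero lam R,
      ‖(bddToHardy q hlam hR f).toLp‖ ≤ C * ‖bddToL2 lam R f‖ := by
  refine ⟨(planeMeasure lam R ^ (1 / (1 : ℝ≥0∞).toReal - 1 / (2 : ℝ≥0∞).toReal)).toReal,
    fun f => ?_⟩
  have hf := memLp_two_of_mem_bddMeanZero f.2
  have hholder := eLpNorm_le_eLpNorm_mul_rpow_measure_univ (p := 1) (q := 2)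
    (μ := (planeMeasure lam).restrict R) (by norm_num) hf.1.restrict
  rw [Measure.restrict_apply_univ, ← eLpNorm_indicator_eq_eLpNorm_restrict hR.measurableSet,
    eLpNorm_congr_ae (indicator_ae_eq_self (Filter.Eventually.of_forall f.2.2.2.1))] at hholder
  rw [Lp.norm_def, eLpNorm_congr_ae (coeFn_bddToHardy q hlam hR f), mul_comm,
    show ‖bddToL2 lam R f‖ = _ from Lp.norm_toLp _ (hf.restrict R),
    ← ENNReal.toReal_mul]
  refine ENNReal.toReal_mono (ENNReal.mul_ne_top (hf.restrict R).2.ne ?_) hholder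
  exact ENNReal.rpow_ne_top_of_ne_zero (hR.measure_ne_zero hlam) (hR.measure_ne_top hlam)

theorem coe_treeAvg_apply {ι κ : Type*} [Fintype κ] (child : ι → κ → ι)
    (w : ι → bddMeanZero lam R) (m : ℕ) (Q : ι) (x : ℝ × ℝ) :
    ((treeAvg child m w Q : bddMeanZero lam R) : ℝ × ℝ → ℂ) x =
      treeAvg child m (fun Q' => (w Q' : ℝ × ℝ → ℂ) x) Q :=
  map_treeAvg child (((LinearMap.proj x : (ℝ × ℝ → ℂ) →ₗ[ℂ] ℂ) ∘ₗ
    (bddMeanZero lam R).subtype).restrictScalars ℝ) m w Q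

end BddToL2

namespace PartitionTree

variable {lam : ℝ} {ι κ : Type*} [Fintype κ] (T : PartitionTree (planeMeasure lam) ι κ)

/-- The difference of the densities of a cell and of the root cell. -/
def densitySub (Q : ι) : bddMeanZero lam (T.cell T.root) :=
  ⟨fun x => ((T.density Q x - T.density T.root x : ℝ) : ℂ), by
    have hbound (Q' : ι) (x : ℝ × ℝ) : ‖T.density Q' x‖ ≤
        (planeMeasure lam).real (T.cell T.root) / (planeMeasure lam).real (T.cell Q') :=
      (Real.norm_of_nonneg (T.density_nonneg Q' x)).trans_le (T.density_le Q' x)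
    refine mem_bddMeanZero_of_bound T.measure_root_ne_top
      (Complex.measurable_ofReal.comp ((T.measurable_density Q).sub (T.measurable_density T.root)))
      (fun x hx => ?_) (fun x => (Complex.norm_real _).trans_le
        (norm_sub_le_of_le (hbound Q x) (hbound T.root x))) ?_
    · rw [T.density_of_notMem fun h => hx (T.cell_subset_root Q h), T.density_of_notMem hx,
        sub_self, Complex.ofReal_zero]
    · rw [integral_complex_ofReal, integral_sub (T.integrable_density Q)
        (T.integrable_density T.root), integral_density, integral_density, sub_self,
        Complex.ofReal_zero]⟩

theorem densitySub_apply (Q : ι) (x : ℝ × ℝ) :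
    (T.densitySub Q : ℝ × ℝ → ℂ) x = T.density Q x - T.density T.root x :=
  Complex.ofReal_sub _ _

theorem densitySub_root : T.densitySub T.root = 0 := by
  ext x
  rw [densitySub_apply, sub_self]
  rfl

theorem isTreeMartingale_densitySub : IsTreeMartingale T.child T.densitySub := by
  have := T.nonempty_index
  ext Q x
  have hsub : IsTreeMartingale T.child fun Q' => T.density Q' x - T.density T.root x :=
    (map_sub (childAvg T.child) _ _).trans (congrArg₂ _ (T.isTreeMartingale_density x)
      (isTreeMartingale_const T.child (T.density T.root x)))
  exact (coe_treeAvg_apply T.child T.densitySub 1 Q x).trans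
    (congrFun ((hsub.map Complex.ofRealLI.toLinearMap).treeAvg_eq 1) Q)

theorem norm_treeAvg_smul_densitySub_sub_le {s : ι → ℂ} (hs : ∀ Q, ‖s Q‖ ≤ 1) (m : ℕ) (Q : ι)
    (x : ℝ × ℝ) :
    ‖((treeAvg T.child m (fun Q' => s Q' • (T.densitySub Q' - T.densitySub Q)) Q :
      bddMeanZero lam (T.cell T.root)) : ℝ × ℝ → ℂ) x‖ ≤ 2 * T.density Q x := by
  have := T.nonempty_index
  have hle (Q' : ι) :
      ‖((s Q' • (T.densitySub Q' - T.densitySub Q) : bddMeanZero lam (T.cell T.root)) :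
        ℝ × ℝ → ℂ) x‖ ≤ T.density Q' x + T.density Q x := by
    calc _ = ‖s Q'‖ * ‖T.density Q' x - T.density Q x‖ := by
          simp only [Submodule.coe_smul, Submodule.coe_sub, Pi.smul_apply, Pi.sub_apply,
            densitySub_apply, sub_sub_sub_cancel_right, norm_smul, ← Complex.ofReal_sub,
            Complex.norm_real]
      _ ≤ 1 * (T.density Q' x + T.density Q x) := by
          gcongr
          · exact hs Q'
          · refine norm_sub_le_of_le ?_ ?_ <;>
              exact (Real.norm_of_nonneg (T.density_nonneg _ x)).le
      _ = T.density Q' x + T.density Q x := one_mul _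
  have hadd : treeAvg T.child m (fun Q' => T.density Q' x + T.density Q x) Q =
      2 * T.density Q x := by
    have h := map_add (treeAvg T.child m) (fun Q' => T.density Q' x) fun _ => T.density Q x
    rw [(T.isTreeMartingale_density x).treeAvg_eq,
      (isTreeMartingale_const T.child (T.density Q x)).treeAvg_eq] at h
    exact (congrFun h Q).trans (two_mul _).symm
  rw [coe_treeAvg_apply, ← hadd]
  exact (norm_treeAvg_le T.child _ m Q).trans (treeAvg_mono T.child hle m Q)

section Functional

variable {Λ : bddMeanZero lam (T.cell T.root) →ₗ[ℂ] ℂ} {M : ℝ}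
  (hΛ : ∀ (f : bddMeanZero lam (T.cell T.root)) (Q : ι),
    (∀ x, ‖(f : ℝ × ℝ → ℂ) x‖ ≤ 2 * T.density Q x) → ‖Λ f‖ ≤ M)

include hΛ in
theorem treeAvg_norm_sub_densitySub_le (m : ℕ) (Q : ι) :
    treeAvg T.child m (fun Q' => ‖Λ (T.densitySub Q') - Λ (T.densitySub Q)‖) Q ≤ M := by
  let s (Q' : ι) : ℂ := conjSign (Λ (T.densitySub Q') - Λ (T.densitySub Q))
  have hsign : Λ (treeAvg T.child m (fun Q' => s Q' • (T.densitySub Q' - T.densitySub Q)) Q) =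
      (treeAvg T.child m (fun Q' => ‖Λ (T.densitySub Q') - Λ (T.densitySub Q)‖) Q : ℝ) := by
    refine (map_treeAvg T.child (Λ.restrictScalars ℝ) m _ Q).trans
      (Eq.trans ?_ (map_treeAvg T.child Complex.ofRealLI.toLinearMap m _ Q).symm)
    refine congrArg (treeAvg T.child m · Q) (funext fun Q' => ?_)
    rw [LinearMap.restrictScalars_apply, map_smul, map_sub, smul_eq_mul, mul_comm]
    exact mul_conjSign _
  have hle := hΛ _ Q
    (T.norm_treeAvg_smul_densitySub_sub_le (s := s) (fun Q' => norm_conjSign_le_one _) m Q)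
  rw [hsign, Complex.norm_real] at hle
  exact (le_abs_self _).trans hle

include hΛ in
theorem treeAvg_sq_norm_densitySub_le (hM : 0 < M) (m : ℕ) :
    treeAvg T.child m (fun Q => ‖Λ (T.densitySub Q)‖ ^ 2) T.root ≤
      johnNirenbergConst (Fintype.card κ) 2 * M ^ 2 := by
  have := T.nonempty_index
  have hmart := T.isTreeMartingale_densitySub.map (Λ.restrictScalars ℝ)
  simpa only [LinearMap.restrictScalars_apply, densitySub_root, map_zero, sub_zero] using
    hmart.treeAvg_pow_le hM (T.treeAvg_norm_sub_densitySub_le hΛ) 2 m T.root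

end Functional

/-- The function which is equal on each cell at depth `m` to the mean value of `f` over that cell,
written as an average of densities so that linear functionals of it are averages over the tree. -/
def leafAverage (m : ℕ) (f : bddMeanZero lam (T.cell T.root)) : bddMeanZero lam (T.cell T.root) :=
  treeAvg T.child m (fun Q => T.average (f : ℝ × ℝ → ℂ) Q • T.densitySub Q) T.root

theorem leafAverage_apply (m : ℕ) (f : bddMeanZero lam (T.cell T.root)) {x : ℝ × ℝ}
    (hx : x ∈ T.cell T.root) :
    (T.leafAverage m f : ℝ × ℝ → ℂ) x = T.average (f : ℝ × ℝ → ℂ) (T.leaf m T.root x) := by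
  have hone : T.density T.root x = 1 := by
    rw [T.density_of_mem hx, div_self (T.measureReal_cell_pos T.root).ne']
  have hroot : T.average (f : ℝ × ℝ → ℂ) T.root = 0 := by
    rw [average, setAverage_eq, setIntegral_eq_integral_of_forall_compl_eq_zero f.2.2.2.1,
      f.2.2.2.2.2, smul_zero]
  have hterm (Q : ι) : ((T.average (f : ℝ × ℝ → ℂ) Q • T.densitySub Q :
      bddMeanZero lam (T.cell T.root)) : ℝ × ℝ → ℂ) x =
      T.average (f : ℝ × ℝ → ℂ) Q * T.density Q x - T.average (f : ℝ × ℝ → ℂ) Q := by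
    rw [Submodule.coe_smul, Pi.smul_apply, densitySub_apply, hone, smul_eq_mul, Complex.ofReal_one,
      mul_sub_one]
  have hsub := map_sub (treeAvg T.child m)
    (fun Q => T.average (f : ℝ × ℝ → ℂ) Q * T.density Q x) (T.average (f : ℝ × ℝ → ℂ))
  rw [(T.isTreeMartingale_average f.2.2.1.integrableOn).treeAvg_eq] at hsub
  rw [leafAverage, coe_treeAvg_apply]
  simp only [hterm]
  refine (congrFun hsub T.root).trans ?_
  rw [Pi.sub_apply, treeAvg_mul_density, hone, hroot, Complex.ofReal_one, mul_one, sub_zero]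

theorem sq_norm_map_leafAverage_le {Λ : bddMeanZero lam (T.cell T.root) →ₗ[ℂ] ℂ} {M : ℝ}
    (hM : 0 < M) (hΛ : ∀ (f : bddMeanZero lam (T.cell T.root)) (Q : ι),
      (∀ x, ‖(f : ℝ × ℝ → ℂ) x‖ ≤ 2 * T.density Q x) → ‖Λ f‖ ≤ M)
    (m : ℕ) (f : bddMeanZero lam (T.cell T.root)) :
    ‖Λ (T.leafAverage m f)‖ ^ 2 ≤ T.average (fun x => ‖(f : ℝ × ℝ → ℂ) x‖ ^ 2) T.root *
      (johnNirenbergConst (Fintype.card κ) 2 * M ^ 2) := by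
  have hf₂ : IntegrableOn (fun x => ‖(f : ℝ × ℝ → ℂ) x‖ ^ 2) (T.cell T.root)
      (planeMeasure lam) :=
    (memLp_two_of_mem_bddMeanZero f.2).integrable_norm_pow two_ne_zero |>.integrableOn
  have hle : ‖Λ (T.leafAverage m f)‖ ≤ treeAvg T.child m
      ((fun Q => ‖T.average (f : ℝ × ℝ → ℂ) Q‖) * fun Q => ‖Λ (T.densitySub Q)‖) T.root := by
    rw [leafAverage, show Λ (treeAvg _ _ _ _) = _ from
      map_treeAvg T.child (Λ.restrictScalars ℝ) m _ _]
    refine (norm_treeAvg_le T.child _ m T.root).trans_eq ?_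
    simp only [LinearMap.restrictScalars_apply, map_smul, norm_smul]
    rfl
  have havg := T.treeAvg_sq_norm_average_le f.2.2.1.integrableOn hf₂ m T.root
  calc ‖Λ (T.leafAverage m f)‖ ^ 2
      ≤ treeAvg T.child m ((fun Q => ‖T.average (f : ℝ × ℝ → ℂ) Q‖) *
          fun Q => ‖Λ (T.densitySub Q)‖) T.root ^ 2 := by gcongr
    _ ≤ treeAvg T.child m (fun Q => ‖T.average (f : ℝ × ℝ → ℂ) Q‖ ^ 2) T.root *
          treeAvg T.child m (fun Q => ‖Λ (T.densitySub Q)‖ ^ 2) T.root :=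
        treeAvg_mul_sq_le T.child _ _ m T.root
    _ ≤ _ := mul_le_mul havg (T.treeAvg_sq_norm_densitySub_le hΛ hM m)
        (treeAvg_nonneg T.child (fun Q => sq_nonneg ‖Λ (T.densitySub Q)‖) m T.root)
        ((treeAvg_nonneg T.child (fun Q => sq_nonneg _) m T.root).trans havg)

theorem tendsto_norm_bddToL2_sub_leafAverage (hT : T.Differentiates)
    (f : bddMeanZero lam (T.cell T.root)) :
    Filter.Tendsto (fun m => ‖bddToL2 lam (T.cell T.root) (f - T.leafAverage m f)‖)
      Filter.atTop (nhds 0) := by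
  obtain ⟨K, hK⟩ := f.2.2.2.2.1
  have hsq : Filter.Tendsto
      (fun m => ‖bddToL2 lam (T.cell T.root) (f - T.leafAverage m f)‖ ^ 2)
      Filter.atTop (nhds 0) := by
    simp only [norm_bddToL2_sq]
    rw [← integral_zero (ℝ × ℝ) ℝ (μ := (planeMeasure lam).restrict (T.cell T.root))]
    refine tendsto_integral_of_dominated_convergence (fun _ => (K + K) ^ 2)
      (fun m => ((f - T.leafAverage m f).2.1.norm.pow_const 2).aestronglyMeasurable)
      (integrableOn_const T.measure_root_ne_top) (fun m => ?_) ?_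
    · filter_upwards [ae_restrict_mem (T.measurableSet_cell T.root)] with x hx
      have : Fact (planeMeasure lam (T.cell (T.leaf m T.root x)) < ∞) :=
        ⟨(T.measure_cell_ne_top _).lt_top⟩
      rw [norm_pow, norm_norm, Submodule.coe_sub, Pi.sub_apply, T.leafAverage_apply m f hx]
      gcongr
      exact norm_sub_le_of_le (hK x)
        (norm_average_le_of_norm_le ((norm_nonneg _).trans (hK 0)) hK)
    · filter_upwards [ae_restrict_mem (T.measurableSet_cell T.root),
        hT f f.2.1 f.2.2.1.integrableOn] with x hx hlim
      simp only [Submodule.coe_sub, Pi.sub_apply, T.leafAverage_apply _ f hx]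
      simpa using ((hlim.const_sub ((f : ℝ × ℝ → ℂ) x)).norm.pow 2)
  simpa only [Real.sqrt_sq (norm_nonneg _), Real.sqrt_zero] using hsq.sqrt

end PartitionTree

section CellTree

variable {lam : ℝ} {ι κ : Type*} [Fintype κ] {T : PartitionTree (planeMeasure lam) ι κ}

theorem norm_bddToHardy_le_of_le_density (hlam : -1 / 2 < lam) (q : ℝ≥0∞)
    (hR : IsRectangle (T.cell T.root))
    (hcell : ∀ Q, ∃ R, IsRectangle R ∧ R =ᵐ[planeMeasure lam] T.cell Q)
    {f : bddMeanZero lam (T.cell T.root)} {Q : ι}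
    (hf : ∀ x, ‖(f : ℝ × ℝ → ℂ) x‖ ≤ 2 * T.density Q x) :
    ‖bddToHardy q hlam hR f‖ ≤ 2 * (planeMeasure lam).real (T.cell T.root) := by
  obtain ⟨R, hR', hRQ⟩ := hcell Q
  have hpos := T.measureReal_cell_pos Q
  refine (norm_bddToHardy_le q hlam hR f hR' (K := 2 * ((planeMeasure lam).real (T.cell T.root) /
    (planeMeasure lam).real (T.cell Q))) ?_ fun x => (hf x).trans ?_).trans_eq ?_
  · filter_upwards [hRQ.mem_iff] with x hx hxR
    have h := hf x
    rwa [T.density_of_notMem (mt hx.2 hxR), mul_zero, norm_le_zero_iff] at h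
  · gcongr
    exact T.density_le Q x
  · rw [measureReal_congr hRQ]
    field_simp

theorem exists_norm_bddToHardy_leafAverage_le (hlam : -1 / 2 < lam) (q : ℝ≥0∞) [Fact (1 < q)]
    (hR : IsRectangle (T.cell T.root))
    (hcell : ∀ Q, ∃ R, IsRectangle R ∧ R =ᵐ[planeMeasure lam] T.cell Q) :
    ∃ D : ℝ, ∀ m f, ‖bddToHardy q hlam hR (T.leafAverage m f)‖ ≤
      D * ‖bddToL2 lam (T.cell T.root) f‖ := by
  set ρ := (planeMeasure lam).real (T.cell T.root)
  have hρ₀ : 0 < ρ := T.measureReal_cell_pos T.root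
  refine ⟨√(ρ⁻¹ * (johnNirenbergConst (Fintype.card κ) 2 * (2 * ρ) ^ 2)), fun m f => ?_⟩
  obtain ⟨ℓ, hℓ, hnorm⟩ := exists_dual_vector'' ℂ (bddToHardy q hlam hR (T.leafAverage m f))
  have hsq := T.sq_norm_map_leafAverage_le (Λ := ℓ.toLinearMap ∘ₗ bddToHardy q hlam hR)
    (M := 2 * ρ) (by positivity) (fun g Q hg => ((ℓ.le_of_opNorm_le hℓ _).trans_eq
      (one_mul _)).trans (norm_bddToHardy_le_of_le_density hlam q hR hcell hg)) m f
  change ‖ℓ (bddToHardy q hlam hR (T.leafAverage m f))‖ ^ 2 ≤ _ at hsq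
  rw [hnorm, RCLike.norm_ofReal, abs_norm] at hsq
  rw [PartitionTree.average, setAverage_eq, ← norm_bddToL2_sq, smul_eq_mul, mul_right_comm] at hsq
  refine (Real.le_sqrt_of_sq_le hsq).trans_eq ?_
  rw [Real.sqrt_mul' _ (sq_nonneg _), Real.sqrt_sq (norm_nonneg _)]

end CellTree

theorem exists_norm_bddToHardy_le {lam : ℝ} (hlam : -1 / 2 < lam) (q : ℝ≥0∞) [Fact (1 < q)]
    {R : Set (ℝ × ℝ)} (hR : IsRectangle R) :
    ∃ D : ℝ, ∀ f, ‖bddToHardy q hlam hR f‖ ≤ D * ‖bddToL2 lam R f‖ := by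
  obtain ⟨T, rfl, hT, hcell⟩ := hR.exists_partitionTree hlam
  obtain ⟨C, hC⟩ := exists_norm_toLp_bddToHardy_le hlam q hR
  obtain ⟨D, hD⟩ := exists_norm_bddToHardy_leafAverage_le hlam q hR hcell
  refine ⟨2 * D, norm_le_two_mul_of_forall_approx (i := LittleHardy.toLpCLM lam q)
    LittleHardy.toLp_injective hC fun f ε hε => ?_⟩
  obtain ⟨m, hm⟩ := ((T.tendsto_norm_bddToL2_sub_leafAverage hT f).eventually_le_const hε).exists
  exact ⟨T.leafAverage m f, hD m f, hm⟩

/-! ### Representation of functionals -/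

theorem exists_forall_eq_inner {V H : Type*} [AddCommGroup V] [Module ℂ V] [NormedAddCommGroup H]
    [InnerProductSpace ℂ H] [CompleteSpace H] {g : V →ₗ[ℂ] ℂ} {L : V →ₗ[ℂ] H} {C : ℝ}
    (hg : ∀ v, ‖g v‖ ≤ C * ‖L v‖) : ∃ y, ∀ v, g v = inner ℂ y (L v) := by
  have hker : g ∈ (LinearMap.ker L).dualAnnihilator := by
    refine (Submodule.mem_dualAnnihilator g).2 fun v hv => ?_
    simpa [LinearMap.mem_ker.1 hv] using hg v
  rw [← LinearMap.range_dualMap_eq_dualAnnihilator_ker] at hker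
  obtain ⟨g', rfl⟩ := hker
  obtain ⟨Λ, hΛ, -⟩ := exists_extension_norm_eq (LinearMap.range L)
    ((g'.domRestrict (LinearMap.range L)).mkContinuous C (by rintro ⟨-, v, rfl⟩; exact hg v))
  refine ⟨(InnerProductSpace.toDual ℂ H).symm Λ, fun v => ?_⟩
  rw [InnerProductSpace.toDual_symm_apply]
  exact (hΛ ⟨L v, LinearMap.mem_range_self L v⟩).symm

section Representation

variable {lam : ℝ} (hlam : -1 / 2 < lam) {q : ℝ≥0∞} {R : Set (ℝ × ℝ)}

theorem exists_representation [Fact (1 < q)] (hR : IsRectangle R)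
    (ℓ : LittleHardy lam q →L[ℂ] ℂ) : ∃ b : ℝ × ℝ → ℂ, Measurable b ∧
      IntegrableOn b R (planeMeasure lam) ∧ ∀ f : bddMeanZero lam R,
        ℓ (bddToHardy q hlam hR f) = ∫ x, b x * (f : ℝ × ℝ → ℂ) x ∂(planeMeasure lam) := by
  have hfinite : IsFiniteMeasure ((planeMeasure lam).restrict R) :=
    ⟨by rw [Measure.restrict_apply_univ]; exact (hR.measure_ne_top hlam).lt_top⟩
  obtain ⟨D, hD⟩ := exists_norm_bddToHardy_le hlam q hR
  obtain ⟨y, hy⟩ := exists_forall_eq_inner (g := ℓ.toLinearMap ∘ₗ bddToHardy q hlam hR)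
    (L := bddToL2 lam R) (C := ‖ℓ‖ * D) fun f => by
      rw [mul_assoc]
      exact ℓ.le_opNorm_of_le (hD f)
  have hyi : Integrable y ((planeMeasure lam).restrict R) := (Lp.memLp y).integrable one_le_two
  refine ⟨fun x => (starRingEnd ℂ) (y x),
    Complex.continuous_conj.measurable.comp (Lp.stronglyMeasurable y).measurable,
    hyi.congr' (Complex.continuous_conj.comp_aestronglyMeasurable hyi.1)
      (Filter.Eventually.of_forall fun x => (RCLike.norm_conj _).symm), fun f => ?_⟩
  rw [← setIntegral_eq_integral_of_forall_compl_eq_zero (s := R)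
    fun x hx => by rw [f.2.2.2.1 x hx, mul_zero]]
  refine (hy f).trans ((L2.inner_def _ _).trans (integral_congr_ae ?_))
  filter_upwards [coeFn_bddToL2 f] with x hx
  rw [hx, RCLike.inner_apply, mul_comm]

include hlam in
theorem exists_ae_eq_const_of_forall_integral_mul_eq_zero (hR : IsRectangle R) {b : ℝ × ℝ → ℂ}
    (hbm : Measurable b) (hb : IntegrableOn b R (planeMeasure lam))
    (h : ∀ f ∈ bddMeanZero lam R, ∫ x, b x * f x ∂(planeMeasure lam) = 0) :
    ∃ z, b =ᵐ[(planeMeasure lam).restrict R] fun _ => z := by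
  have hosc : meanOsc lam b R ≤ ENNReal.ofReal 0 :=
    meanOsc_le_of_forall_bddMeanZero hR.measurableSet (hR.measure_ne_zero hlam)
      (hR.measure_ne_top hlam) hbm hb fun f hf _ => by simp [h f hf]
  rw [ENNReal.ofReal_zero, nonpos_iff_eq_zero, meanOsc, mul_eq_zero, ENNReal.inv_eq_zero,
    or_iff_right (hR.measure_ne_top hlam), lintegral_eq_zero_iff (hbm.sub_const _).enorm] at hosc
  refine ⟨⨍ y in R, b y ∂(planeMeasure lam), ?_⟩
  filter_upwards [hosc] with x hx
  simpa [sub_eq_zero] using hx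

end Representation

/-! ### Exhaustion of the quadrant by squares -/

/-- The squares `(0, n + 1) × (0, n + 1)`, which exhaust the quadrant. -/
def square (n : ℕ) : Set (ℝ × ℝ) := Ioo 0 (n + 1 : ℝ) ×ˢ Ioo 0 (n + 1 : ℝ)

theorem isRectangle_square (n : ℕ) : IsRectangle (square n) :=
  isRectangle_iff.2 ⟨0, n + 1, 0, n + 1, le_rfl, by positivity, le_rfl, by positivity, rfl⟩

theorem square_mono : Monotone square := fun m n h =>
  have hle : (m : ℝ) + 1 ≤ n + 1 := by gcongr
  prod_mono (Ioo_subset_Ioo_right hle) (Ioo_subset_Ioo_right hle)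

theorem IsRectangle.exists_subset_square {R : Set (ℝ × ℝ)} (hR : IsRectangle R) :
    ∃ n, R ⊆ square n := by
  obtain ⟨a, b, c, d, ha, -, hc, -, rfl⟩ := isRectangle_iff.1 hR
  obtain ⟨n, hn⟩ := exists_nat_ge (max b d)
  refine ⟨n, prod_mono (Ioo_subset_Ioo ha ?_) (Ioo_subset_Ioo hc ?_)⟩
  · linarith [le_max_left b d]
  · linarith [le_max_right b d]

/-- The index of the first square which contains a given point of the quadrant. -/
def squareIndex (x : ℝ × ℝ) : ℕ := ⌊max x.1 x.2⌋₊

theorem measurable_squareIndex : Measurable squareIndex :=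
  (measurable_fst.max measurable_snd).nat_floor

theorem mem_square_squareIndex {x : ℝ × ℝ} (hx : x ∈ quadrant) : x ∈ square (squareIndex x) := by
  have := Nat.lt_floor_add_one (max x.1 x.2)
  exact ⟨⟨hx.1, (le_max_left _ _).trans_lt this⟩, hx.2, (le_max_right _ _).trans_lt this⟩

theorem squareIndex_le {x : ℝ × ℝ} {n : ℕ} (hx : x ∈ square n) : squareIndex x ≤ n := by
  refine Nat.lt_succ_iff.1 ((Nat.floor_lt (hx.1.1.le.trans (le_max_left _ _))).2 ?_)
  rw [Nat.cast_succ]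
  exact max_lt hx.1.2 hx.2.2

theorem square_subset_quadrant (n : ℕ) : square n ⊆ quadrant := fun _ hx => ⟨hx.1.1, hx.2.1⟩

theorem ae_mem_quadrant (lam : ℝ) : ∀ᵐ x ∂(planeMeasure lam), x ∈ quadrant := by
  have hline : ∀ᵐ x ∂(lineMeasure lam), x ∈ Ioi (0 : ℝ) :=
    (withDensity_absolutelyContinuous _ _).ae_le (ae_restrict_mem measurableSet_Ioi)
  filter_upwards [Measure.quasiMeasurePreserving_fst.ae hline,
    Measure.quasiMeasurePreserving_snd.ae hline] with x hfst hsnd using ⟨hfst, hsnd⟩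

theorem exists_measurable_forall_ae_eq_restrict_square {μ : Measure (ℝ × ℝ)}
    {b : ℕ → ℝ × ℝ → ℂ} (hbm : ∀ n, Measurable (b n))
    (hb : ∀ m n, m ≤ n → b m =ᵐ[μ.restrict (square m)] b n) :
    ∃ c : ℝ × ℝ → ℂ, Measurable c ∧ ∀ n, c =ᵐ[μ.restrict (square n)] b n := by
  refine ⟨fun x => b (squareIndex x) x,
    (measurable_from_prod_countable_right hbm : Measurable fun p : ℕ × (ℝ × ℝ) => b p.1 p.2).comp
      (measurable_squareIndex.prodMk measurable_id), fun n => ?_⟩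
  have hall : ∀ᵐ x ∂μ, ∀ m, m ≤ n → x ∈ square m → b m x = b n x :=
    ae_all_iff.2 fun m => Filter.eventually_imp_distrib_left.2 fun hmn =>
      (ae_restrict_iff' (isRectangle_square m).measurableSet).1 (hb m n hmn)
  filter_upwards [ae_restrict_of_ae hall, ae_restrict_mem (isRectangle_square n).measurableSet]
    with x hx hxn
  exact hx _ (squareIndex_le hxn) (mem_square_squareIndex (square_subset_quadrant n hxn))

section Global

variable {lam : ℝ} (hlam : -1 / 2 < lam)

include hlam in
theorem eq_of_ae_eq_const_of_average_eq {n : ℕ} {b : ℝ × ℝ → ℂ} {z w : ℂ}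
    (hb : b =ᵐ[(planeMeasure lam).restrict (square n)] fun _ => z)
    (hw : ⨍ x in square 0, b x ∂(planeMeasure lam) = w) : z = w := by
  rw [← hw, average_congr (ae_restrict_of_ae_restrict_of_subset (square_mono (Nat.zero_le n)) hb)]
  exact (setAverage_const ((isRectangle_square 0).measure_ne_zero hlam)
    ((isRectangle_square 0).measure_ne_top hlam) z).symm

include hlam in
theorem exists_ae_eq_const_of_forall_square {b : ℝ × ℝ → ℂ}
    (hb : ∀ n, ∃ z : ℂ, b =ᵐ[(planeMeasure lam).restrict (square n)] fun _ => z) :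
    ∃ z : ℂ, ∀ᵐ x ∂(planeMeasure lam), b x = z := by
  choose z hz using hb
  have hconst (n : ℕ) : z n = ⨍ x in square 0, b x ∂(planeMeasure lam) :=
    eq_of_ae_eq_const_of_average_eq hlam (hz n) rfl
  simp only [hconst] at hz
  refine ⟨⨍ x in square 0, b x ∂(planeMeasure lam), ?_⟩
  filter_upwards [ae_all_iff.2 fun n =>
    (ae_restrict_iff' (isRectangle_square n).measurableSet).1 (hz n), ae_mem_quadrant lam]
    with x hx hxq
  exact hx _ (mem_square_squareIndex hxq)

variable {q : ℝ≥0∞} [Fact (1 < q)]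

theorem exists_normalized_representation (ℓ : LittleHardy lam q →L[ℂ] ℂ) (n : ℕ) :
    ∃ b : ℝ × ℝ → ℂ, Measurable b ∧ IntegrableOn b (square n) (planeMeasure lam) ∧
      ⨍ x in square 0, b x ∂(planeMeasure lam) = 0 ∧ ∀ {R} (hR : IsRectangle R), R ⊆ square n →
        ∀ f : bddMeanZero lam R, ℓ (bddToHardy q hlam hR f) =
          ∫ x, b x * (f : ℝ × ℝ → ℂ) x ∂(planeMeasure lam) := by
  have hfin (n : ℕ) := (isRectangle_square n).measure_ne_top hlam
  have h0 := (isRectangle_square 0).measure_ne_zero hlam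
  obtain ⟨b, hbm, hbi, hb⟩ := exists_representation hlam (isRectangle_square n) ℓ
  set z := ⨍ x in square 0, b x ∂(planeMeasure lam)
  refine ⟨fun x => b x - z, hbm.sub_const _, Integrable.sub hbi (integrableOn_const (hfin n)),
    ?_, fun {R} hR hsub f => ?_⟩
  · rw [setAverage_eq, integral_sub (hbi.mono_set (square_mono (Nat.zero_le n)))
      (integrableOn_const (hfin 0)), smul_sub, ← setAverage_eq, ← setAverage_eq,
      setAverage_const h0 (hfin 0), sub_self]
  · have hf : bddToHardy q hlam (isRectangle_square n) ⟨f, bddMeanZero_mono hsub f.2⟩ =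
        bddToHardy q hlam hR f := LittleHardy.toLp_injective rfl
    rw [← hf, hb]
    simp only [sub_mul]
    rw [integral_sub (integrable_mul_of_mem_bddMeanZero (hbi.mono_set hsub) f.2)
      (f.2.2.1.const_mul _), integral_const_mul, f.2.2.2.2.2, mul_zero, sub_zero]

theorem exists_global_representation (ℓ : LittleHardy lam q →L[ℂ] ℂ) :
    ∃ b : ℝ × ℝ → ℂ, Measurable b ∧
      (∀ R, IsRectangle R → IntegrableOn b R (planeMeasure lam)) ∧
      ∀ R (hR : IsRectangle R) (f : bddMeanZero lam R),
        ℓ (bddToHardy q hlam hR f) = ∫ x, b x * (f : ℝ × ℝ → ℂ) x ∂(planeMeasure lam) := by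
  choose b hbm hbi hbavg hb using exists_normalized_representation hlam ℓ
  have hagree (m n : ℕ) (hmn : m ≤ n) : b m =ᵐ[(planeMeasure lam).restrict (square m)] b n := by
    have hsub := square_mono hmn
    have hbn := (hbi n).mono_set hsub
    obtain ⟨z, hz⟩ := exists_ae_eq_const_of_forall_integral_mul_eq_zero hlam
      (isRectangle_square m) ((hbm m).sub (hbm n)) (Integrable.sub (hbi m) hbn) fun f hf => by
        simp only [Pi.sub_apply, sub_mul]
        rw [integral_sub (integrable_mul_of_mem_bddMeanZero (hbi m) hf)
          (integrable_mul_of_mem_bddMeanZero hbn hf), sub_eq_zero,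
          ← hb m (isRectangle_square m) subset_rfl ⟨f, hf⟩,
          ← hb n (isRectangle_square m) hsub ⟨f, hf⟩]
    have hz₀ : z = 0 := eq_of_ae_eq_const_of_average_eq hlam hz <| by
      have hsub₀ (n : ℕ) := square_mono (Nat.zero_le n)
      simp only [Pi.sub_apply]
      rw [setAverage_eq, integral_sub ((hbi m).mono_set (hsub₀ m)) ((hbi n).mono_set (hsub₀ n)),
        smul_sub, ← setAverage_eq, ← setAverage_eq, hbavg, hbavg, sub_self]
    filter_upwards [hz] with x hx
    exact sub_eq_zero.1 (hx.trans hz₀)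
  obtain ⟨c, hcm, hc⟩ := exists_measurable_forall_ae_eq_restrict_square hbm hagree
  refine ⟨c, hcm, fun R hR => ?_, fun R hR f => ?_⟩ <;>
    obtain ⟨n, hn⟩ := hR.exists_subset_square
  · exact IntegrableOn.mono_set (Integrable.congr (hbi n) (hc n).symm) hn
  · rw [hb n hR hn f]
    refine integral_congr_ae ?_
    filter_upwards [(ae_restrict_iff' (isRectangle_square n).measurableSet).1 (hc n)] with x hx
    by_cases hxR : x ∈ R
    · rw [hx (hn hxR)]
    · rw [f.2.2.2.1 x hxR, mul_zero, mul_zero]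

end Global

/-! ### Density of bounded functions -/

theorem enorm_average_le {X E : Type*} [MeasurableSpace X] [NormedAddCommGroup E] [NormedSpace ℝ E]
    (μ : Measure X) [IsFiniteMeasure μ] [NeZero μ] (f : X → E) :
    ‖⨍ x, f x ∂μ‖ₑ ≤ (μ univ)⁻¹ * eLpNorm f 1 μ := by
  rw [average, eLpNorm_one_eq_lintegral_enorm, ← smul_eq_mul, ← lintegral_smul_measure]
  exact enorm_integral_le_lintegral_enorm f

theorem eLpNorm_average_le {X E : Type*} [MeasurableSpace X] [NormedAddCommGroup E]
    [NormedSpace ℝ E] {μ : Measure X} [IsFiniteMeasure μ] {q : ℝ≥0∞} (hq : 1 ≤ q) {f : X → E}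
    (hf : AEStronglyMeasurable f μ) : eLpNorm (fun _ => ⨍ x, f x ∂μ) q μ ≤ eLpNorm f q μ := by
  rcases eq_zero_or_neZero μ with rfl | hμ
  · simp
  have h₀ : μ univ ≠ 0 := Measure.measure_univ_ne_zero.2 hμ.out
  have hfin : μ univ ≠ ∞ := measure_ne_top μ univ
  rw [eLpNorm_const _ (zero_lt_one.trans_le hq).ne' hμ.out]
  calc ‖⨍ x, f x ∂μ‖ₑ * μ univ ^ (1 / q.toReal)
      ≤ (μ univ)⁻¹ * (eLpNorm f q μ * μ univ ^ (1 - 1 / q.toReal)) * μ univ ^ (1 / q.toReal) := by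
        gcongr
        refine (enorm_average_le μ f).trans ?_
        gcongr
        simpa using eLpNorm_le_eLpNorm_mul_rpow_measure_univ hq hf
    _ = eLpNorm f q μ := by
        rw [mul_assoc, mul_assoc, ← ENNReal.rpow_add _ _ h₀ hfin, sub_add_cancel, ENNReal.rpow_one,
          mul_left_comm, ENNReal.inv_mul_cancel h₀ hfin, mul_one]

theorem eLpNorm_sub_average_le {X E : Type*} [MeasurableSpace X] [NormedAddCommGroup E]
    [NormedSpace ℝ E] {μ : Measure X} [IsFiniteMeasure μ] {q : ℝ≥0∞} (hq : 1 ≤ q) {f : X → E}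
    (hf : AEStronglyMeasurable f μ) :
    eLpNorm (fun x => f x - ⨍ y, f y ∂μ) q μ ≤ 2 * eLpNorm f q μ := by
  refine (eLpNorm_sub_le hf aestronglyMeasurable_const hq).trans ?_
  rw [two_mul]
  gcongr
  exact eLpNorm_average_le hq hf

theorem exists_bounded_ae_eq {X E : Type*} [MeasurableSpace X] [NormedAddCommGroup E]
    {μ : Measure X} {f : X → E} (hf : MemLp f ∞ μ) :
    ∃ g, StronglyMeasurable g ∧ (∃ K : ℝ, ∀ x, ‖g x‖ ≤ K) ∧ f =ᵐ[μ] g := by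
  obtain ⟨f', hf', hff'⟩ := hf.1
  have hK : ∀ᵐ x ∂μ, ‖f x‖ ≤ (eLpNorm f ∞ μ).toReal := by
    filter_upwards [ae_le_eLpNormEssSup (f := f) (μ := μ)] with x hx
    rw [← toReal_enorm, eLpNorm_exponent_top]
    exact ENNReal.toReal_mono (eLpNorm_exponent_top (f := f) ▸ hf.2.ne) hx
  set K := (eLpNorm f ∞ μ).toReal
  refine ⟨{x | ‖f' x‖ ≤ K}.indicator f',
    hf'.indicator (hf'.norm.measurableSet_le stronglyMeasurable_const), ⟨K, fun x => ?_⟩, ?_⟩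
  · rw [norm_indicator_eq_indicator_norm]
    exact indicator_apply_le' id fun _ => ENNReal.toReal_nonneg
  · filter_upwards [hff', hK] with x hx hxK
    rw [hx] at hxK ⊢
    exact (indicator_of_mem (s := {x | ‖f' x‖ ≤ K}) hxK f').symm

theorem exists_bounded_eLpNorm_sub_le {X E : Type*} [MeasurableSpace X] [NormedAddCommGroup E]
    {μ : Measure X} {q : ℝ≥0∞} {f : X → E} (hf : MemLp f q μ) {ε : ℝ≥0∞} (hε : ε ≠ 0) :
    ∃ g, StronglyMeasurable g ∧ (∃ K : ℝ, ∀ x, ‖g x‖ ≤ K) ∧ eLpNorm (f - g) q μ ≤ ε := by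
  rcases eq_or_ne q ∞ with rfl | hq
  · obtain ⟨g, hg, hK, hfg⟩ := exists_bounded_ae_eq hf
    refine ⟨g, hg, hK, ?_⟩
    rw [eLpNorm_congr_ae (hfg.sub (ae_eq_refl g)), sub_self, eLpNorm_zero]
    exact zero_le
  · obtain ⟨g, hg, -⟩ := hf.exists_simpleFunc_eLpNorm_sub_lt hq hε
    exact ⟨g, g.stronglyMeasurable, g.exists_forall_norm_le, hg.le⟩

theorem eLpNorm_sub_indicator_sub_average_le {X E : Type*} [MeasurableSpace X]
    [NormedAddCommGroup E] [NormedSpace ℝ E] {μ : Measure X} {R : Set X} (hR : MeasurableSet R)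
    (hfin : μ R ≠ ∞) {q : ℝ≥0∞} (hq : 1 ≤ q) {f g : X → E} (hf : IntegrableOn f R μ)
    (hg : IntegrableOn g R μ) (hsupp : ∀ᵐ x ∂μ, x ∉ R → f x = 0) (hint : ∫ x, f x ∂μ = 0) :
    eLpNorm (fun x => f x - R.indicator (fun x => g x - ⨍ y in R, g y ∂μ) x) q μ ≤
      2 * eLpNorm (f - g) q (μ.restrict R) := by
  have : IsFiniteMeasure (μ.restrict R) := isFiniteMeasure_restrict.2 hfin
  have havg : ⨍ y in R, (f - g) y ∂μ = -⨍ y in R, g y ∂μ := by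
    have hfR : ∫ x in R, f x ∂μ = 0 := by
      rw [setIntegral_eq_integral_of_ae_compl_eq_zero hsupp, hint]
    simp only [setAverage_eq, Pi.sub_apply]
    rw [integral_sub hf hg, hfR, zero_sub, smul_neg]
  refine le_of_eq_of_le ?_ (eLpNorm_sub_average_le hq (hf.sub hg).aestronglyMeasurable)
  rw [← eLpNorm_indicator_eq_eLpNorm_restrict hR, havg]
  refine eLpNorm_congr_ae ?_
  filter_upwards [hsupp] with x hx
  by_cases hxR : x ∈ R
  · simp only [indicator_of_mem hxR, Pi.sub_apply, sub_neg_eq_add]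
    abel
  · simp only [indicator_of_notMem hxR, hx hxR, sub_zero]

theorem IsAtom.exists_littleHardy {lam : ℝ} {q : ℝ≥0∞} [Fact (1 < q)]
    {a : Lp ℂ 1 (planeMeasure lam)} (ha : IsAtom lam q a) :
    ∃ u : LittleHardy lam q, u.toLp = a ∧ ‖u‖ ≤ 1 := by
  obtain ⟨hmem, ⟨R, hR, hsupp, hle⟩, hint⟩ := ha
  exact exists_toLp_eq_of_eLpNorm_le hmem hR hsupp hint zero_le_one (by simpa using hle)

section Density

variable {lam : ℝ} (hlam : -1 / 2 < lam) {q : ℝ≥0∞} {R : Set (ℝ × ℝ)}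

theorem norm_sub_bddToHardy_le (hR : IsRectangle R) {u : LittleHardy lam q}
    (hsupp : ∀ᵐ x ∂(planeMeasure lam), x ∉ R → u.toLp x = 0)
    (hint : ∫ x, u.toLp x ∂(planeMeasure lam) = 0) (f : bddMeanZero lam R) {A : ℝ} (hA : 0 ≤ A)
    (hle : eLpNorm (fun x => u.toLp x - (f : ℝ × ℝ → ℂ) x) q (planeMeasure lam) ≤
      ENNReal.ofReal A * planeMeasure lam R ^ ((q⁻¹).toReal - 1)) :
    ‖u - bddToHardy q hlam hR f‖ ≤ A := by
  set d := u - bddToHardy q hlam hR f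
  have hd : (d.toLp : ℝ × ℝ → ℂ) =ᵐ[planeMeasure lam]
      fun x => u.toLp x - (f : ℝ × ℝ → ℂ) x := by
    filter_upwards [Lp.coeFn_sub u.toLp (bddToHardy q hlam hR f).toLp,
      coeFn_bddToHardy q hlam hR f] with x hx hf
    rw [← hf]
    exact hx
  rw [← eLpNorm_congr_ae hd] at hle
  have htop : planeMeasure lam R ^ ((q⁻¹).toReal - 1) < ∞ :=
    (ENNReal.rpow_ne_top_of_ne_zero (hR.measure_ne_zero hlam) (hR.measure_ne_top hlam)).lt_top
  obtain ⟨w, hw, hnorm⟩ := exists_toLp_eq_of_eLpNorm_le (q := q) (f := d.toLp)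
    ⟨Lp.aestronglyMeasurable _, hle.trans_lt (ENNReal.mul_lt_top ENNReal.ofReal_lt_top htop)⟩ hR
    (by
      filter_upwards [hd, hsupp] with x hx hu hxR
      rw [hx, hu hxR, f.2.2.2.1 x hxR, sub_zero])
    (by
      rw [integral_congr_ae hd, integral_sub (L1.integrable_coeFn _) f.2.2.1, hint,
        f.2.2.2.2.2, sub_zero]) hA hle
  rwa [LittleHardy.toLp_injective hw] at hnorm

theorem exists_norm_sub_bddToHardy_le [hq : Fact (1 < q)] {u : LittleHardy lam q}
    (hu : IsAtom lam q u.toLp) {ε : ℝ} (hε : 0 < ε) :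
    ∃ (R : Set (ℝ × ℝ)) (hR : IsRectangle R) (f : bddMeanZero lam R),
      ‖u - bddToHardy q hlam hR f‖ ≤ ε := by
  obtain ⟨hmem, ⟨R, hR, hsupp, -⟩, hint⟩ := hu
  have hfin := hR.measure_ne_top hlam
  have hδ : ENNReal.ofReal (ε / 2) * planeMeasure lam R ^ ((q⁻¹).toReal - 1) ≠ 0 :=
    mul_ne_zero (by simpa using hε)
      (ENNReal.rpow_pos (pos_iff_ne_zero.2 (hR.measure_ne_zero hlam)) hfin).ne'
  obtain ⟨g, hg, ⟨K, hK⟩, hug⟩ := exists_bounded_eLpNorm_sub_le (hmem.restrict R) hδ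
  refine ⟨R, hR, ⟨_, indicator_sub_average_mem hR.measurableSet hfin hg.measurable hK⟩,
    norm_sub_bddToHardy_le hlam hR hsupp hint _ hε.le ?_⟩
  refine (eLpNorm_sub_indicator_sub_average_le hR.measurableSet hfin hq.out.le
    (L1.integrable_coeFn _).integrableOn (Measure.integrableOn_of_bounded hfin
      hg.aestronglyMeasurable (Filter.Eventually.of_forall hK)) hsupp hint).trans ?_
  refine (mul_le_mul_right hug 2).trans_eq ?_
  rw [← mul_assoc, ← ENNReal.ofReal_ofNat 2, ← ENNReal.ofReal_mul (by norm_num),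
    mul_div_cancel₀ ε two_ne_zero]

end Density

/-! ### The duality -/

section Duality

variable {lam : ℝ} {q : ℝ≥0∞} [Fact (1 < q)]

theorem LittleHardy.hasSum_of_decomposition {f : LittleHardy lam q} {α : ℕ → ℂ}
    {u : ℕ → LittleHardy lam q} (hu : ∀ i, ‖u i‖ ≤ 1)
    (hd : IsAtomicDecomposition lam q f.toLp α fun i => (u i).toLp) :
    HasSum (fun i => α i • u i) f := by
  have hs : Summable fun i => α i • u i := Summable.of_norm_bounded hd.summable fun i => by
    rw [norm_smul]
    exact mul_le_of_le_one_right (norm_nonneg _) (hu i)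
  have hf : f = ∑' i, α i • u i := LittleHardy.toLp_injective <|
    hd.hasSum.unique <| ((LittleHardy.toLpCLM lam q).hasSum hs.hasSum).congr_fun fun i => by
      rw [map_smul, LittleHardy.toLpCLM_apply]
  rw [hf]
  exact hs.hasSum

theorem eq_of_forall_isAtom {ℓ ℓ' : LittleHardy lam q →L[ℂ] ℂ}
    (h : ∀ u : LittleHardy lam q, IsAtom lam q u.toLp → ℓ u = ℓ' u) : ℓ = ℓ' := by
  ext f
  obtain ⟨α, a, hd⟩ := f.mem
  choose u hu hnorm using fun i => (hd.isAtom i).exists_littleHardy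
  obtain rfl : (fun i => (u i).toLp) = a := funext hu
  have hs := LittleHardy.hasSum_of_decomposition hnorm hd
  refine (ℓ.hasSum hs).unique ((ℓ'.hasSum hs).congr_fun fun i => ?_)
  rw [map_smul, map_smul, h (u i) (hd.isAtom i)]

variable (hlam : -1 / 2 < lam)

theorem eq_of_forall_bddToHardy {ℓ ℓ' : LittleHardy lam q →L[ℂ] ℂ}
    (h : ∀ R (hR : IsRectangle R) (f : bddMeanZero lam R),
      ℓ (bddToHardy q hlam hR f) = ℓ' (bddToHardy q hlam hR f)) : ℓ = ℓ' := by
  refine eq_of_forall_isAtom fun u hu => ?_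
  have hclosure : u ∈ closure {v | ℓ v = ℓ' v} := Metric.mem_closure_iff.2 fun ε hε => by
    obtain ⟨R, hR, f, hf⟩ := exists_norm_sub_bddToHardy_le hlam hu (half_pos hε)
    exact ⟨_, h R hR f, (dist_eq_norm u _).trans_lt (hf.trans_lt (half_lt_self hε))⟩
  rwa [(isClosed_eq ℓ.continuous ℓ'.continuous).closure_eq] at hclosure

theorem dualityMap_surjective : Function.Surjective (dualityMap hlam q) := by
  intro ℓ
  obtain ⟨b, hbm, hbi, hb⟩ := exists_global_representation hlam ℓ
  have hmem : MemBMO lam b := by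
    refine ⟨fun x hx => ⟨square (squareIndex x), mem_nhdsWithin_of_mem_nhds
      ((isOpen_Ioo.prod isOpen_Ioo).mem_nhds (mem_square_squareIndex hx)),
      hbi _ (isRectangle_square _)⟩, ?_⟩
    exact (bmoNorm_le_of_forall_bddMeanZero hlam hbm hbi ℓ hb).trans_lt ENNReal.ofReal_lt_top
  have hmk := AEEqFun.coeFn_mk b hbm.aestronglyMeasurable (μ := planeMeasure lam)
  let B : LittleBMO lam := ⟨AEEqFun.mk b hbm.aestronglyMeasurable, memBMO_congr hmk.symm hmem⟩
  refine ⟨B, eq_of_forall_bddToHardy hlam fun R hR f => ?_⟩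
  rw [dualityMap_bddToHardy hlam q B hR f, hb R hR f]
  refine integral_congr_ae ?_
  filter_upwards [hmk] with x hx
  exact congrArg (· * _) hx

theorem dualityMap_eq_zero_iff (b : LittleBMO lam) :
    dualityMap hlam q b = 0 ↔ ∃ c : ℂ, ∀ᵐ x ∂(planeMeasure lam), b x = c := by
  constructor
  · intro h
    refine exists_ae_eq_const_of_forall_square hlam fun n =>
      exists_ae_eq_const_of_forall_integral_mul_eq_zero hlam (isRectangle_square n) b.measurable
        (b.integrableOn hlam (isRectangle_square n)) fun f hf => ?_
    rw [← dualityMap_bddToHardy hlam q b (isRectangle_square n) ⟨f, hf⟩, h, zero_apply]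
  · rintro ⟨c, hc⟩
    refine eq_of_forall_bddToHardy hlam fun R hR f => ?_
    rw [dualityMap_bddToHardy hlam q b hR f, zero_apply]
    have hcongr : (fun x => b x * (f : ℝ × ℝ → ℂ) x) =ᵐ[planeMeasure lam]
        fun x => c * (f : ℝ × ℝ → ℂ) x := by
      filter_upwards [hc] with x hx
      rw [hx]
    rw [integral_congr_ae hcongr, integral_const_mul, f.2.2.2.2.2, mul_zero]

theorem exists_norm_dualityMap_equiv (q : ℝ≥0∞) [Fact (1 < q)] :
    ∃ C : ℝ, 0 < C ∧ ∀ b : LittleBMO lam,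
      C⁻¹ * ‖b‖ ≤ ‖dualityMap hlam q b‖ ∧ ‖dualityMap hlam q b‖ ≤ C * ‖b‖ := by
  obtain ⟨K, hK, hle⟩ := exists_norm_dualityMap_le hlam q
  refine ⟨max K 2, hK.trans_le (le_max_left K 2), fun b => ⟨?_, (hle b).trans ?_⟩⟩
  · rw [inv_mul_le_iff₀ (hK.trans_le (le_max_left K 2))]
    refine (norm_le_two_mul_norm_dualityMap hlam q b).trans ?_
    gcongr
    exact le_max_right K 2
  · gcongr
    exact le_max_left K 2

end Duality

end Bessel

end

theorem mainTheorem7_general (lam : ℝ) (hlam : -1 / 2 < lam) (q : ℝ≥0∞) [Fact (1 < q)] :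
    CompleteSpace (Bessel.LittleHardy lam q) ∧
    ∃ Φ : Bessel.LittleBMO lam →ₗ[ℂ] (Bessel.LittleHardy lam q →L[ℂ] ℂ),
      (∀ (b : Bessel.LittleBMO lam) (f : Bessel.LittleHardy lam q),
        f.toLp ∈ Submodule.span ℂ {a | Bessel.IsAtom lam q a} →
          Integrable (fun x => b x * f.toLp x) (Bessel.planeMeasure lam) ∧
          Φ b f = ∫ x, b x * f.toLp x ∂(Bessel.planeMeasure lam)) ∧
      Function.Surjective Φ ∧
      (∀ b : Bessel.LittleBMO lam,
        Φ b = 0 ↔ ∃ c : ℂ, ∀ᵐ x ∂(Bessel.planeMeasure lam), b x = c) ∧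
      ∃ C : ℝ, 0 < C ∧ ∀ b : Bessel.LittleBMO lam, C⁻¹ * ‖b‖ ≤ ‖Φ b‖ ∧ ‖Φ b‖ ≤ C * ‖b‖ := by
  refine ⟨inferInstance, Bessel.dualityMap hlam q, fun b f hf => ?_,
    Bessel.dualityMap_surjective hlam, Bessel.dualityMap_eq_zero_iff hlam,
    Bessel.exists_norm_dualityMap_equiv hlam q⟩
  have hint := Bessel.integrable_mul_of_mem_span hlam b hf
  exact ⟨hint, (Bessel.dualityMap_apply hlam q b f).trans (Bessel.pairing_eq_integral hlam b hint)⟩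

theorem mainTheorem7 (lam : ℝ) (hlam : 0 < lam) (q : ℝ≥0∞) [Fact (1 < q)] :
    CompleteSpace (Bessel.LittleHardy lam q) ∧
    ∃ Φ : Bessel.LittleBMO lam →ₗ[ℂ] (Bessel.LittleHardy lam q →L[ℂ] ℂ),
      (∀ (b : Bessel.LittleBMO lam) (f : Bessel.LittleHardy lam q),
        f.toLp ∈ Submodule.span ℂ {a | Bessel.IsAtom lam q a} →
          Integrable (fun x => b x * f.toLp x) (Bessel.planeMeasure lam) ∧
          Φ b f = ∫ x, b x * f.toLp x ∂(Bessel.planeMeasure lam)) ∧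
      Function.Surjective Φ ∧
      (∀ b : Bessel.LittleBMO lam,
        Φ b = 0 ↔ ∃ c : ℂ, ∀ᵐ x ∂(Bessel.planeMeasure lam), b x = c) ∧
      ∃ C : ℝ, 0 < C ∧ ∀ b : Bessel.LittleBMO lam, C⁻¹ * ‖b‖ ≤ ‖Φ b‖ ∧ ‖Φ b‖ ≤ C * ‖b‖ := by
  exact mainTheorem7_general lam (by linarith) q
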